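/- **Proposition 5.5 (Tightness of the empirical density fields).** Let $d\ge 1$ and write $|x-y|=\sum_{i}|x_i-y_i|$ on $\mathbb Z^d$. Let $\lambda=\{\lambda_t(\{x,y\}) : |x-y|=1,\ t\ge 0\}$ be an environment of non-negative conductances on the nearest-neighbour bonds of $\mathbb Z^d$, càdlàg in $t$, and bounded: $\lambda_t(\{x,y\})\le\alpha$ for some constant $\alpha$, all bonds and all $t\ge0$. For each $N\in\mathbb N=\{1,2,\dots\}$ let $\{\eta^N_t, t\ge 0\}$, on a probability space with probability $\mathbb P_N$, be a symmetric simple exclusion process in the environment $\lambda$, that is, a càdlàg process in $\{0,1\}^{\mathbb Z^d}$ solving the martingale problem for the time-dependent generator $$L_t\varphi(\eta)=\sum_{\{x,y\}:|x-y|=1}\lambda_t(\{x,y\})\Big(\eta(x)(1-\eta(y))\big(\varphi(\eta^{x,y})-\varphi(\eta)\big)+\eta(y)(1-\eta(x))\big(\varphi(\eta^{y,x})-\varphi(\eta)\big)\Big)$$ on cylinder functions $\varphi$, where $\eta^{x,y}$ is $\eta$ with the particle at $x$ moved to $y$. The initial configuration is arbitrary (it may be random and depend on $N$; in particular one may take for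 all $N$ one and the same process started from a fixed $\eta\in\{0,1\}^{\mathbb Z^d}$). Let $$X^N_t(G)=\frac1{N^d}\sum_{x\in\mathbb Z^d}G\!\left(\tfrac xN\right)\eta^N_{tN^2}(x),\qquad G\in\mathcal S(\mathbb R^d),\ t\ge0,$$ let $\mathcal F^N_t$ be generated by all $X^N_s(G)$, $s\le t$, $G\in\mathcal S(\mathbb R^d)$, and let $T>0$. Then for every $G\in\mathcal S(\mathbb R^d)$: (T1) for all $t\in[0,T]$, $\ \lim_{m\to\infty}\limsup_{N\to\infty}\mathbb P_N(|X^N_t(G)|>m)=0$; (T2) for all $\varepsilon>0$ there exist $h_\varepsilon>0$, $N_\varepsilon\in\mathbb N$, deterministic functions $\psi^N_\varepsilon,\psi_\varepsilon:[0,h_\varepsilon]\to[0,\infty)$ and numbers $\phi^N_\varepsilon\ge0$ such that, for all $N\ge N_\varepsilon$: (i) $\psi^N_\varepsilon$ is non-decreasing; (ii) for all $h\in[0,h_\varepsilon]$ and $t\in[0,T]$, $\ \mathbb P_N\big(|X^N_{t+h}(G)-X^N_t(G)|>\varepsilon\,\big|\,\mathcal F^N_t\big)\le\psi^N_\varepsilon(h)$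 almost surely; (iii) $\psi^N_\varepsilon(h)\le\psi_\varepsilon(h)+\phi^N_\varepsilon$ for all $h\in[0,h_\varepsilon]$; and moreover (iv) $\phi^N_\varepsilon\to0$ as $N\to\infty$; (v) $\psi_\varepsilon(h)\to0$ as $h\downarrow0$. Moreover, the sequence $\{X^N_t, t\in[0,T]\}$, $N\in\mathbb N$, is tight in the Skorokhod space $D([0,T],\mathcal S'(\mathbb R^d))$ of càdlàg paths in $\mathcal S'(\mathbb R^d)$ (with the strong dual topology): for every $\varepsilon>0$ there is a compact set $K\subset D([0,T],\mathcal S'(\mathbb R^d))$ such that, for every $N$, the path $\{X^N_t, t\in[0,T]\}$ lies in $K$ up to an event of probability at most $\varepsilon$. -/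

import Mathlib

open MeasureTheory ProbabilityTheory Filter Topology
open scoped NNReal ENNReal SchwartzMap

/-- The lattice `ℤ^d`. -/
abbrev Site (d : ℕ) : Type := Fin d → ℤ
/-- Configurations of particles, `{0,1}^(ℤ^d)`: `true` is an occupied site. Topology and
σ-algebra are the product ones. -/
abbrev Config (d : ℕ) : Type := Site d → Bool
/-- The Euclidean space `ℝ^d`. -/
abbrev Space (d : ℕ) : Type := EuclideanSpace ℝ (Fin d)
/-- The occupation number `ξ(x) ∈ {0,1}`. -/
def occ {d : ℕ} (ξ : Config d) (x : Site d) : ℝ := if ξ x then 1 else 0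
/-- The point `x / N` of `ℝ^d`. -/
noncomputable def rescale {d : ℕ} (N : ℕ+) (x : Site d) : Space d :=
  WithLp.toLp 2 fun i => (x i : ℝ) / (N : ℝ)

/-- `x` and `y` are nearest neighbours, `|x - y| = ∑ i, |x i - y i| = 1`. -/
def Nbr {d : ℕ} (x y : Site d) : Prop := ∑ i, |x i - y i| = 1

instance {d : ℕ} (x y : Site d) : Decidable (Nbr x y) :=
  inferInstanceAs (Decidable (∑ i, |x i - y i| = 1))

/-- Right-continuous functions with left limits (in a time set with a first element there is no
condition on the left limit at that element, as `𝓝[<] t = ⊥` there). -/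
def IsCadlag {ι E : Type*} [TopologicalSpace ι] [Preorder ι] [TopologicalSpace E]
    (f : ι → E) : Prop :=
  ∀ t, ContinuousWithinAt f (Set.Ici t) t ∧ ∃ l, Tendsto f (𝓝[<] t) (𝓝 l)

/-- A dynamic environment: non-negative conductances `rate t x y` on the bonds `{x, y}` of the
lattice, càdlàg in time. Only the values at nearest neighbours matter. -/
structure Environment (d : ℕ) where
  rate : ℝ≥0 → Site d → Site d → ℝ
  symm : ∀ t x y, Nbr x y → rate t x y = rate t y x
  nonneg : ∀ t x y, Nbr x y → 0 ≤ rate t x y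
  cadlag : ∀ x y, Nbr x y → IsCadlag fun t => rate t x y

/-- The configuration `ξ^{x,y}`: the particle at `x` is moved to `y`. -/
def moveParticle {d : ℕ} (ξ : Config d) (x y : Site d) : Config d :=
  Function.update (Function.update ξ x false) y true

/-- Functions of finitely many occupation variables. (These are automatically bounded.) -/
def IsCylinder {d : ℕ} (φ : Config d → ℝ) : Prop :=
  ∃ A : Finset (Site d), DependsOn φ (A : Set (Site d))

/-- The generator `L_t` of the symmetric simple exclusion process in the environment `lam`:
`∑_{ {x,y} } λ_t({x,y}) (ξ(x)(1-ξ(y))(φ(ξ^{x,y})-φ(ξ)) + ξ(y)(1-ξ(x))(φ(ξ^{y,x})-φ(ξ)))`,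
a sum over unordered pairs of neighbours, written as the sum over ordered pairs `p = (x, y)` of the
terms in which a particle moves from `x` to `y`. Only finitely many terms are non-zero for
a cylinder function `φ`. -/
noncomputable def generator {d : ℕ} (lam : Environment d) (t : ℝ≥0) (φ : Config d → ℝ)
    (ξ : Config d) : ℝ :=
  ∑' p : Site d × Site d, if Nbr p.1 p.2 then
    lam.rate t p.1 p.2 *
      (occ ξ p.1 * (1 - occ ξ p.2) * (φ (moveParticle ξ p.1 p.2) - φ ξ)) else 0

/-- `η` is a symmetric simple exclusion process in the environment `lam` (with respect to the
filtration `𝓕`, from an arbitrary initial configuration): an adapted process with càdlàg paths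
that solves the martingale problem for the time-dependent generator `L_t` on cylinder functions. -/
structure IsSSEP {d : ℕ} (lam : Environment d) {Ω : Type*} [mΩ : MeasurableSpace Ω]
    (P : Measure Ω) (𝓕 : Filtration ℝ≥0 mΩ) (η : ℝ≥0 → Ω → Config d) : Prop where
  adapted : ∀ t, Measurable[𝓕 t] (η t)
  cadlag : ∀ ω, IsCadlag fun t => η t ω
  martingale : ∀ φ : Config d → ℝ, IsCylinder φ →
    Martingale (fun (t : ℝ≥0) (ω : Ω) => φ (η t ω) -
      ∫ s in (0 : ℝ)..t, generator lam s.toNNReal φ (η s.toNNReal ω)) 𝓕 P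

theorem IsSSEP.measurable {d : ℕ} {lam : Environment d} {Ω : Type*} [mΩ : MeasurableSpace Ω]
    {P : Measure Ω} {𝓕 : Filtration ℝ≥0 mΩ} {η : ℝ≥0 → Ω → Config d}
    (h : IsSSEP lam P 𝓕 η) (t : ℝ≥0) : Measurable (η t) :=
  (h.adapted t).mono (𝓕.le t) le_rfl

/-! Absolute convergence of the sums over the lattice that define the density field. -/
theorem summable_site (d : ℕ) :
    Summable fun x : Site d => ((1 + ‖fun i => (x i : ℝ)‖) ^ (d + 1))⁻¹ := by
  let b := Pi.basisFun ℝ (Fin d)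
  let L : Submodule ℤ (Fin d → ℝ) := Submodule.span ℤ (Set.range b)
  have hfin : Module.finrank ℤ L = d := by
    rw [Module.finrank_eq_card_basis (b.restrictScalars ℤ)]; simp
  have h := ZLattice.summable_norm_pow_inv L (d + 1) (by omega)
  let e : Site d ≃ L := (b.restrictScalars ℤ).equivFun.symm.toEquiv
  have he : ∀ x : Site d, ((e x : L) : Fin d → ℝ) = fun i => (x i : ℝ) := by
    intro x
    funext i
    simp [e, b, Module.Basis.equivFun_symm_apply, Finset.sum_apply, Pi.single_apply]
  have h2 := (e.summable_iff).2 h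
  refine Summable.of_norm_bounded_eventually h2 ?_
  rw [Filter.eventually_cofinite]
  refine (Set.finite_singleton (0 : Site d)).subset ?_
  intro x hx
  by_contra hne
  apply hx
  have hx0 : (fun i => (x i : ℝ)) ≠ 0 := by
    intro h0
    apply hne
    funext i
    have := congrFun h0 i
    simpa using this
  have hpos : 0 < ‖fun i => (x i : ℝ)‖ := norm_pos_iff.2 hx0
  simp only [Function.comp, Submodule.coe_norm, he, norm_inv, norm_pow]
  have : ‖1 + ‖fun i => (x i : ℝ)‖‖ = 1 + ‖fun i => (x i : ℝ)‖ := by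
    rw [Real.norm_eq_abs, abs_of_pos]; positivity
  rw [this]
  rw [inv_pow]
  refine inv_anti₀ (pow_pos hpos _) (pow_le_pow_left₀ hpos.le ?_ _)
  linarith

theorem exists_empirical_bound (d : ℕ) (N : ℕ+) : ∃ w : Site d → ℝ, Summable w ∧
    ∀ (G : 𝓢(Space d, ℝ)) (x : Site d), ‖G (rescale N x)‖ ≤
      ((Finset.Iic (d + 1, 0)).sup (schwartzSeminormFamily ℝ (Space d) ℝ)) G * w x := by
  refine ⟨fun x => 2 ^ (d + 1) * (N : ℝ) ^ (d + 1) *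
    ((1 + ‖fun i => (x i : ℝ)‖) ^ (d + 1))⁻¹, (summable_site d).mul_left _, fun G x => ?_⟩
  have h := SchwartzMap.one_add_le_sup_seminorm_apply (𝕜 := ℝ) (m := (d + 1, 0)) (k := d + 1)
    (n := 0) le_rfl le_rfl G (rescale N x)
  rw [norm_iteratedFDeriv_zero] at h
  have hN : (1 : ℝ) ≤ N := by exact_mod_cast N.pos
  have hN0 : (0 : ℝ) < N := by linarith
  have h1 : ‖fun i => (x i : ℝ)‖ ≤ N * ‖rescale N x‖ := by
    rw [pi_norm_le_iff_of_nonneg (by positivity)]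
    intro i
    have h2 := PiLp.norm_apply_le (rescale N x) i
    have h3 : (rescale N x) i = (x i : ℝ) / N := rfl
    rw [h3, norm_div, Real.norm_of_nonneg hN0.le, div_le_iff₀ hN0] at h2
    linarith
  have h4 : (1 + ‖fun i => (x i : ℝ)‖) ≤ N * (1 + ‖rescale N x‖) := by
    nlinarith
  have h5 := pow_le_pow_left₀ (by positivity) h4 (d + 1)
  rw [mul_pow] at h5
  have h6 : (0 : ℝ) < (1 + ‖fun i => (x i : ℝ)‖) ^ (d + 1) := by positivity
  have hfam : (fun m : ℕ × ℕ => SchwartzMap.seminorm ℝ m.1 m.2 (E := Space d) (F := ℝ)) =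
    schwartzSeminormFamily ℝ (Space d) ℝ := rfl
  simp only [hfam] at h
  rw [← mul_assoc, ← div_eq_mul_inv, le_div_iff₀ h6]
  calc _ ≤ ‖G (rescale N x)‖ * ((N : ℝ) ^ (d + 1) * (1 + ‖rescale N x‖) ^ (d + 1)) := by gcongr
    _ = (N : ℝ) ^ (d + 1) * ((1 + ‖rescale N x‖) ^ (d + 1) * ‖G (rescale N x)‖) := by ring
    _ ≤ (N : ℝ) ^ (d + 1) * (2 ^ (d + 1) *
        ((Finset.Iic (d + 1, 0)).sup (schwartzSeminormFamily ℝ (Space d) ℝ)) G) := by gcongr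
    _ = _ := by ring

theorem norm_occ_le {d : ℕ} (ξ : Config d) (x : Site d) : ‖occ ξ x‖ ≤ 1 := by
  unfold occ; split <;> simp

theorem exists_mul_occ_bound {d : ℕ} (N : ℕ+) : ∃ w : Site d → ℝ, Summable w ∧
    ∀ (G : 𝓢(Space d, ℝ)) (ξ : Config d) (x : Site d), ‖G (rescale N x) * occ ξ x‖ ≤
      ((Finset.Iic (d + 1, 0)).sup (schwartzSeminormFamily ℝ (Space d) ℝ)) G * w x := by
  obtain ⟨w, hw, h⟩ := exists_empirical_bound d N
  refine ⟨w, hw, fun G ξ x => le_trans ?_ (h G x)⟩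
  rw [norm_mul]
  exact mul_le_of_le_one_right (norm_nonneg _) (norm_occ_le ξ x)

theorem summable_mul_occ {d : ℕ} (N : ℕ+) (ξ : Config d) (G : 𝓢(Space d, ℝ)) :
    Summable fun x : Site d => G (rescale N x) * occ ξ x := by
  obtain ⟨w, hw, h⟩ := exists_mul_occ_bound (d := d) N
  exact Summable.of_norm_bounded (hw.mul_left _) (h G ξ)

/-- The empirical density field of a configuration `ξ`, as an element of `𝓢'(ℝ^d)`:
`G ↦ N^(-d) * ∑_{x ∈ ℤ^d} G(x/N) ξ(x)`. The type of continuous linear functionals carries the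
strong dual topology (uniform convergence on bounded subsets of `𝓢(ℝ^d)`). -/
noncomputable def empiricalField {d : ℕ} (N : ℕ+) (ξ : Config d) : 𝓢(Space d, ℝ) →L[ℝ] ℝ :=
  SchwartzMap.mkCLMtoNormedSpace
    (fun G => ((N : ℝ) ^ d)⁻¹ * ∑' x : Site d, G (rescale N x) * occ ξ x)
    (fun G H => by
      simp only [add_apply, add_mul]
      rw [(summable_mul_occ N ξ G).tsum_add (summable_mul_occ N ξ H), mul_add])
    (fun c G => by
      simp only [smul_apply, smul_eq_mul, RingHom.id_apply, mul_assoc]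
      rw [tsum_mul_left]; ring)
    (by
      obtain ⟨w, hw, h⟩ := exists_mul_occ_bound (d := d) N
      refine ⟨Finset.Iic (d + 1, 0), ((N : ℝ) ^ d)⁻¹ * |∑' x, w x|, by positivity, fun G => ?_⟩
      rw [norm_mul, Real.norm_of_nonneg (by positivity), mul_assoc]
      gcongr
      calc _ ≤ ∑' x, ((Finset.Iic (d + 1, 0)).sup (schwartzSeminormFamily ℝ (Space d) ℝ)) G * w x :=
            tsum_of_norm_bounded (hw.mul_left _).hasSum (h G ξ)
        _ ≤ _ := by
          rw [tsum_mul_left, mul_comm]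
          exact mul_le_mul_of_nonneg_right (le_abs_self _) (apply_nonneg _ _))

theorem empiricalField_apply {d : ℕ} (N : ℕ+) (ξ : Config d) (G : 𝓢(Space d, ℝ)) :
    empiricalField N ξ G = ((N : ℝ) ^ d)⁻¹ * ∑' x : Site d, G (rescale N x) * occ ξ x := rfl

theorem measurable_empiricalField {d : ℕ} (N : ℕ+) (G : 𝓢(Space d, ℝ)) :
    Measurable fun ξ : Config d => empiricalField N ξ G := by
  obtain ⟨w, hw, h⟩ := exists_mul_occ_bound (d := d) N
  simp only [empiricalField_apply]
  refine Continuous.measurable (continuous_const.mul ?_)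
  refine continuous_tsum (fun x => ?_) (hw.mul_left _) (fun x ξ => h G ξ x)
  refine continuous_const.mul ?_
  exact (continuous_of_discreteTopology (f := fun b : Bool => if b then (1 : ℝ) else 0)).comp
    (continuous_apply x)

/-- The empirical density field process with diffusive time scaling, an `𝓢'(ℝ^d)`-valued process:
`X^N_t(G) = N^(-d) * ∑_{x ∈ ℤ^d} G(x/N) η_{t N^2}(x)`. -/
noncomputable def densityField {d : ℕ} (N : ℕ+) {Ω : Type*} (η : ℝ≥0 → Ω → Config d)
    (t : ℝ≥0) (ω : Ω) : 𝓢(Space d, ℝ) →L[ℝ] ℝ :=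
  empiricalField N (η (t * (N : ℝ≥0) ^ 2) ω)

theorem measurable_densityField {d : ℕ} (N : ℕ+) {Ω : Type*} [MeasurableSpace Ω]
    {η : ℝ≥0 → Ω → Config d} (hη : ∀ t, Measurable (η t)) (t : ℝ≥0) (G : 𝓢(Space d, ℝ)) :
    Measurable fun ω => densityField N η t ω G :=
  (measurable_empiricalField N G).comp (hη _)

/-- The natural filtration of the `𝓢'(ℝ^d)`-valued process `X^N`:
at time `t` it is generated by all `X^N_s(G)`, `s ≤ t`, `G ∈ 𝓢(ℝ^d)`. -/
noncomputable def fieldFiltration {d : ℕ} (N : ℕ+) {Ω : Type*} [mΩ : MeasurableSpace Ω]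
    {η : ℝ≥0 → Ω → Config d} (hη : ∀ t, Measurable (η t)) : Filtration ℝ≥0 mΩ where
  seq t := ⨆ s ∈ Set.Iic t, ⨆ G : 𝓢(Space d, ℝ),
    MeasurableSpace.comap (fun ω => densityField N η s ω G) inferInstance
  mono' _ _ h := biSup_mono fun _ hs => le_trans hs h
  le' _ := iSup₂_le fun s _ => iSup_le fun G => (measurable_densityField N hη s G).comap_le

/-- The Skorokhod space `D([0,T], E)`: càdlàg functions from `[0,T]` to `E`. -/
structure SkorokhodSpace (T : ℝ≥0) (E : Type*) [TopologicalSpace E] where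
  toFun : Set.Icc (0 : ℝ≥0) T → E
  cadlag : IsCadlag toFun

/-- The pairs of paths `(x, y)` for which some time change `τ` (an increasing bijection of `[0,T]`)
satisfies `|τ(t) - t| < δ` and `(x(t), y(τ(t))) ∈ U` for all `t`. -/
def skorokhodEntourage {T : ℝ≥0} {E : Type*} [TopologicalSpace E] (U : Set (E × E)) (δ : ℝ) :
    Set (SkorokhodSpace T E × SkorokhodSpace T E) :=
  {p | ∃ τ : Set.Icc (0 : ℝ≥0) T ≃o Set.Icc (0 : ℝ≥0) T,
    ∀ t, dist (τ t) t < δ ∧ (p.1.toFun t, p.2.toFun (τ t)) ∈ U}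

/-- The uniformity of the Skorokhod (J1) topology on `D([0,T], E)`, with the sets
`skorokhodEntourage U δ` for entourages `U` of `E` and `δ > 0` as a basis. -/
instance {T : ℝ≥0} {E : Type*} [UniformSpace E] : UniformSpace (SkorokhodSpace T E) :=
  .ofCore <| .mkOfBasis
    { sets := {S | ∃ U ∈ uniformity E, ∃ δ : ℝ, 0 < δ ∧ S = skorokhodEntourage U δ}
      nonempty := ⟨_, Set.univ, Filter.univ_mem, 1, one_pos, rfl⟩
      inter_sets := by
        rintro _ _ ⟨U, hU, δ, hδ, rfl⟩ ⟨V, hV, ε, hε, rfl⟩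
        refine ⟨_, ⟨U ∩ V, Filter.inter_mem hU hV, min δ ε, lt_min hδ hε, rfl⟩, ?_⟩
        rintro p ⟨τ, hτ⟩
        exact ⟨⟨τ, fun t => ⟨(hτ t).1.trans_le (min_le_left _ _), (hτ t).2.1⟩⟩,
          ⟨τ, fun t => ⟨(hτ t).1.trans_le (min_le_right _ _), (hτ t).2.2⟩⟩⟩ }
    (by
      rintro _ ⟨U, hU, δ, hδ, rfl⟩ x
      exact ⟨OrderIso.refl _, fun t => ⟨by simpa using hδ, refl_mem_uniformity hU⟩⟩)
    (by
      rintro _ ⟨U, hU, δ, hδ, rfl⟩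
      refine ⟨_, ⟨Prod.swap ⁻¹' U, symm_le_uniformity hU, δ, hδ, rfl⟩, ?_⟩
      rintro p ⟨τ, hτ⟩
      refine ⟨τ.symm, fun t => ⟨?_, ?_⟩⟩
      · have := (hτ (τ.symm t)).1
        rwa [OrderIso.apply_symm_apply, dist_comm] at this
      · have := (hτ (τ.symm t)).2
        rwa [OrderIso.apply_symm_apply] at this)
    (by
      rintro _ ⟨U, hU, δ, hδ, rfl⟩
      obtain ⟨V, hV, hVU⟩ := comp_mem_uniformity_sets hU
      refine ⟨_, ⟨V, hV, δ / 2, half_pos hδ, rfl⟩, ?_⟩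
      rintro ⟨x, z⟩ ⟨y, ⟨τ, hτ⟩, ⟨σ, hσ⟩⟩
      refine ⟨τ.trans σ, fun t => ⟨?_, hVU ⟨y.toFun (τ t), (hτ t).2, (hσ (τ t)).2⟩⟩⟩
      have h1 := (hτ t).1
      have h2 := (hσ (τ t)).1
      have h3 := dist_triangle (σ (τ t)) (τ t) t
      rw [OrderIso.trans_apply]
      linarith)

/-- Tightness in `D([0,T], E)` of the processes `Y i`, `i ∈ ι`, with time set `[0,∞)`, defined on
the probability spaces `(Ω i, P i)`: for every `ε > 0` there is a compact set `K` of càdlàg paths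
that contains the path `(Y i t)_{t ∈ [0,T]}` up to an event of probability at most `ε`,
for all `i`. In particular the paths on `[0,T]` are almost surely càdlàg. -/
def IsTightInSkorokhod (T : ℝ≥0) {E : Type*} [UniformSpace E] {ι : Type*} {Ω : ι → Type*}
    [∀ i, MeasurableSpace (Ω i)] (P : ∀ i, Measure (Ω i)) (Y : ∀ i, ℝ≥0 → Ω i → E) : Prop :=
  ∀ ε : ℝ≥0∞, 0 < ε → ∃ K : Set (SkorokhodSpace T E), IsCompact K ∧
    ∀ i, P i {ω | ¬ ∃ x ∈ K, ∀ t, x.toFun t = Y i (t : ℝ≥0) ω} ≤ ε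

/-! The density field of any configuration is bounded, uniformly in `N`, by a constant times the
weighted norm `sup (1 + ‖x‖)^(d+1) |G x|` (`exists_abs_empiricalField_le`). This gives (T1) at once,
and it confines all paths to one ball of functionals that is compact for the strong topology. What
remains is to control the increments.

The conductances have no spatial regularity, so the accelerated generator applied to the field is
only of order `N` and the drift cannot be bounded directly. The exclusion process acts on its
one-point and two-point functions by exchanging the ends of bonds. Hence the expectations `ρ_s(v) =
E[Z φ_v(η_{t₀+s})]`, with `Z` measurable at time `t₀`, solve a linear symmetric jump system
(`IsSSEP.integral_evolution`). For such a system `∑ H ρ + γ ∑ w ρ²` is differentiated in place of `∑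
H ρ`: the Dirichlet form produced by the quadratic term absorbs the gradient terms, so only first
differences of `H` and of the weight `w` enter (`tsum_energy_le`). These differences are `O(1/N)`
times the weight, the elapsed time is `h N²`, and `γ = √h` yields a bound of order `√h`
(`parabolic_scaling_le`).

With `X'` and `X` the field at times `t + h` and `t`, write `(X' - X)² = (X'² - X²) - 2 X (X' - X)`.
The two-point estimate with `Z = 1_A` and the one-point estimate with `Z = 1_A X` give `E[1_A (X' -
X)²] ≤ K √h P(A)` for every past event `A` (`exists_setIntegral_field_sub_sq_le`). Chebyshev's
inequality then proves (T2).

For tightness, conditionally small increments are turned into partitions of `[0,T]` with a minimal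
step and small oscillation on each part. On a grid, an Ottaviani-type inequality bounds the chance
that two crossings of a threshold are close, and the expected number of crossings is bounded; then
the grid is refined (`measure_not_hasPartition_le`). Paths with values in a compact set and with
such partitions at every precision form a compact set (`isCompact_skorokhod`). Closeness of
functionals in the ball is tested on finite nets of test functions (`exists_netClose_subset`), so
countably many finite-dimensional estimates suffice. -/

/-! ### Energy estimate for symmetric jump systems -/

section Energy

variable {V B : Type*} [DecidableEq B]

/-- The rate attached to the pair `(v, b)` when only the moves in `act v` are active at `v`. -/
def activeRate (act : V → Finset B) (c : B → ℝ) (p : V × B) : ℝ :=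
  if p.2 ∈ act p.1 then c p.2 else 0

/-- The drift `∑ b ∈ act v, c b * (ρ (σ b v) - ρ v)` of a function on `V`. -/
def jumpDrift (σ : B → V → V) (act : V → Finset B) (c : B → ℝ) (ρ : V → ℝ) (v : V) : ℝ :=
  ∑ b ∈ act v, c b * (ρ (σ b v) - ρ v)

variable {σ : B → V → V} {act : V → Finset B} {c : B → ℝ}

theorem activeRate_nonneg (hc : ∀ v, ∀ b ∈ act v, 0 ≤ c b) (p : V × B) :
    0 ≤ activeRate act c p := by
  unfold activeRate; split
  · exact hc _ _ ‹_›
  · exact le_rfl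

theorem hasSum_activeRate_mul (v : V) (f : V → B → ℝ) :
    HasSum (fun b => activeRate act c (v, b) * f v b) (∑ b ∈ act v, c b * f v b) := by
  have h : ∑ b ∈ act v, c b * f v b = ∑ b ∈ act v, activeRate act c (v, b) * f v b :=
    Finset.sum_congr rfl fun b hb => by simp [activeRate, hb]
  rw [h]
  exact hasSum_sum_of_ne_finset_zero fun b hb => by simp [activeRate, hb]

theorem summable_activeRate_mul_weight (hc : ∀ v, ∀ b ∈ act v, 0 ≤ c b) {κ : ℝ}
    (hκ : ∀ v, ∑ b ∈ act v, c b ≤ κ) {w : V → ℝ} (hw0 : ∀ v, 0 ≤ w v) (hw : Summable w) :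
    Summable (fun p : V × B => activeRate act c p * w p.1) ∧
      ∑' p : V × B, activeRate act c p * w p.1 ≤ κ * ∑' v, w v := by
  have hs : ∀ v, HasSum (fun b => activeRate act c (v, b) * w v) (∑ b ∈ act v, c b * w v) :=
    fun v => hasSum_activeRate_mul v fun v _ => w v
  have hle : ∀ v, ∑ b ∈ act v, c b * w v ≤ κ * w v := fun v => by
    rw [← Finset.sum_mul]; exact mul_le_mul_of_nonneg_right (hκ v) (hw0 v)
  have h0 : ∀ v, 0 ≤ ∑ b ∈ act v, c b * w v := fun v =>
    Finset.sum_nonneg fun b hb => mul_nonneg (hc v b hb) (hw0 v)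
  have hS : Summable fun v => ∑ b ∈ act v, c b * w v :=
    Summable.of_nonneg_of_le h0 hle (hw.mul_left κ)
  have hsum : Summable (fun p : V × B => activeRate act c p * w p.1) := by
    refine (summable_prod_of_nonneg fun p => mul_nonneg (activeRate_nonneg hc p) (hw0 _)).2
      ⟨fun v => (hs v).summable, ?_⟩
    simpa only [(hs _).tsum_eq] using hS
  refine ⟨hsum, ?_⟩
  rw [hsum.tsum_prod]
  simp only [(hs _).tsum_eq]
  rw [← tsum_mul_left]
  exact hS.tsum_le_tsum hle (hw.mul_left κ)

/-- Symmetrizing the sum over pairs `(v, b)` under the involution `v ↦ σ b v` turns the left side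
into gradient terms minus the dissipation `2 γ w Δ²`, where `Δ = ρ (σ b v) - ρ v`. Young's
inequality absorbs the gradient terms, so no second difference of `H` is needed. -/
theorem tsum_energy_le (hσ : ∀ b v, σ b (σ b v) = v) (hact : ∀ b v, b ∈ act (σ b v) ↔ b ∈ act v)
    (hc : ∀ v, ∀ b ∈ act v, 0 ≤ c b) {κ : ℝ} (hκ : ∀ v, ∑ b ∈ act v, c b ≤ κ)
    {w H : V → ℝ} (hw0 : ∀ v, 0 ≤ w v) (hw : Summable w) {C θ ν γ : ℝ}
    (hH : ∀ v, |H v| ≤ C * w v)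
    (hwθ : ∀ v, ∀ b ∈ act v, |w (σ b v) - w v| ≤ θ * w v)
    (hHν : ∀ v, ∀ b ∈ act v, |H (σ b v) - H v| ≤ ν * w v) (hγ : 0 < γ)
    {ρ : V → ℝ} (hρ : ∀ v, |ρ v| ≤ 1) :
    ∑' v, (H v + 2 * γ * w v * ρ v) * jumpDrift σ act c ρ v ≤
      κ * (∑' v, w v) * (ν ^ 2 / (8 * γ) + γ * θ ^ 2 / 2) := by
  obtain ⟨hkw, hkwle⟩ := summable_activeRate_mul_weight hc hκ hw0 hw
  set k := activeRate act c with hk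
  have hk0 : ∀ p, 0 ≤ k p := activeRate_nonneg hc
  let F : V × B → ℝ := fun p =>
    k p * ((H p.1 + 2 * γ * w p.1 * ρ p.1) * (ρ (σ p.2 p.1) - ρ p.1))
  -- The rates are invariant under this involution of pairs, so `F` and `F ∘ e` have the same sum
  -- and it is enough to bound `F + F ∘ e` pointwise.
  let e : V × B ≃ V × B :=
    { toFun := fun p => (σ p.2 p.1, p.2)
      invFun := fun p => (σ p.2 p.1, p.2)
      left_inv := fun p => by simp [hσ]
      right_inv := fun p => by simp [hσ] }
  have hke : ∀ p, k (e p) = k p := fun p => by simp [hk, activeRate, e, hact]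
  have hF : Summable F := by
    refine Summable.of_norm_bounded (hkw.mul_left ((C + 2 * γ) * 2)) fun p => ?_
    have h1 : |H p.1 + 2 * γ * w p.1 * ρ p.1| ≤ (C + 2 * γ) * w p.1 := by
      refine (abs_add_le _ _).trans ?_
      have : |2 * γ * w p.1 * ρ p.1| ≤ 2 * γ * w p.1 := by
        rw [abs_mul, abs_of_nonneg (by have := hw0 p.1; positivity)]
        exact mul_le_of_le_one_right (by have := hw0 p.1; positivity) (hρ _)
      linarith [hH p.1]
    have h2 : |ρ (σ p.2 p.1) - ρ p.1| ≤ 2 :=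
      (abs_sub _ _).trans (by linarith [hρ (σ p.2 p.1), hρ p.1])
    rw [Real.norm_eq_abs, abs_mul, abs_mul, abs_of_nonneg (hk0 p)]
    calc _ ≤ k p * (((C + 2 * γ) * w p.1) * 2) := by
          have := hk0 p
          gcongr
          exact (abs_nonneg _).trans h1
      _ = _ := by ring
  have hFe : Summable (F ∘ e) := (e.summable_iff).2 hF
  have hL : ∑' v, (H v + 2 * γ * w v * ρ v) * jumpDrift σ act c ρ v = ∑' p, F p := by
    rw [hF.tsum_prod]
    refine tsum_congr fun v => ?_
    have := hasSum_activeRate_mul (act := act) (c := c) v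
      fun v b => (H v + 2 * γ * w v * ρ v) * (ρ (σ b v) - ρ v)
    rw [this.tsum_eq, jumpDrift, Finset.mul_sum]
    exact Finset.sum_congr rfl fun b _ => by ring
  have h2 : 2 * ∑' p, F p = ∑' p, (F p + (F ∘ e) p) := by
    rw [hF.tsum_add hFe, show ∑' p, (F ∘ e) p = ∑' p, F p from e.tsum_eq F]; ring
  have hpt : ∀ p, F p + (F ∘ e) p ≤ (ν ^ 2 / (4 * γ) + γ * θ ^ 2) * (k p * w p.1) := by
    rintro ⟨v, b⟩
    have hke' := hke (v, b)
    simp only [Function.comp, F, hke']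
    simp only [e, Equiv.coe_fn_mk, hσ]
    by_cases hb : b ∈ act v
    · have h3 := abs_le.1 (hwθ v b hb)
      have h4 := abs_le.1 (hHν v b hb)
      set Δ := ρ (σ b v) - ρ v with hΔ
      have h5 : (H v - H (σ b v)) * Δ ≤ ν * w v * |Δ| := by
        refine (le_abs_self _).trans ?_
        rw [abs_mul, abs_sub_comm]
        exact mul_le_mul_of_nonneg_right (hHν v b hb) (abs_nonneg _)
      have h6 : -((w (σ b v) - w v) * ρ (σ b v) * Δ) ≤ θ * w v * |Δ| := by
        refine (neg_le_abs _).trans ?_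
        rw [abs_mul, abs_mul]
        refine mul_le_mul_of_nonneg_right ?_ (abs_nonneg _)
        exact (mul_le_of_le_one_right (abs_nonneg _) (hρ _)).trans (hwθ v b hb)
      -- The dissipation `2 γ Δ²` is spent in two halves: one on the gradient of `H` here, the other
      -- on the gradient of the weight in `h8`. The constants are halved again when the
      -- symmetrization is undone.
      have h7 : ν * |Δ| ≤ γ * Δ ^ 2 + ν ^ 2 / (4 * γ) := by
        have : γ * Δ ^ 2 + ν ^ 2 / (4 * γ) - ν * |Δ| = (2 * γ * |Δ| - ν) ^ 2 / (4 * γ) := by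
          rw [← sq_abs Δ]; field_simp; ring
        have : 0 ≤ (2 * γ * |Δ| - ν) ^ 2 / (4 * γ) := by positivity
        linarith
      have h8 : 2 * γ * (θ * |Δ|) ≤ γ * Δ ^ 2 + γ * θ ^ 2 := by
        rw [← sq_abs Δ]; nlinarith [mul_nonneg hγ.le (sq_nonneg (|Δ| - θ))]
      have h9 : (H v + 2 * γ * w v * ρ v) * Δ +
          (H (σ b v) + 2 * γ * w (σ b v) * ρ (σ b v)) * (ρ v - ρ (σ b v)) ≤
          w v * (ν ^ 2 / (4 * γ) + γ * θ ^ 2) := by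
        have e1 : (H v + 2 * γ * w v * ρ v) * Δ +
          (H (σ b v) + 2 * γ * w (σ b v) * ρ (σ b v)) * (ρ v - ρ (σ b v)) =
          (H v - H (σ b v)) * Δ + 2 * γ * (-((w (σ b v) - w v) * ρ (σ b v) * Δ))
            - 2 * γ * (w v * Δ ^ 2) := by rw [hΔ]; ring
        rw [e1]
        have h10 := mul_le_mul_of_nonneg_left h6 (by positivity : 0 ≤ 2 * γ)
        have h11 := mul_le_mul_of_nonneg_left h7 (hw0 v)
        have h12 := mul_le_mul_of_nonneg_left h8 (hw0 v)
        linarith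
      have := mul_le_mul_of_nonneg_left h9 (hk0 (v, b))
      linarith
    · simp [hk, activeRate, hb]
  have h3 := (hF.add hFe).tsum_le_tsum hpt (hkw.mul_left _)
  rw [tsum_mul_left, ← h2] at h3
  rw [hL]
  have h4 : (ν ^ 2 / (4 * γ) + γ * θ ^ 2) * ∑' p, k p * w p.1 ≤
      (ν ^ 2 / (4 * γ) + γ * θ ^ 2) * (κ * ∑' v, w v) :=
    mul_le_mul_of_nonneg_left hkwle (by positivity)
  have h5 : ν ^ 2 / (4 * γ) = 2 * (ν ^ 2 / (8 * γ)) := by field_simp; ring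
  rw [h5] at h3 h4
  linarith

omit [DecidableEq B] in
theorem abs_jumpDrift_le (hc : ∀ v, ∀ b ∈ act v, 0 ≤ c b) {κ : ℝ}
    (hκ : ∀ v, ∑ b ∈ act v, c b ≤ κ) {ρ : V → ℝ} {m : ℝ} (hm : 0 ≤ m) (hρ : ∀ v, |ρ v| ≤ m)
    (v : V) : |jumpDrift σ act c ρ v| ≤ κ * (2 * m) := by
  calc |jumpDrift σ act c ρ v| ≤ ∑ b ∈ act v, |c b * (ρ (σ b v) - ρ v)| :=
        Finset.abs_sum_le_sum_abs _ _
    _ ≤ ∑ b ∈ act v, c b * (2 * m) := by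
        refine Finset.sum_le_sum fun b hb => ?_
        rw [abs_mul, abs_of_nonneg (hc v b hb)]
        refine mul_le_mul_of_nonneg_left ?_ (hc v b hb)
        exact (abs_sub _ _).trans (by linarith [hρ (σ b v), hρ v])
    _ ≤ κ * (2 * m) := by
        rw [← Finset.sum_mul]; exact mul_le_mul_of_nonneg_right (hκ v) (by positivity)

end Energy

/-! ### Time integration of the energy estimate. -/

section Evolution

variable {V B : Type*} [DecidableEq B] [Countable V]
  {σ : B → V → V} {act : V → Finset B} {c : ℝ → B → ℝ}

/-- One-sided bound for the evolution of `∑ v, H v * ρ v` under a bounded symmetric jump system. -/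
theorem tsum_sub_le_of_evolution (hσ : ∀ b v, σ b (σ b v) = v)
    (hact : ∀ b v, b ∈ act (σ b v) ↔ b ∈ act v)
    {τ : ℝ} (hτ : 0 ≤ τ) (hc : ∀ s ∈ Set.Icc 0 τ, ∀ v, ∀ b ∈ act v, 0 ≤ c s b)
    (hcm : ∀ b, Measurable fun s => c s b) {κ : ℝ}
    (hκ : ∀ s ∈ Set.Icc 0 τ, ∀ v, ∑ b ∈ act v, c s b ≤ κ)
    {w H : V → ℝ} (hw0 : ∀ v, 0 ≤ w v) (hw : Summable w) {C θ ν γ : ℝ}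
    (hH : ∀ v, |H v| ≤ C * w v)
    (hwθ : ∀ v, ∀ b ∈ act v, |w (σ b v) - w v| ≤ θ * w v)
    (hHν : ∀ v, ∀ b ∈ act v, |H (σ b v) - H v| ≤ ν * w v) (hγ : 0 < γ)
    {ρ : ℝ → V → ℝ} (hρ : ∀ s ∈ Set.Icc 0 τ, ∀ v, |ρ s v| ≤ 1)
    (hρc : ∀ v, ContinuousOn (fun s => ρ s v) (Set.Icc 0 τ))
    (hρd : ∀ v, ∀ s ∈ Set.Ioo 0 τ,
      HasDerivWithinAt (fun s => ρ s v) (jumpDrift σ act (c s) (ρ s) v) (Set.Ioi s) s) :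
    ∑' v, H v * (ρ τ v - ρ 0 v) ≤
      (∑' v, w v) * (γ + τ * κ * (ν ^ 2 / (8 * γ) + γ * θ ^ 2 / 2)) := by
  classical
  rcases isEmpty_or_nonempty V with hV | ⟨⟨v₀⟩⟩
  · simp
  have h0mem : (0 : ℝ) ∈ Set.Icc 0 τ := ⟨le_rfl, hτ⟩
  have hτmem : τ ∈ Set.Icc 0 τ := ⟨hτ, le_rfl⟩
  have hκ0 : 0 ≤ κ := (Finset.sum_nonneg (hc 0 h0mem v₀)).trans (hκ 0 h0mem v₀)
  have hW0 : 0 ≤ ∑' v, w v := tsum_nonneg hw0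
  set D := κ * (∑' v, w v) * (ν ^ 2 / (8 * γ) + γ * θ ^ 2 / 2) with hD
  have hD0 : 0 ≤ D := by positivity
  -- `J s v` is the right derivative of `H v * ρ s v + γ * w v * ρ s v ^ 2`.
  let J : ℝ → V → ℝ := fun s v => (H v + 2 * γ * w v * ρ s v) * jumpDrift σ act (c s) (ρ s) v
  have hJb : ∀ s ∈ Set.Icc 0 τ, ∀ v, ‖J s v‖ ≤ (C + 2 * γ) * (κ * (2 * 1)) * w v := by
    intro s hs v
    have h1 : |H v + 2 * γ * w v * ρ s v| ≤ (C + 2 * γ) * w v := by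
      refine (abs_add_le _ _).trans ?_
      have : |2 * γ * w v * ρ s v| ≤ 2 * γ * w v := by
        rw [abs_mul, abs_of_nonneg (by have := hw0 v; positivity)]
        exact mul_le_of_le_one_right (by have := hw0 v; positivity) (hρ s hs _)
      linarith [hH v]
    rw [Real.norm_eq_abs, abs_mul]
    calc _ ≤ ((C + 2 * γ) * w v) * (κ * (2 * 1)) := mul_le_mul h1
          (abs_jumpDrift_le (hc s hs) (hκ s hs) zero_le_one (hρ s hs) v) (abs_nonneg _)
          ((abs_nonneg _).trans h1)
      _ = _ := by ring
  have hρm : ∀ v, AEStronglyMeasurable (fun s => ρ s v)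
      (volume.restrict (Set.uIoc 0 τ)) := fun v => by
    rw [Set.uIoc_of_le hτ]
    exact ((hρc v).aestronglyMeasurable measurableSet_Icc).mono_measure
      (Measure.restrict_mono Set.Ioc_subset_Icc_self le_rfl)
  have hJm : ∀ v, AEStronglyMeasurable (fun s => J s v) (volume.restrict (Set.uIoc 0 τ)) := by
    intro v
    refine ((hρm v).const_mul _).const_add _ |>.mul ?_
    refine Finset.aestronglyMeasurable_fun_sum _ fun b _ => ?_
    exact (hcm b).aestronglyMeasurable.mul ((hρm _).sub (hρm _))
  have hIoc : Set.uIoc 0 τ ⊆ Set.Icc 0 τ := by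
    rw [Set.uIoc_of_le hτ]; exact Set.Ioc_subset_Icc_self
  have hFTC : ∀ v, ∫ s in (0 : ℝ)..τ, J s v =
      (H v * ρ τ v + γ * w v * ρ τ v ^ 2) - (H v * ρ 0 v + γ * w v * ρ 0 v ^ 2) := by
    intro v
    refine intervalIntegral.integral_eq_sub_of_hasDeriv_right
      (f := fun s => H v * ρ s v + γ * w v * ρ s v ^ 2) ?_ ?_ ?_
    · rw [Set.uIcc_of_le hτ]
      exact ((hρc v).const_mul _).add (((hρc v).pow 2).const_mul _)
    · intro s hs
      rw [min_eq_left hτ, max_eq_right hτ] at hs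
      have h := hρd v s hs
      refine ((h.const_mul (H v)).add ((h.pow 2).const_mul (γ * w v))).congr_deriv ?_
      simp only [J]; push_cast; ring
    · rw [intervalIntegrable_iff]
      refine IntegrableOn.of_bound (by simp) (hJm v) ((C + 2 * γ) * (κ * (2 * 1)) * w v) ?_
      filter_upwards [ae_restrict_mem measurableSet_uIoc] with s hs using hJb s (hIoc hs) v
  have hsum : HasSum (fun v => ∫ s in (0 : ℝ)..τ, J s v) (∫ s in (0 : ℝ)..τ, ∑' v, J s v) := by
    refine intervalIntegral.hasSum_integral_of_dominated_convergence
      (fun v _ => (C + 2 * γ) * (κ * (2 * 1)) * w v) hJm ?_ ?_ ?_ ?_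
    · exact fun v => Eventually.of_forall fun s hs => hJb s (hIoc hs) v
    · exact Eventually.of_forall fun s hs => hw.mul_left _
    · exact intervalIntegrable_const
    · exact Eventually.of_forall fun s hs =>
        (Summable.of_norm_bounded (hw.mul_left _) (hJb s (hIoc hs))).hasSum
  have hint : ∫ s in (0 : ℝ)..τ, ∑' v, J s v ≤ τ * D := by
    -- Integrability of the summed drift need not be known: otherwise its integral is zero by
    -- convention and the bound is non-negative.
    by_cases hi : IntervalIntegrable (fun s => ∑' v, J s v) volume 0 τ
    · have := intervalIntegral.integral_mono_on hτ hi (intervalIntegrable_const (c := D))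
        fun s hs => tsum_energy_le hσ hact (hc s hs) (hκ s hs) hw0 hw hH hwθ hHν hγ (hρ s hs)
      simpa using this
    · rw [intervalIntegral.integral_undef hi]; positivity
  have hS1 : Summable fun v => H v * (ρ τ v - ρ 0 v) := by
    refine Summable.of_norm_bounded (hw.mul_left (C * 2)) fun v => ?_
    have : |ρ τ v - ρ 0 v| ≤ 2 :=
      (abs_sub _ _).trans (by linarith [hρ τ hτmem v, hρ 0 h0mem v])
    rw [Real.norm_eq_abs, abs_mul]
    calc _ ≤ (C * w v) * 2 := mul_le_mul (hH v) this (abs_nonneg _) ((abs_nonneg _).trans (hH v))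
      _ = _ := by ring
  -- The quadratic term at time `τ` has the favourable sign and is dropped; at time `0` it costs at
  -- most `γ * w v`.
  have hle : ∀ v, H v * (ρ τ v - ρ 0 v) ≤ (∫ s in (0 : ℝ)..τ, J s v) + γ * w v := by
    intro v
    rw [hFTC v]
    have h1 : ρ 0 v ^ 2 ≤ 1 := (sq_le_one_iff_abs_le_one _).2 (hρ 0 h0mem v)
    have h2 : 0 ≤ γ * w v := mul_nonneg hγ.le (hw0 v)
    nlinarith [mul_nonneg h2 (sq_nonneg (ρ τ v)), mul_le_mul_of_nonneg_left h1 h2]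
  have h3 := hS1.tsum_le_tsum hle (hsum.summable.add (hw.mul_left γ))
  rw [hsum.summable.tsum_add (hw.mul_left γ), hsum.tsum_eq, tsum_mul_left] at h3
  calc _ ≤ _ := h3
    _ ≤ τ * D + γ * ∑' v, w v := by linarith
    _ = _ := by rw [hD]; ring

/-- The evolution of `∑ v, H v * ρ v` under a bounded symmetric jump system. -/
theorem abs_tsum_sub_le_of_evolution (hσ : ∀ b v, σ b (σ b v) = v)
    (hact : ∀ b v, b ∈ act (σ b v) ↔ b ∈ act v)
    {τ : ℝ} (hτ : 0 ≤ τ) (hc : ∀ s ∈ Set.Icc 0 τ, ∀ v, ∀ b ∈ act v, 0 ≤ c s b)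
    (hcm : ∀ b, Measurable fun s => c s b) {κ : ℝ}
    (hκ : ∀ s ∈ Set.Icc 0 τ, ∀ v, ∑ b ∈ act v, c s b ≤ κ)
    {w H : V → ℝ} (hw0 : ∀ v, 0 ≤ w v) (hw : Summable w) {C θ ν γ : ℝ}
    (hH : ∀ v, |H v| ≤ C * w v)
    (hwθ : ∀ v, ∀ b ∈ act v, |w (σ b v) - w v| ≤ θ * w v)
    (hHν : ∀ v, ∀ b ∈ act v, |H (σ b v) - H v| ≤ ν * w v) (hγ : 0 < γ)
    {ρ : ℝ → V → ℝ} {m : ℝ} (hm : 0 ≤ m) (hρ : ∀ s ∈ Set.Icc 0 τ, ∀ v, |ρ s v| ≤ m)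
    (hρc : ∀ v, ContinuousOn (fun s => ρ s v) (Set.Icc 0 τ))
    (hρd : ∀ v, ∀ s ∈ Set.Ioo 0 τ,
      HasDerivWithinAt (fun s => ρ s v) (jumpDrift σ act (c s) (ρ s) v) (Set.Ioi s) s) :
    |∑' v, H v * (ρ τ v - ρ 0 v)| ≤
      m * ((∑' v, w v) * (γ + τ * κ * (ν ^ 2 / (8 * γ) + γ * θ ^ 2 / 2))) := by
  rcases hm.eq_or_lt with rfl | hm
  · have h0 : ∀ s ∈ Set.Icc 0 τ, ∀ v, ρ s v = 0 := fun s hs v => abs_nonpos_iff.1 (hρ s hs v)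
    simp [h0 τ ⟨hτ, le_rfl⟩, h0 0 ⟨le_rfl, hτ⟩]
  -- Dividing `ρ` by `m` reduces to the unit bound. The estimate is used for `H` and for `-H`, and
  -- linearity makes the final bound proportional to `m`.
  have key : ∀ H' : V → ℝ, (∀ v, |H' v| ≤ C * w v) →
      (∀ v, ∀ b ∈ act v, |H' (σ b v) - H' v| ≤ ν * w v) →
      ∑' v, H' v * (m⁻¹ * ρ τ v - m⁻¹ * ρ 0 v) ≤
        (∑' v, w v) * (γ + τ * κ * (ν ^ 2 / (8 * γ) + γ * θ ^ 2 / 2)) := by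
    intro H' h1 h2
    refine tsum_sub_le_of_evolution (ρ := fun s v => m⁻¹ * ρ s v) hσ hact hτ hc hcm hκ hw0 hw h1
      hwθ h2 hγ ?_ ?_ ?_
    · intro s hs v
      rw [abs_mul, abs_of_pos (inv_pos.2 hm), inv_mul_le_iff₀ hm, mul_one]
      exact hρ s hs v
    · exact fun v => (hρc v).const_mul _
    · intro v s hs
      refine ((hρd v s hs).const_mul m⁻¹).congr_deriv ?_
      simp only [jumpDrift, Finset.mul_sum]
      exact Finset.sum_congr rfl fun b _ => by ring
  have hsc : ∀ H' : V → ℝ, ∑' v, H' v * (m⁻¹ * ρ τ v - m⁻¹ * ρ 0 v) =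
      m⁻¹ * ∑' v, H' v * (ρ τ v - ρ 0 v) := fun H' => by
    rw [← tsum_mul_left]; exact tsum_congr fun v => by ring
  have k1 := key H hH hHν
  have k2 := key (fun v => -H v) (fun v => by simpa using hH v) (fun v b hb => by
    have := hHν v b hb
    rwa [← abs_neg, neg_sub_neg, neg_sub])
  rw [hsc, inv_mul_le_iff₀ hm] at k1 k2
  have hneg : ∑' v, -H v * (ρ τ v - ρ 0 v) = -∑' v, H v * (ρ τ v - ρ 0 v) := by
    rw [← tsum_neg]; exact tsum_congr fun v => by ring
  rw [hneg] at k2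
  exact abs_le.2 ⟨by linarith, k1⟩

end Evolution

/-! ### Evolution of the correlation functions of the exclusion process -/

section Bonds

variable {d : ℕ}

theorem nbr_comm {x y : Site d} : Nbr x y ↔ Nbr y x := by
  simp only [Nbr, abs_sub_comm]

theorem finite_nbr_zero (d : ℕ) : {e : Site d | Nbr 0 e}.Finite := by
  refine (Set.finite_Icc (fun _ => (-1 : ℤ)) (fun _ => 1)).subset fun e he => ?_
  have h : ∀ i, |e i| ≤ 1 := fun i => by
    have h1 := Finset.single_le_sum (f := fun i => |(0 : Site d) i - e i|)
      (fun i _ => abs_nonneg _) (Finset.mem_univ i)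
    have h2 : ∑ i, |(0 : Site d) i - e i| = 1 := he
    rw [h2] at h1
    simpa using h1
  exact ⟨fun i => (abs_le.1 (h i)).1, fun i => (abs_le.1 (h i)).2⟩

/-- The neighbours of the origin. -/
noncomputable def originNbrs (d : ℕ) : Finset (Site d) := (finite_nbr_zero d).toFinset

theorem mem_originNbrs {e : Site d} : e ∈ originNbrs d ↔ Nbr 0 e := by simp [originNbrs]

theorem nbr_add {x e : Site d} : Nbr x (x + e) ↔ Nbr 0 e := by simp [Nbr]

/-- The oriented bonds with an end point in `A`. -/
noncomputable def touching (A : Finset (Site d)) : Finset (Site d × Site d) :=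
  (A ×ˢ originNbrs d).image (fun p => (p.1, p.1 + p.2)) ∪
    (A ×ˢ originNbrs d).image (fun p => (p.1 + p.2, p.1))

theorem mem_touching {A : Finset (Site d)} {b : Site d × Site d} :
    b ∈ touching A ↔ Nbr b.1 b.2 ∧ (b.1 ∈ A ∨ b.2 ∈ A) := by
  obtain ⟨x, y⟩ := b
  simp only [touching, Finset.mem_union, Finset.mem_image, Finset.mem_product, mem_originNbrs,
    Prod.mk.injEq, Prod.exists]
  constructor
  · rintro (⟨a, e, ⟨ha, he⟩, rfl, rfl⟩ | ⟨a, e, ⟨ha, he⟩, rfl, rfl⟩)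
    · exact ⟨nbr_add.2 he, Or.inl ha⟩
    · exact ⟨nbr_comm.1 (nbr_add.2 he), Or.inr ha⟩
  · rintro ⟨hn, hx | hy⟩
    · refine Or.inl ⟨x, y - x, ⟨hx, ?_⟩, rfl, by abel⟩
      rw [← nbr_add (x := x)]; simpa using hn
    · refine Or.inr ⟨y, x - y, ⟨hy, ?_⟩, by abel, rfl⟩
      rw [← nbr_add (x := y)]; simpa using nbr_comm.1 hn

theorem card_touching_le (A : Finset (Site d)) :
    (touching A).card ≤ 2 * (A.card * (originNbrs d).card) := by
  refine (Finset.card_union_le _ _).trans ?_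
  have h1 := Finset.card_image_le (s := A ×ˢ originNbrs d) (f := fun p => (p.1, p.1 + p.2))
  have h2 := Finset.card_image_le (s := A ×ˢ originNbrs d) (f := fun p => (p.1 + p.2, p.1))
  rw [Finset.card_product] at h1 h2
  omega

/-- Half of the conductance of an oriented bond. -/
noncomputable def halfRate (lam : Environment d) (t : ℝ≥0) (b : Site d × Site d) : ℝ :=
  if Nbr b.1 b.2 then lam.rate t b.1 b.2 / 2 else 0

theorem halfRate_nonneg (lam : Environment d) (t : ℝ≥0) (b : Site d × Site d) :
    0 ≤ halfRate lam t b := by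
  unfold halfRate; split_ifs with h
  · exact div_nonneg (lam.nonneg _ _ _ h) zero_le_two
  · exact le_rfl

theorem halfRate_le {lam : Environment d} {α : ℝ}
    (hlam : ∀ t x y, Nbr x y → lam.rate t x y ≤ α) (t : ℝ≥0) (b : Site d × Site d) :
    halfRate lam t b ≤ |α| := by
  unfold halfRate; split_ifs with h
  · have := hlam t _ _ h; have := lam.nonneg t _ _ h; linarith [le_abs_self α]
  · exact abs_nonneg _

theorem sum_halfRate_le {lam : Environment d} {α : ℝ}
    (hlam : ∀ t x y, Nbr x y → lam.rate t x y ≤ α) (t : ℝ≥0) {A : Finset (Site d)} {k : ℕ}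
    (hA : A.card ≤ k) :
    ∑ b ∈ touching A, halfRate lam t b ≤ (2 * (k * (originNbrs d).card) : ℕ) * |α| := by
  refine (Finset.sum_le_card_nsmul _ _ _ fun b _ => halfRate_le hlam t b).trans ?_
  rw [nsmul_eq_mul]
  refine mul_le_mul_of_nonneg_right ?_ (abs_nonneg _)
  exact_mod_cast (card_touching_le A).trans (by gcongr)

theorem halfRate_continuousWithinAt (lam : Environment d) (b : Site d × Site d) (t : ℝ≥0) :
    ContinuousWithinAt (fun t => halfRate lam t b) (Set.Ici t) t := by
  unfold halfRate; split_ifs with h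
  · exact ((lam.cadlag _ _ h) t).1.div_const 2
  · exact continuousWithinAt_const

/-- The generator acts on functions of finitely many occupation variables by exchanging the
occupation variables at the ends of bonds. -/
theorem generator_eq_sum (lam : Environment d) (t : ℝ≥0) {φ : Config d → ℝ} {A : Finset (Site d)}
    (hφ : DependsOn φ (A : Set (Site d))) (ξ : Config d) :
    generator lam t φ ξ =
      ∑ b ∈ touching A, halfRate lam t b * (φ (ξ ∘ Equiv.swap b.1 b.2) - φ ξ) := by
  classical
  let f : Site d × Site d → ℝ := fun p => if Nbr p.1 p.2 then
    lam.rate t p.1 p.2 *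
      (occ ξ p.1 * (1 - occ ξ p.2) * (φ (moveParticle ξ p.1 p.2) - φ ξ)) else 0
  have h1 : generator lam t φ ξ = ∑ p ∈ touching A, f p := by
    refine tsum_eq_sum fun p hp => ?_
    by_cases hn : Nbr p.1 p.2
    · rw [mem_touching] at hp
      push Not at hp
      obtain ⟨h1, h2⟩ := hp hn
      have : φ (moveParticle ξ p.1 p.2) = φ ξ := by
        refine hφ fun x hx => ?_
        have hx1 : x ≠ p.1 := fun h => h1 (h ▸ hx)
        have hx2 : x ≠ p.2 := fun h => h2 (h ▸ hx)
        simp [moveParticle, hx1, hx2]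
      simp [this]
    · simp [hn]
  have h2 : ∑ p ∈ touching A, f p = ∑ p ∈ touching A, f p.swap := by
    refine Finset.sum_nbij' Prod.swap Prod.swap ?_ ?_ ?_ ?_ ?_ <;>
      simp +contextual [mem_touching, or_comm, nbr_comm]
  -- If the two occupations differ, exactly one of the two orientations allows a move, and that move
  -- is the exchange. If they agree, both sides vanish. The factor `2` compensates the halved rate.
  have h3 : ∀ p ∈ touching A, f p + f p.swap =
      2 * (halfRate lam t p * (φ (ξ ∘ Equiv.swap p.1 p.2) - φ ξ)) := by
    rintro ⟨x, y⟩ hp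
    have hn : Nbr x y := (mem_touching.1 hp).1
    have hn' : Nbr y x := nbr_comm.1 hn
    have hxy : x ≠ y := by
      rintro rfl; simp [Nbr] at hn
    simp only [f, halfRate, hn, hn', if_true, Prod.fst_swap, Prod.snd_swap, lam.symm t y x hn']
    have hsame : ξ x = ξ y → ξ ∘ Equiv.swap x y = ξ := by
      intro h; funext z
      simp only [Function.comp, Equiv.swap_apply_def]
      split_ifs with h1 h2
      · rw [h1, h]
      · rw [h2, h]
      · rfl
    have hmv : ∀ x y : Site d, x ≠ y → ξ x = true → ξ y = false →
        moveParticle ξ x y = ξ ∘ Equiv.swap x y := by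
      intro x y hxy hx hy; funext z
      simp only [Function.comp, Equiv.swap_apply_def, moveParticle, Function.update_apply]
      split_ifs <;> simp_all
    cases hx : ξ x <;> cases hy : ξ y
    · rw [hsame (hx.trans hy.symm)]; simp [occ, hx, hy]
    · rw [hmv y x hxy.symm hy hx, Equiv.swap_comm y x]; simp [occ, hx, hy]; ring
    · rw [hmv x y hxy hx hy]; simp [occ, hx, hy]; ring
    · rw [hsame (hx.trans hy.symm)]; simp [occ, hx, hy]
  have h4 : 2 * ∑ p ∈ touching A, f p =
      2 * ∑ b ∈ touching A, halfRate lam t b * (φ (ξ ∘ Equiv.swap b.1 b.2) - φ ξ) := by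
    rw [two_mul]
    nth_rw 2 [h2]
    rw [← Finset.sum_add_distrib, Finset.sum_congr rfl h3, Finset.mul_sum]
  rw [h1]
  linarith

end Bonds

/-! ### Measurability of right-continuous processes. -/

section RightContinuous

/-- Approximate the time from the right by points of a grid of mesh `1 / (n + 1)`. The
approximations take countably many times, hence are jointly measurable, and they converge by right
continuity. -/
theorem measurable_uncurry_of_rightContinuous {Ω : Type*} [MeasurableSpace Ω] {f : ℝ → Ω → ℝ}
    (hf : ∀ r, Measurable (f r)) (hr : ∀ ω r, ContinuousWithinAt (fun r => f r ω) (Set.Ici r) r) :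
    Measurable (Function.uncurry f) := by
  let a : ℕ → ℝ → ℝ := fun n r => ((⌊r * (n + 1)⌋ : ℝ) + 1) / (n + 1)
  have ha : ∀ r, Tendsto (fun n => a n r) atTop (𝓝[≥] r) := by
    intro r
    refine tendsto_nhdsWithin_iff.2 ⟨?_, Eventually.of_forall fun n => ?_⟩
    · have h1 : Tendsto (fun n : ℕ => r + 1 / ((n : ℝ) + 1)) atTop (𝓝 (r + 0)) :=
        tendsto_const_nhds.add tendsto_one_div_add_atTop_nhds_zero_nat
      rw [add_zero] at h1
      refine tendsto_of_tendsto_of_tendsto_of_le_of_le tendsto_const_nhds h1 (fun n => ?_)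
        (fun n => ?_)
      · have hn : (0 : ℝ) < n + 1 := by positivity
        simp only [a]
        rw [le_div_iff₀ hn]
        exact (Int.lt_floor_add_one _).le
      · have hn : (0 : ℝ) < n + 1 := by positivity
        simp only [a]
        rw [div_le_iff₀ hn, add_mul, one_div, inv_mul_cancel₀ hn.ne']
        linarith [Int.floor_le (r * (n + 1))]
    · have hn : (0 : ℝ) < n + 1 := by positivity
      simp only [a, Set.mem_Ici]
      rw [le_div_iff₀ hn]
      exact (Int.lt_floor_add_one _).le
  refine measurable_of_tendsto_metrizable (f := fun n (p : ℝ × Ω) => f (a n p.1) p.2) ?_ ?_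
  · intro n
    have h1 : Measurable fun q : ℤ × Ω => f (((q.1 : ℝ) + 1) / (n + 1)) q.2 :=
      measurable_from_prod_countable_right fun z => hf (((z : ℝ) + 1) / (n + 1))
    have h2 : Measurable fun p : ℝ × Ω => (⌊p.1 * (n + 1)⌋, p.2) :=
      (Int.measurable_floor.comp (measurable_fst.mul_const _)).prodMk measurable_snd
    exact h1.comp h2
  · rw [tendsto_pi_nhds]
    rintro ⟨r, ω⟩
    exact (hr ω r).tendsto.comp (ha r)

theorem measurable_of_rightContinuous {g : ℝ → ℝ}
    (hr : ∀ r, ContinuousWithinAt g (Set.Ici r) r) : Measurable g := by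
  have := measurable_uncurry_of_rightContinuous (Ω := Unit) (f := fun r _ => g r)
    (fun r => measurable_const) (fun _ r => hr r)
  exact this.comp (measurable_id.prodMk (measurable_const (a := ())))

theorem continuousWithinAt_comp_toNNReal {E : Type*} [TopologicalSpace E] {f : ℝ≥0 → E}
    (hf : ∀ t, ContinuousWithinAt f (Set.Ici t) t) (t₀ : ℝ≥0) (r : ℝ) :
    ContinuousWithinAt (fun r : ℝ => f (t₀ + r.toNNReal)) (Set.Ici r) r :=
  (hf _).comp (t := Set.Ici (t₀ + r.toNNReal)) (by fun_prop)
    fun s hs => add_le_add_right (Real.toNNReal_le_toNNReal hs) t₀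

end RightContinuous

/-! ### The linear evolution of expectations, from the martingale problem. -/

section Correlation

variable {d : ℕ} {lam : Environment d} {α : ℝ} {Ω : Type*} [mΩ : MeasurableSpace Ω]
  {P : Measure Ω} [IsProbabilityMeasure P] {𝓕 : Filtration ℝ≥0 mΩ} {η : ℝ≥0 → Ω → Config d}

/-- Pull the bounded factor known at time `s` out of the conditional expectation. This is how
conditioning on the past enters the evolution equations. -/
theorem integral_mul_martingale_eq {M : ℝ≥0 → Ω → ℝ} (hM : Martingale M 𝓕 P) {s t : ℝ≥0}
    (hst : s ≤ t) {Z : Ω → ℝ} (hZ : Measurable[𝓕 s] Z) {m : ℝ} (hZm : ∀ ω, |Z ω| ≤ m) :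
    ∫ ω, Z ω * M t ω ∂P = ∫ ω, Z ω * M s ω ∂P := by
  have hZ' : StronglyMeasurable[𝓕 s] Z := hZ.stronglyMeasurable
  have hint : Integrable (Z * M t) P :=
    (hM.integrable t).bdd_mul (hZ'.mono (𝓕.le s)).aestronglyMeasurable (c := m)
      (Eventually.of_forall hZm)
  have h1 := condExp_mul_of_stronglyMeasurable_left hZ' hint (hM.integrable t)
  have h2 := hM.condExp_ae_eq hst
  calc ∫ ω, Z ω * M t ω ∂P = ∫ ω, (P[Z * M t | 𝓕 s]) ω ∂P := (integral_condExp (𝓕.le s)).symm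
    _ = _ := integral_congr_ae (by
      filter_upwards [h1, h2] with ω h1 h2
      rw [h1, Pi.mul_apply, h2])

variable {V : Type*} {σ : Site d × Site d → V → V} {A : V → Finset (Site d)}
  {φ : V → Config d → ℝ}

/-- For functions `φ v` of finitely many occupation variables, permuted among themselves by
exchanging the ends of bonds, the expectations `E[Z φ v (η (t₀ + s))]` evolve by the corresponding
symmetric jump system. -/
theorem IsSSEP.integral_evolution (h : IsSSEP lam P 𝓕 η)
    (hlam : ∀ t x y, Nbr x y → lam.rate t x y ≤ α)
    (hφA : ∀ v, DependsOn (φ v) (A v : Set (Site d))) (hφc : ∀ v, Continuous (φ v))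
    (hφ1 : ∀ v ξ, |φ v ξ| ≤ 1)
    (hφσ : ∀ v b ξ, φ v (ξ ∘ Equiv.swap b.1 b.2) = φ (σ b v) ξ)
    {t₀ : ℝ≥0} {Z : Ω → ℝ} (hZ : Measurable[𝓕 t₀] Z) {m : ℝ} (hZm : ∀ ω, |Z ω| ≤ m) (v : V) :
    let ρ : ℝ → V → ℝ := fun s v => ∫ ω, Z ω * φ v (η (t₀ + s.toNNReal) ω) ∂P
    (∀ τ, ContinuousOn (fun s => ρ s v) (Set.Icc 0 τ)) ∧
    ∀ s, 0 < s → HasDerivWithinAt (fun s => ρ s v)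
      (jumpDrift σ (fun v => touching (A v)) (halfRate lam (t₀ + s.toNNReal)) (ρ s) v)
      (Set.Ioi s) s := by
  intro ρ
  have hZ0 : Measurable Z := hZ.mono (𝓕.le t₀) le_rfl
  have hm0 : 0 ≤ m := by
    obtain ⟨ω⟩ : Nonempty Ω := nonempty_of_isProbabilityMeasure P
    exact (abs_nonneg _).trans (hZm ω)
  have hφm : ∀ v, Measurable (φ v) := fun v => (hφc v).measurable
  have hηr : ∀ v ω r, ContinuousWithinAt (fun r : ℝ => φ v (η (t₀ + r.toNNReal) ω)) (Set.Ici r) r :=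
    fun v ω r => continuousWithinAt_comp_toNNReal (f := fun t => φ v (η t ω))
      (fun t => (hφc v).continuousAt.comp_continuousWithinAt (h.cadlag ω t).1) t₀ r
  have hcr : ∀ b r, ContinuousWithinAt (fun r : ℝ => halfRate lam (t₀ + r.toNNReal) b)
      (Set.Ici r) r := fun b r =>
    continuousWithinAt_comp_toNNReal (halfRate_continuousWithinAt lam b) t₀ r
  have hZφm : ∀ (v : V) (r : ℝ), Measurable fun ω => Z ω * φ v (η (t₀ + r.toNNReal) ω) := fun v r =>
    hZ0.mul ((hφm v).comp (h.measurable _))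
  have hZφb : ∀ v t ω, ‖Z ω * φ v (η t ω)‖ ≤ m := fun v t ω => by
    rw [norm_mul]
    exact (mul_le_mul (hZm ω) (hφ1 v _) (abs_nonneg _) hm0).trans (mul_one m).le
  have hρr : ∀ v r, ContinuousWithinAt (fun r => ρ r v) (Set.Ici r) r := fun v r =>
    tendsto_integral_filter_of_dominated_convergence (fun _ => m)
      (Eventually.of_forall fun r => (hZφm v r).aestronglyMeasurable)
      (Eventually.of_forall fun r => Eventually.of_forall fun ω => hZφb v _ ω)
      (integrable_const m)
      (Eventually.of_forall fun ω => (continuousWithinAt_const.mul (hηr v ω r)))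
  have hρb : ∀ r v, |ρ r v| ≤ m := fun r v => by
    have := norm_integral_le_of_norm_le_const (μ := P) (Eventually.of_forall fun ω =>
      hZφb v (t₀ + r.toNNReal) ω)
    simpa using this
  let G : ℝ → ℝ := fun r =>
    jumpDrift σ (fun v => touching (A v)) (halfRate lam (t₀ + r.toNNReal)) (ρ r) v
  have hGr : ∀ r, ContinuousWithinAt G (Set.Ici r) r := fun r =>
    tendsto_finsetSum _ fun b _ => (hcr b r).mul ((hρr _ r).sub (hρr _ r))
  have hGm : Measurable G := measurable_of_rightContinuous hGr
  set κ : ℝ := (2 * ((A v).card * (originNbrs d).card) : ℕ) * |α| with hκ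
  have hdb : ∀ (t : ℝ≥0) (r : V → ℝ) (M : ℝ), 0 ≤ M → (∀ v, |r v| ≤ M) →
      |∑ b ∈ touching (A v), halfRate lam t b * (r (σ b v) - r v)| ≤ κ * (2 * M) := by
    intro t r M hM hr
    calc _ ≤ ∑ b ∈ touching (A v), |halfRate lam t b * (r (σ b v) - r v)| :=
          Finset.abs_sum_le_sum_abs _ _
      _ ≤ ∑ b ∈ touching (A v), halfRate lam t b * (2 * M) := by
          refine Finset.sum_le_sum fun b _ => ?_
          rw [abs_mul, abs_of_nonneg (halfRate_nonneg lam t b)]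
          refine mul_le_mul_of_nonneg_left ?_ (halfRate_nonneg lam t b)
          exact (abs_sub _ _).trans (by linarith [hr (σ b v), hr v])
      _ ≤ κ * (2 * M) := by
          rw [← Finset.sum_mul]
          exact mul_le_mul_of_nonneg_right (sum_halfRate_le hlam t le_rfl) (by positivity)
  have hGb : ∀ r, |G r| ≤ κ * (2 * m) := fun r => hdb _ (ρ r) m hm0 (hρb r)
  have hGi : ∀ a b, IntervalIntegrable G volume a b := fun a b => by
    rw [intervalIntegrable_iff]
    exact IntegrableOn.of_bound (by simp) hGm.aestronglyMeasurable (κ * (2 * m))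
      (Eventually.of_forall hGb)
  let g : ℝ → Ω → ℝ := fun r ω => generator lam r.toNNReal (φ v) (η r.toNNReal ω)
  have hg : ∀ r ω, g r ω = ∑ b ∈ touching (A v), halfRate lam r.toNNReal b *
      (φ (σ b v) (η r.toNNReal ω) - φ v (η r.toNNReal ω)) := fun r ω => by
    simp only [g, generator_eq_sum lam _ (hφA v), hφσ]
  have hgb : ∀ r ω, |g r ω| ≤ κ * (2 * 1) := fun r ω => by
    rw [hg]
    exact hdb _ (fun v => φ v (η r.toNNReal ω)) 1 zero_le_one fun v => hφ1 v _
  have hgm : Measurable (Function.uncurry g) := by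
    refine measurable_uncurry_of_rightContinuous (fun r => ?_) (fun ω r => ?_)
    · rw [show g r = _ from funext (hg r)]
      exact Finset.measurable_fun_sum _ fun b _ =>
        (((hφm _).comp (h.measurable _)).sub ((hφm _).comp (h.measurable _))).const_mul _
    · have e : (fun r => g r ω) = fun r => ∑ b ∈ touching (A v), halfRate lam (0 + r.toNNReal) b *
        (φ (σ b v) (η (0 + r.toNNReal) ω) - φ v (η (0 + r.toNNReal) ω)) := by
        funext r; simp only [hg, zero_add]
      rw [e]
      refine tendsto_finsetSum _ fun b _ => ?_
      have hφη : ∀ v, ContinuousWithinAt (fun r : ℝ => φ v (η (0 + r.toNNReal) ω)) (Set.Ici r) r :=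
        fun v => continuousWithinAt_comp_toNNReal (f := fun t => φ v (η t ω))
          (fun t => (hφc v).continuousAt.comp_continuousWithinAt (h.cadlag ω t).1) 0 r
      exact (continuousWithinAt_comp_toNNReal (halfRate_continuousWithinAt lam b) 0 r).mul
        ((hφη _).sub (hφη _))
  have hgi : ∀ ω a b, IntervalIntegrable (fun r => g r ω) volume a b := fun ω a b => by
    rw [intervalIntegrable_iff]
    exact IntegrableOn.of_bound (by simp)
      (hgm.comp (measurable_id.prodMk measurable_const)).aestronglyMeasurable (κ * (2 * 1))
      (Eventually.of_forall fun r => hgb r ω)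
  have hIm : ∀ t : ℝ≥0, Integrable (fun ω => φ v (η t ω)) P := fun t =>
    Integrable.of_bound ((hφm v).comp (h.measurable _)).aestronglyMeasurable 1
      (Eventually.of_forall fun ω => hφ1 v _)
  have hM := h.martingale (φ v) ⟨A v, hφA v⟩
  have hZi : ∀ {f : Ω → ℝ}, Integrable f P → Integrable (fun ω => Z ω * f ω) P := fun hf =>
    hf.bdd_mul hZ0.aestronglyMeasurable (c := m) (Eventually.of_forall hZm)
  have hII : ∀ t : ℝ≥0, Integrable (fun ω => ∫ r in (0 : ℝ)..t, g r ω) P := fun t => by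
    have := (hIm t).sub (hM.integrable t)
    refine this.congr (Eventually.of_forall fun ω => ?_)
    simp [g]
  -- Testing the martingale of `φ v` against `Z` between `t₀` and `t₀ + s`, together with Fubini,
  -- gives the equation in integrated form.
  have hint : ∀ s, 0 ≤ s → ρ s v = ρ 0 v + ∫ r in (0 : ℝ)..s, G r := by
    intro s hs
    have hle : t₀ ≤ t₀ + s.toNNReal := le_self_add
    have h1 := integral_mul_martingale_eq hM hle hZ hZm
    simp only [mul_sub] at h1
    rw [integral_sub (hZi (hIm _)) (hZi (hII _)), integral_sub (hZi (hIm _)) (hZi (hII _))] at h1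
    have h2 : (∫ ω, Z ω * (∫ r in (0 : ℝ)..(t₀ + s.toNNReal : ℝ≥0), g r ω) ∂P) -
        (∫ ω, Z ω * (∫ r in (0 : ℝ)..t₀, g r ω) ∂P) =
        ∫ ω, (∫ r in (0 : ℝ)..s, Z ω * g (t₀ + r) ω) ∂P := by
      rw [← integral_sub (hZi (hII _)) (hZi (hII _))]
      refine integral_congr_ae (Eventually.of_forall fun ω => ?_)
      simp only [← mul_sub]
      rw [intervalIntegral.integral_interval_sub_left (hgi _ _ _) (hgi _ _ _),
        intervalIntegral.integral_const_mul,
        intervalIntegral.integral_comp_add_left (fun r => g r ω) (t₀ : ℝ)]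
      simp [Real.coe_toNNReal s hs]
    have h3 : ∫ ω, (∫ r in (0 : ℝ)..s, Z ω * g (t₀ + r) ω) ∂P =
        ∫ r in (0 : ℝ)..s, ∫ ω, Z ω * g (t₀ + r) ω ∂P := by
      simp only [intervalIntegral.integral_of_le hs]
      refine integral_integral_swap ?_
      refine Integrable.of_bound (C := m * (κ * (2 * 1))) ?_ (Eventually.of_forall fun p => ?_)
      · refine Measurable.aestronglyMeasurable ?_
        refine (hZ0.comp measurable_fst).mul ?_
        exact hgm.comp ((measurable_snd.const_add _).prodMk measurable_fst)
      · simp only [Function.uncurry, norm_mul]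
        exact mul_le_mul (hZm _) (hgb _ _) (norm_nonneg _) hm0
    have h4 : ∫ r in (0 : ℝ)..s, ∫ ω, Z ω * g (t₀ + r) ω ∂P = ∫ r in (0 : ℝ)..s, G r := by
      refine intervalIntegral.integral_congr fun r hr => ?_
      rw [Set.uIcc_of_le hs] at hr
      have er : ((t₀ : ℝ) + r).toNNReal = t₀ + r.toNNReal := by
        rw [Real.toNNReal_add (NNReal.coe_nonneg t₀) hr.1, Real.toNNReal_coe]
      simp only [G, jumpDrift, hg, er, Finset.mul_sum]
      have hi : ∀ v, Integrable (fun ω => Z ω * φ v (η (t₀ + r.toNNReal) ω)) P := fun v =>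
        Integrable.of_bound (hZφm v r).aestronglyMeasurable m
          (Eventually.of_forall fun ω => hZφb v _ ω)
      rw [integral_finsetSum]
      · refine Finset.sum_congr rfl fun b _ => ?_
        rw [← integral_sub (hi _) (hi _), ← integral_const_mul]
        refine integral_congr_ae (Eventually.of_forall fun ω => ?_)
        simp only; ring
      · intro b _
        refine ((hi (σ b v)).sub (hi v)).const_mul (halfRate lam (t₀ + r.toNNReal) b) |>.congr
          (Eventually.of_forall fun ω => ?_)
        simp only [Pi.sub_apply]; ring
    have h5 : ρ 0 v = ∫ ω, Z ω * φ v (η t₀ ω) ∂P := by simp [ρ]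
    rw [h5, ← h4, ← h3, ← h2]
    simp only [ρ, g] at h1 ⊢
    linarith
  have hprim : Continuous fun s => ∫ r in (0 : ℝ)..s, G r :=
    intervalIntegral.continuous_primitive hGi 0
  refine ⟨fun τ => ?_, fun s hs => ?_⟩
  · refine (continuous_const.add hprim).continuousOn.congr fun s hs => hint s hs.1
  -- The conductances are only càdlàg in time, so `G` is only right-continuous and only right
  -- derivatives are available.
  · have hd : HasDerivWithinAt (fun s => ∫ r in (0 : ℝ)..s, G r) (G s) (Set.Ici s) s :=
      intervalIntegral.integral_hasDerivWithinAt_right (t := Set.Ioi s) (hGi 0 s)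
        hGm.stronglyMeasurable.stronglyMeasurableAtFilter
        ((hGr s).mono Set.Ioi_subset_Ici_self)
    replace hd := hd.mono Set.Ioi_subset_Ici_self
    refine (hd.const_add (ρ 0 v)).congr (fun r hr => ?_) (hint s hs.le)
    exact hint r (hs.le.trans (le_of_lt hr))

end Correlation

/-! ### Lattice weights and Schwartz functions on the rescaled lattice -/

section Weight

variable {d : ℕ}

/-- The weight `(1 + |x / N|) ^ (-(d + 1))`. -/
noncomputable def weight (N : ℕ+) (x : Site d) : ℝ := ((1 + ‖rescale N x‖) ^ (d + 1))⁻¹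

theorem weight_pos (N : ℕ+) (x : Site d) : 0 < weight N x := by unfold weight; positivity

/-- A Riemann sum bound: split the lattice into cubes of side `N` by division with remainder. Each
cube has `N ^ d` sites, on which the weight is comparable to the unscaled weight of the quotient. -/
theorem exists_tsum_weight_le (d : ℕ) : ∃ C : ℝ, 0 ≤ C ∧ ∀ N : ℕ+,
    Summable (weight N : Site d → ℝ) ∧ ∑' x : Site d, weight N x ≤ C * (N : ℝ) ^ d := by
  let w₁ : Site d → ℝ := fun q => ((1 + ‖fun i => (q i : ℝ)‖) ^ (d + 1))⁻¹
  have hw₁ : Summable w₁ := summable_site d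
  refine ⟨2 ^ (d + 1) * ∑' q, w₁ q, mul_nonneg (by positivity) (tsum_nonneg fun q => by positivity),
    fun N => ?_⟩
  have hN : (1 : ℝ) ≤ N := by exact_mod_cast N.pos
  have hN0 : (0 : ℝ) < N := by linarith
  have : NeZero (N : ℕ) := ⟨N.ne_zero⟩
  let e : Site d ≃ (Fin d → ℤ) × (Fin d → Fin N) :=
    (Equiv.piCongrRight fun _ => Int.divModEquiv N).trans
      (Equiv.arrowProdEquivProdArrow (Fin d) (fun _ => ℤ) (fun _ => Fin N))
  have he : ∀ (q : Fin d → ℤ) (r : Fin d → Fin N) i,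
      (e.symm (q, r)) i = (r i : ℕ) + (N : ℕ) * q i := by
    intro q r i
    simp only [e, Equiv.symm_trans_apply, Equiv.arrowProdEquivProdArrow_symm_apply,
      Equiv.piCongrRight_symm_apply, Pi.map_apply]
    simp [Int.divModEquiv]; ring
  have hle : ∀ q r, weight N (e.symm (q, r)) ≤ 2 ^ (d + 1) * w₁ q := by
    intro q r
    have h1 : ‖fun i => (q i : ℝ)‖ ≤ ‖rescale N (e.symm (q, r))‖ + 1 := by
      rw [pi_norm_le_iff_of_nonneg (by positivity)]
      intro i
      have h2 := PiLp.norm_apply_le (rescale N (e.symm (q, r))) i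
      have h3 : (rescale N (e.symm (q, r))) i = (e.symm (q, r) i : ℝ) / N := rfl
      rw [h3, he] at h2
      have h4 : (((r i : ℕ) + (N : ℕ) * q i : ℤ) : ℝ) / N = q i + (r i : ℕ) / N := by
        push_cast; field_simp; ring
      rw [h4] at h2
      have h5 : ‖((r i : ℕ) : ℝ) / N‖ ≤ 1 := by
        rw [Real.norm_of_nonneg (by positivity), div_le_one hN0]
        exact_mod_cast (r i).2.le
      have h6 := norm_sub_le ((q i : ℝ) + (r i : ℕ) / N) ((r i : ℕ) / N)
      rw [add_sub_cancel_right] at h6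
      linarith
    have h2 : 1 + ‖fun i => (q i : ℝ)‖ ≤ 2 * (1 + ‖rescale N (e.symm (q, r))‖) := by
      linarith [norm_nonneg (rescale N (e.symm (q, r)))]
    have h3 := pow_le_pow_left₀ (by positivity) h2 (d + 1)
    rw [mul_pow] at h3
    simp only [weight, w₁]
    rw [← div_eq_mul_inv, inv_eq_one_div, div_le_div_iff₀ (by positivity) (by positivity)]
    linarith
  have hs : Summable fun p : (Fin d → ℤ) × (Fin d → Fin N) => weight N (e.symm p) := by
    refine (summable_prod_of_nonneg fun p => (weight_pos N _).le).2 ⟨fun q => ?_, ?_⟩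
    · exact (hasSum_fintype _).summable
    · refine Summable.of_nonneg_of_le (fun q => tsum_nonneg fun r => (weight_pos N _).le)
        (fun q => ?_) (hw₁.mul_left ((N : ℝ) ^ d * 2 ^ (d + 1)))
      rw [tsum_fintype]
      refine (Finset.sum_le_card_nsmul _ _ _ fun r _ => hle q r).trans ?_
      rw [nsmul_eq_mul]; simp [mul_assoc]
  refine ⟨(e.symm.summable_iff).1 hs, ?_⟩
  rw [← e.symm.tsum_eq, hs.tsum_prod]
  calc _ ≤ ∑' q, (N : ℝ) ^ d * 2 ^ (d + 1) * w₁ q := by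
        refine Summable.tsum_le_tsum (fun q => ?_) ?_ (hw₁.mul_left _)
        · rw [tsum_fintype]
          refine (Finset.sum_le_card_nsmul _ _ _ fun r _ => hle q r).trans ?_
          rw [nsmul_eq_mul]; simp [mul_assoc]
        · exact hs.prod
    _ = _ := by rw [tsum_mul_left]; ring

theorem norm_rescale_sub_le (N : ℕ+) {x y : Site d} (h : Nbr x y) :
    ‖rescale N y - rescale N x‖ ≤ 1 / (N : ℝ) := by
  have hN0 : (0 : ℝ) < N := by exact_mod_cast N.pos
  rw [EuclideanSpace.norm_eq]
  refine Real.sqrt_le_iff.2 ⟨by positivity, ?_⟩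
  have h1 : ∀ i, ‖(rescale N y - rescale N x) i‖ = |((x i - y i : ℤ) : ℝ)| / N := by
    intro i
    have : (rescale N y - rescale N x) i = (y i : ℝ) / N - (x i : ℝ) / N := rfl
    rw [this, ← sub_div, norm_div, Real.norm_of_nonneg hN0.le, Real.norm_eq_abs, abs_sub_comm]
    push_cast; rfl
  simp only [h1]
  have h2 : ∑ i, |((x i - y i : ℤ) : ℝ)| = 1 := by
    have : ∑ i, |x i - y i| = 1 := h
    exact_mod_cast this
  calc _ ≤ (∑ i, |((x i - y i : ℤ) : ℝ)| / N) ^ 2 :=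
        Finset.sum_sq_le_sq_sum_of_nonneg fun i _ => by positivity
    _ = _ := by rw [← Finset.sum_div, h2]

theorem one_add_pow_le {δ : ℝ} (h0 : 0 ≤ δ) (h1 : δ ≤ 1) (n : ℕ) :
    (1 + δ) ^ n ≤ 1 + 3 ^ n * δ := by
  induction n with
  | zero => simp [h0]
  | succ n ih =>
    have h3 : (1 : ℝ) ≤ 3 ^ n := one_le_pow₀ (by norm_num)
    rw [pow_succ, pow_succ]
    nlinarith [mul_le_mul_of_nonneg_right ih (by linarith : 0 ≤ 1 + δ),
      mul_nonneg (mul_nonneg (by linarith : (0 : ℝ) ≤ 3 ^ n) h0) (sub_nonneg.2 h1),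
      mul_nonneg h0 (sub_nonneg.2 h3)]

/-- Neighbours are at rescaled distance at most `1 / N`, so their weights differ by a factor of at
most `(1 + 1 / N) ^ (d + 1)`, which is `1 + O(1 / N)`. -/
theorem abs_weight_sub_le (N : ℕ+) {x y : Site d} (h : Nbr x y) :
    |weight N y - weight N x| ≤ 3 ^ (d + 1) / (N : ℝ) * weight N x := by
  have hN : (1 : ℝ) ≤ N := by exact_mod_cast N.pos
  have hN0 : (0 : ℝ) < N := by linarith
  have hδ0 : (0 : ℝ) ≤ 1 / N := by positivity
  have hδ1 : (1 : ℝ) / N ≤ 1 := by rw [div_le_one hN0]; exact hN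
  set q : ℝ := (1 + 1 / (N : ℝ)) ^ (d + 1) with hq
  have hq1 : 1 ≤ q := one_le_pow₀ (by linarith)
  have hq2 : q - 1 ≤ 3 ^ (d + 1) / (N : ℝ) := by
    have := one_add_pow_le hδ0 hδ1 (d + 1)
    rw [← hq, mul_one_div] at this; linarith
  have key : ∀ {x y : Site d}, Nbr x y → weight N y ≤ q * weight N x := by
    intro x y h
    have h1 := norm_rescale_sub_le N h
    have h2 := norm_sub_norm_le (rescale N x) (rescale N y)
    rw [norm_sub_rev] at h2
    have h3 : 1 + ‖rescale N x‖ ≤ (1 + 1 / (N : ℝ)) * (1 + ‖rescale N y‖) := by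
      nlinarith [mul_nonneg hδ0 (norm_nonneg (rescale N y))]
    have h4 := pow_le_pow_left₀ (by positivity) h3 (d + 1)
    rw [mul_pow, ← hq] at h4
    simp only [weight]
    rw [← div_eq_mul_inv, inv_eq_one_div, div_le_div_iff₀ (by positivity) (by positivity)]
    linarith
  have h1 := key h
  have h2 := key (nbr_comm.1 h)
  have hx := (weight_pos N x).le
  have hy := (weight_pos N y).le
  refine (abs_le.2 ⟨?_, ?_⟩).trans (mul_le_mul_of_nonneg_right hq2 hx)
  · nlinarith
  · linarith

theorem abs_weight_swap_sub_le (N : ℕ+) {b : Site d × Site d} (h : Nbr b.1 b.2) (x : Site d) :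
    |weight N (Equiv.swap b.1 b.2 x) - weight N x| ≤ 3 ^ (d + 1) / (N : ℝ) * weight N x := by
  rw [Equiv.swap_apply_def]
  split_ifs with h1 h2
  · subst h1; exact abs_weight_sub_le N h
  · subst h2; exact abs_weight_sub_le N (nbr_comm.1 h)
  · rw [sub_self, abs_zero]; have := weight_pos N x; positivity

theorem abs_schwartz_le_of_bound {G : 𝓢(Space d, ℝ)} {M : ℝ}
    (hM : ∀ x, (1 + ‖x‖) ^ (d + 1) * |G x| ≤ M) (N : ℕ+) (x : Site d) :
    |G (rescale N x)| ≤ M * weight N x := by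
  rw [weight, ← div_eq_mul_inv, le_div_iff₀ (by positivity), mul_comm]
  exact hM _

theorem exists_schwartz_bound (G : 𝓢(Space d, ℝ)) (k : ℕ) : ∃ M : ℝ, 0 ≤ M ∧
    (∀ x, (1 + ‖x‖) ^ k * |G x| ≤ M) ∧ ∀ x, (1 + ‖x‖) ^ k * ‖fderiv ℝ G x‖ ≤ M := by
  refine ⟨2 ^ k * ((Finset.Iic (k, 1)).sup fun m : ℕ × ℕ =>
    SchwartzMap.seminorm ℝ m.1 m.2) G, by positivity, fun x => ?_, fun x => ?_⟩
  · have := SchwartzMap.one_add_le_sup_seminorm_apply (𝕜 := ℝ) (m := (k, 1)) (k := k)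
      (n := 0) le_rfl zero_le_one G x
    rwa [norm_iteratedFDeriv_zero] at this
  · have := SchwartzMap.one_add_le_sup_seminorm_apply (𝕜 := ℝ) (m := (k, 1)) (k := k)
      (n := 1) le_rfl le_rfl G x
    rwa [norm_iteratedFDeriv_one] at this

theorem exists_lattice_bound (G : 𝓢(Space d, ℝ)) : ∃ M : ℝ, 0 ≤ M ∧ ∀ N : ℕ+,
    (∀ x : Site d, |G (rescale N x)| ≤ M * weight N x) ∧
    ∀ x y : Site d, Nbr x y → |G (rescale N y) - G (rescale N x)| ≤ M / N * weight N x := by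
  obtain ⟨M, hM0, hM, hM'⟩ := exists_schwartz_bound G (d + 1)
  refine ⟨2 ^ (d + 1) * M, by positivity, fun N => ⟨fun x => ?_, fun x y h => ?_⟩⟩
  · refine (abs_schwartz_le_of_bound hM N x).trans ?_
    have := (weight_pos N x).le
    exact mul_le_mul_of_nonneg_right
      (le_mul_of_one_le_left hM0 (one_le_pow₀ (by norm_num))) this
  · have hN : (1 : ℝ) ≤ N := by exact_mod_cast N.pos
    have hN0 : (0 : ℝ) < N := by linarith
    have h1 := norm_rescale_sub_le N h
    have hδ1 : (1 : ℝ) / N ≤ 1 := by rw [div_le_one hN0]; exact hN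
    -- On a ball of radius at most one, `1 + ‖z‖` is at least half of `1 + ‖rescale N x‖`; this is
    -- the origin of `2 ^ (d + 1)`.
    have hb : ∀ z ∈ Metric.closedBall (rescale N x) (1 / (N : ℝ)),
        ‖fderiv ℝ G z‖ ≤ 2 ^ (d + 1) * M * weight N x := by
      intro z hz
      rw [mem_closedBall_iff_norm] at hz
      have h2 : 1 + ‖rescale N x‖ ≤ 2 * (1 + ‖z‖) := by
        have := norm_sub_norm_le (rescale N x) z
        rw [norm_sub_rev] at this
        linarith [norm_nonneg z]
      have h3 := pow_le_pow_left₀ (by positivity) h2 (d + 1)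
      rw [mul_pow] at h3
      rw [weight, ← div_eq_mul_inv, le_div_iff₀ (by positivity)]
      calc _ ≤ ‖fderiv ℝ G z‖ * (2 ^ (d + 1) * (1 + ‖z‖) ^ (d + 1)) := by gcongr
        _ = 2 ^ (d + 1) * ((1 + ‖z‖) ^ (d + 1) * ‖fderiv ℝ G z‖) := by ring
        _ ≤ _ := by gcongr; exact hM' z
    have h2 := (convex_closedBall (rescale N x) (1 / (N : ℝ))).norm_image_sub_le_of_norm_fderiv_le
      (𝕜 := ℝ) (f := G) (fun z _ => G.differentiableAt) hb
      (Metric.mem_closedBall_self (by positivity)) (mem_closedBall_iff_norm.2 h1)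
    rw [Real.norm_eq_abs] at h2
    refine h2.trans ?_
    have hC : 0 ≤ 2 ^ (d + 1) * M * weight N x := by have := weight_pos N x; positivity
    refine (mul_le_mul_of_nonneg_left h1 hC).trans_eq ?_
    ring

theorem abs_schwartz_swap_sub_le {G : 𝓢(Space d, ℝ)} {M : ℝ} (hM0 : 0 ≤ M) {N : ℕ+}
    (hM : ∀ x y : Site d, Nbr x y → |G (rescale N y) - G (rescale N x)| ≤ M / N * weight N x)
    {b : Site d × Site d} (h : Nbr b.1 b.2) (x : Site d) :
    |G (rescale N (Equiv.swap b.1 b.2 x)) - G (rescale N x)| ≤ M / N * weight N x := by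
  rw [Equiv.swap_apply_def]
  split_ifs with h1 h2
  · subst h1; exact hM _ _ h
  · subst h2; exact hM _ _ (nbr_comm.1 h)
  · rw [sub_self, abs_zero]; have := weight_pos N x; positivity

end Weight

/-! ### Second moments of the increments of the density field -/

section SecondMoment

variable {d : ℕ} {lam : Environment d} {α : ℝ}

theorem abs_integral_le_integral_abs_of_le {Ω : Type*} [MeasurableSpace Ω] {P : Measure Ω}
    {Z f : Ω → ℝ} (hZ : Integrable Z P) (hf : ∀ ω, |f ω| ≤ 1) :
    |∫ ω, Z ω * f ω ∂P| ≤ ∫ ω, |Z ω| ∂P := by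
  rw [← Real.norm_eq_abs]
  refine norm_integral_le_of_norm_le hZ.abs (Eventually.of_forall fun ω => ?_)
  rw [Real.norm_eq_abs, abs_mul]
  exact mul_le_of_le_one_right (abs_nonneg _) (hf ω)

theorem hasSum_integral_mul_tsum {Ω V : Type*} [MeasurableSpace Ω] [Countable V] {P : Measure Ω}
    [IsProbabilityMeasure P] {Z : Ω → ℝ} (hZ : Measurable Z) {m : ℝ} (hZm : ∀ ω, |Z ω| ≤ m)
    {f : V → Ω → ℝ} (hf : ∀ v, Measurable (f v)) (hf1 : ∀ v ω, |f v ω| ≤ 1) {H w : V → ℝ}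
    (hw : Summable w) {C : ℝ} (hH : ∀ v, |H v| ≤ C * w v) :
    HasSum (fun v => H v * ∫ ω, Z ω * f v ω ∂P) (∫ ω, Z ω * ∑' v, H v * f v ω ∂P) := by
  have hb : ∀ v ω, ‖H v * (Z ω * f v ω)‖ ≤ (C * m) * w v := fun v ω => by
    rw [norm_mul, norm_mul]
    have h1 : ‖Z ω‖ * ‖f v ω‖ ≤ m * 1 :=
      mul_le_mul (hZm ω) (hf1 v ω) (norm_nonneg _) ((abs_nonneg _).trans (hZm ω))
    calc _ ≤ (C * w v) * (m * 1) := mul_le_mul (hH v) h1 (by positivity)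
          ((abs_nonneg _).trans (hH v))
      _ = _ := by ring
  have h := hasSum_integral_of_dominated_convergence (μ := P)
    (F := fun v ω => H v * (Z ω * f v ω)) (f := fun ω => ∑' v, H v * (Z ω * f v ω))
    (fun v _ => (C * m) * w v)
    (fun v => ((hZ.mul (hf v)).const_mul _).aestronglyMeasurable)
    (fun v => Eventually.of_forall fun ω => hb v ω)
    (Eventually.of_forall fun ω => hw.mul_left _) (integrable_const _)
    (Eventually.of_forall fun ω =>
      (Summable.of_norm_bounded (hw.mul_left _) fun v => hb v ω).hasSum)
  simp only [integral_const_mul] at h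
  have e : ∀ ω, Z ω * ∑' v, H v * f v ω = ∑' v, H v * (Z ω * f v ω) := fun ω => by
    rw [← tsum_mul_left]
    exact tsum_congr fun v => by ring
  simpa only [e] using h

/-- The energy bound is applied to `ρ s v = E[Z φ v (η (t₀ + s))]`, which is at most `E|Z|` in
absolute value. The factor `E|Z|` in the result is what later makes the estimates conditional ones.
-/
theorem IsSSEP.abs_integral_mul_tsum_sub_le {Ω : Type*} [mΩ : MeasurableSpace Ω]
    {P : Measure Ω} [IsProbabilityMeasure P] {𝓕 : Filtration ℝ≥0 mΩ} {η : ℝ≥0 → Ω → Config d}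
    {V : Type*} [Countable V] {σ : Site d × Site d → V → V} {A : V → Finset (Site d)}
    {φ : V → Config d → ℝ} (h : IsSSEP lam P 𝓕 η)
    (hlam : ∀ t x y, Nbr x y → lam.rate t x y ≤ α)
    (hφA : ∀ v, DependsOn (φ v) (A v : Set (Site d))) (hφc : ∀ v, Continuous (φ v))
    (hφ1 : ∀ v ξ, |φ v ξ| ≤ 1)
    (hφσ : ∀ v b ξ, φ v (ξ ∘ Equiv.swap b.1 b.2) = φ (σ b v) ξ)
    (hσ : ∀ b v, σ b (σ b v) = v)
    (hA : ∀ b v, b ∈ touching (A (σ b v)) ↔ b ∈ touching (A v)) {k : ℕ} (hk : ∀ v, (A v).card ≤ k)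
    {w H : V → ℝ} (hw0 : ∀ v, 0 ≤ w v) (hw : Summable w) {C θ ν γ : ℝ}
    (hH : ∀ v, |H v| ≤ C * w v)
    (hwθ : ∀ v, ∀ b : Site d × Site d, Nbr b.1 b.2 → |w (σ b v) - w v| ≤ θ * w v)
    (hHν : ∀ v, ∀ b : Site d × Site d, Nbr b.1 b.2 → |H (σ b v) - H v| ≤ ν * w v) (hγ : 0 < γ)
    {t₀ : ℝ≥0} {Z : Ω → ℝ} (hZ : Measurable[𝓕 t₀] Z) {m : ℝ} (hZm : ∀ ω, |Z ω| ≤ m) (τ : ℝ≥0) :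
    |∫ ω, Z ω * ∑' v, H v * φ v (η (t₀ + τ) ω) ∂P - ∫ ω, Z ω * ∑' v, H v * φ v (η t₀ ω) ∂P| ≤
      (∫ ω, |Z ω| ∂P) * ((∑' v, w v) * (γ + τ * ((2 * (k * (originNbrs d).card) : ℕ) * |α|) *
        (ν ^ 2 / (8 * γ) + γ * θ ^ 2 / 2))) := by
  classical
  have hZ0 : Measurable Z := hZ.mono (𝓕.le t₀) le_rfl
  have hZi : Integrable Z P := Integrable.of_bound hZ0.aestronglyMeasurable m
    (Eventually.of_forall hZm)
  have hs : ∀ t, HasSum (fun v => H v * ∫ ω, Z ω * φ v (η t ω) ∂P)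
      (∫ ω, Z ω * ∑' v, H v * φ v (η t ω) ∂P) := fun t =>
    hasSum_integral_mul_tsum hZ0 hZm (fun v => (hφc v).measurable.comp (h.measurable t))
      (fun v ω => hφ1 v _) hw hH
  have hev := h.integral_evolution hlam hφA hφc hφ1 hφσ hZ hZm
  have hcm : ∀ b, Measurable fun s : ℝ => halfRate lam (t₀ + s.toNNReal) b := fun b =>
    measurable_of_rightContinuous fun r =>
      continuousWithinAt_comp_toNNReal (halfRate_continuousWithinAt lam b) t₀ r
  have key := abs_tsum_sub_le_of_evolution (σ := σ) (act := fun v => touching (A v))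
    (c := fun s => halfRate lam (t₀ + s.toNNReal)) hσ hA τ.2
    (fun s _ v b _ => halfRate_nonneg lam _ b) hcm
    (fun s _ v => sum_halfRate_le hlam _ (hk v)) hw0 hw hH
    (fun v b hb => hwθ v b (mem_touching.1 hb).1) (fun v b hb => hHν v b (mem_touching.1 hb).1) hγ
    (ρ := fun s v => ∫ ω, Z ω * φ v (η (t₀ + s.toNNReal) ω) ∂P)
    (integral_nonneg fun ω => abs_nonneg (Z ω))
    (fun s _ v => abs_integral_le_integral_abs_of_le hZi fun ω => hφ1 v _)
    (fun v => (hev v).1 _) (fun v s hs => (hev v).2 s hs.1)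
  rw [← (hs (t₀ + τ)).tsum_eq, ← (hs t₀).tsum_eq, ← (hs _).summable.tsum_sub (hs _).summable]
  refine le_trans (le_of_eq ?_) key
  congr 1
  refine tsum_congr fun v => ?_
  simp [mul_sub]

theorem continuous_occ (x : Site d) : Continuous fun ξ : Config d => occ ξ x :=
  (continuous_of_discreteTopology (f := fun b : Bool => if b then (1 : ℝ) else 0)).comp
    (continuous_apply x)

/-- Exchanging the ends of a bond does not change whether the bond touches a label; this provides
the symmetry of the active bonds required by the energy estimate. -/
theorem swap_mem_touching_iff {x : Site d} {b : Site d × Site d} :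
    (b.1 = Equiv.swap b.1 b.2 x ∨ b.2 = Equiv.swap b.1 b.2 x) ↔ (b.1 = x ∨ b.2 = x) := by
  rw [Equiv.swap_apply_def]
  split_ifs with h1 h2
  · simp [h1]
  · simp [h2]
  · simp

theorem IsSSEP.abs_integral_field_sub_le {Ω : Type*} [mΩ : MeasurableSpace Ω]
    {P : Measure Ω} [IsProbabilityMeasure P] {𝓕 : Filtration ℝ≥0 mΩ} {η : ℝ≥0 → Ω → Config d}
    (h : IsSSEP lam P 𝓕 η) (hlam : ∀ t x y, Nbr x y → lam.rate t x y ≤ α) (N : ℕ+)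
    (hw : Summable (weight N : Site d → ℝ)) {G : 𝓢(Space d, ℝ)} {M : ℝ} (hM0 : 0 ≤ M)
    (hM : ∀ x : Site d, |G (rescale N x)| ≤ M * weight N x)
    (hM' : ∀ x y : Site d, Nbr x y → |G (rescale N y) - G (rescale N x)| ≤ M / N * weight N x)
    {γ : ℝ} (hγ : 0 < γ)
    {t₀ : ℝ≥0} {Z : Ω → ℝ} (hZ : Measurable[𝓕 t₀] Z) {m : ℝ} (hZm : ∀ ω, |Z ω| ≤ m) (τ : ℝ≥0) :
    |∫ ω, Z ω * ∑' x, G (rescale N x) * occ (η (t₀ + τ) ω) x ∂P -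
      ∫ ω, Z ω * ∑' x, G (rescale N x) * occ (η t₀ ω) x ∂P| ≤
      (∫ ω, |Z ω| ∂P) * ((∑' x : Site d, weight N x) *
        (γ + τ * ((2 * (1 * (originNbrs d).card) : ℕ) * |α|) *
        ((M / N) ^ 2 / (8 * γ) + γ * (3 ^ (d + 1) / N) ^ 2 / 2))) := by
  refine h.abs_integral_mul_tsum_sub_le (V := Site d) (σ := fun b => Equiv.swap b.1 b.2)
    (A := fun x => {x}) (φ := fun x ξ => occ ξ x) hlam ?_ continuous_occ
    (fun x ξ => norm_occ_le ξ x) (fun x b ξ => rfl) (fun b x => Equiv.swap_apply_self _ _ _) ?_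
    (fun x => (Finset.card_singleton x).le) (fun x => (weight_pos N x).le) hw hM
    (fun x b hb => abs_weight_swap_sub_le N hb x)
    (fun x b hb => abs_schwartz_swap_sub_le hM0 hM' hb x) hγ hZ hZm τ
  · intro x ξ ξ' hξ
    simp only [occ, hξ x (by simp)]
  · intro b x
    simp only [mem_touching, Finset.mem_singleton, swap_mem_touching_iff]

/-- The square of the field is linear in the products `occ ξ x * occ ξ y` over all ordered pairs. A
bond exchange acts on both labels at once and preserves the diagonal, so the diagonal needs no
separate treatment. -/
theorem IsSSEP.abs_integral_field_sq_sub_le {Ω : Type*} [mΩ : MeasurableSpace Ω]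
    {P : Measure Ω} [IsProbabilityMeasure P] {𝓕 : Filtration ℝ≥0 mΩ} {η : ℝ≥0 → Ω → Config d}
    (h : IsSSEP lam P 𝓕 η) (hlam : ∀ t x y, Nbr x y → lam.rate t x y ≤ α) (N : ℕ+)
    (hw : Summable (weight N : Site d → ℝ)) {G : 𝓢(Space d, ℝ)} {M : ℝ} (hM0 : 0 ≤ M)
    (hM : ∀ x : Site d, |G (rescale N x)| ≤ M * weight N x)
    (hM' : ∀ x y : Site d, Nbr x y → |G (rescale N y) - G (rescale N x)| ≤ M / N * weight N x)
    {γ : ℝ} (hγ : 0 < γ)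
    {t₀ : ℝ≥0} {Z : Ω → ℝ} (hZ : Measurable[𝓕 t₀] Z) {m : ℝ} (hZm : ∀ ω, |Z ω| ≤ m) (τ : ℝ≥0) :
    |∫ ω, Z ω * (∑' x, G (rescale N x) * occ (η (t₀ + τ) ω) x) ^ 2 ∂P -
      ∫ ω, Z ω * (∑' x, G (rescale N x) * occ (η t₀ ω) x) ^ 2 ∂P| ≤
      (∫ ω, |Z ω| ∂P) * ((∑' x : Site d, weight N x) ^ 2 *
        (γ + τ * ((2 * (2 * (originNbrs d).card) : ℕ) * |α|) *
        ((M ^ 2 * (2 + 3 ^ (d + 1)) / N) ^ 2 / (8 * γ) +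
          γ * (3 ^ (d + 1) * (2 + 3 ^ (d + 1)) / N) ^ 2 / 2))) := by
  classical
  have hN : (1 : ℝ) ≤ N := by exact_mod_cast N.pos
  have hN0 : (0 : ℝ) < N := by linarith
  have hw0 : ∀ x : Site d, 0 ≤ weight N x := fun x => (weight_pos N x).le
  set Θ : ℝ := 3 ^ (d + 1) with hΘ
  have hΘ0 : 0 < Θ := by positivity
  have hΘN : Θ / N ≤ Θ := div_le_self hΘ0.le hN
  have hww : Summable fun v : Site d × Site d => weight N v.1 * weight N v.2 :=
    hw.mul_of_nonneg hw hw0 hw0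
  have hsq : ∀ ξ : Config d, (∑' x, G (rescale N x) * occ ξ x) ^ 2 =
      ∑' v : Site d × Site d, (G (rescale N v.1) * G (rescale N v.2)) * (occ ξ v.1 * occ ξ v.2) := by
    intro ξ
    have hs := summable_mul_occ N ξ G
    rw [sq, tsum_mul_tsum_of_summable_norm hs.norm hs.norm]
    exact tsum_congr fun v => by ring
  have hwsq : (∑' x : Site d, weight N x) ^ 2 =
      ∑' v : Site d × Site d, weight N v.1 * weight N v.2 := by
    rw [sq, tsum_mul_tsum_of_summable_norm hw.norm hw.norm]
  have hwup : ∀ (b : Site d × Site d), Nbr b.1 b.2 → ∀ x,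
      weight N (Equiv.swap b.1 b.2 x) ≤ (1 + Θ) * weight N x := fun b hb x => by
    have h1 := (abs_le.1 (abs_weight_swap_sub_le N hb x)).2
    rw [← hΘ] at h1
    nlinarith [hw0 x, mul_le_mul_of_nonneg_right hΘN (hw0 x)]
  simp only [hsq, hwsq]
  refine h.abs_integral_mul_tsum_sub_le (V := Site d × Site d)
    (σ := fun b v => (Equiv.swap b.1 b.2 v.1, Equiv.swap b.1 b.2 v.2))
    (A := fun v => {v.1, v.2}) (φ := fun v ξ => occ ξ v.1 * occ ξ v.2) (C := M ^ 2)
    (H := fun v => G (rescale N v.1) * G (rescale N v.2))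
    (w := fun v => weight N v.1 * weight N v.2) (k := 2) (θ := Θ * (2 + Θ) / N)
    (ν := M ^ 2 * (2 + Θ) / N) hlam ?_
    (fun v => (continuous_occ v.1).mul (continuous_occ v.2)) ?_ (fun v b ξ => ?_)
    (fun b v => by simp) ?_ (fun v => Finset.card_le_two)
    (fun v => mul_nonneg (hw0 v.1) (hw0 v.2)) hww ?_ ?_ ?_ hγ hZ hZm τ
  · intro v ξ ξ' hξ
    simp only [occ, hξ v.1 (by simp), hξ v.2 (by simp)]
  · intro v ξ
    rw [abs_mul]
    exact mul_le_one₀ (norm_occ_le ξ _) (abs_nonneg _) (norm_occ_le ξ _)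
  · simp only [occ, Function.comp]
  · intro b v
    have h1 := swap_mem_touching_iff (x := v.1) (b := b)
    have h2 := swap_mem_touching_iff (x := v.2) (b := b)
    simp only [mem_touching, Finset.mem_insert, Finset.mem_singleton]
    rw [or_or_or_comm, h1, h2, or_or_or_comm]
  · intro v
    rw [abs_mul]
    calc _ ≤ (M * weight N v.1) * (M * weight N v.2) :=
          mul_le_mul (hM _) (hM _) (abs_nonneg _) (mul_nonneg hM0 (hw0 _))
      _ = _ := by ring
  · intro v b hb
    have h1 := abs_weight_swap_sub_le N hb v.1
    have h2 := abs_weight_swap_sub_le N hb v.2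
    have h3 := hwup b hb v.2
    simp only
    set a := weight N v.1
    set a' := weight N (Equiv.swap b.1 b.2 v.1)
    set c := weight N v.2
    set c' := weight N (Equiv.swap b.1 b.2 v.2)
    have hc' : 0 ≤ c' := hw0 _
    have ha : 0 ≤ a := hw0 _
    have hc : 0 ≤ c := hw0 _
    -- A discrete product rule; replacing `c'` by `(1 + Θ) * c` produces the constant `Θ * (1 + Θ) +
    -- Θ = Θ * (2 + Θ)`.
    calc |a' * c' - a * c| = |(a' - a) * c' + a * (c' - c)| := by ring_nf
      _ ≤ |a' - a| * c' + a * |c' - c| := by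
          refine (abs_add_le _ _).trans ?_
          rw [abs_mul, abs_mul, abs_of_nonneg hc', abs_of_nonneg ha]
      _ ≤ (Θ / N * a) * ((1 + Θ) * c) + a * (Θ / N * c) := by gcongr
      _ = _ := by ring
  · intro v b hb
    have h1 := abs_schwartz_swap_sub_le hM0 hM' hb v.1
    have h2 := abs_schwartz_swap_sub_le hM0 hM' hb v.2
    have h3 := (hM (Equiv.swap b.1 b.2 v.2)).trans
      (mul_le_mul_of_nonneg_left (hwup b hb v.2) hM0)
    have h4 := hM v.1
    simp only
    set a := G (rescale N v.1)
    set a' := G (rescale N (Equiv.swap b.1 b.2 v.1))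
    set c := G (rescale N v.2)
    set c' := G (rescale N (Equiv.swap b.1 b.2 v.2))
    have hx := hw0 v.1
    have hy := hw0 v.2
    calc |a' * c' - a * c| = |(a' - a) * c' + a * (c' - c)| := by ring_nf
      _ ≤ |a' - a| * |c'| + |a| * |c' - c| := by
          refine (abs_add_le _ _).trans ?_
          rw [abs_mul, abs_mul]
      _ ≤ (M / N * weight N v.1) * (M * ((1 + Θ) * weight N v.2)) +
          (M * weight N v.1) * (M / N * weight N v.2) := by gcongr
      _ = _ := by ring

/-- The density field is bounded by the weighted supremum norm of the test function. -/
theorem exists_abs_empiricalField_le (d : ℕ) : ∃ C : ℝ, 0 ≤ C ∧ ∀ (N : ℕ+) (ξ : Config d)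
    (G : 𝓢(Space d, ℝ)) (M : ℝ), (∀ x, (1 + ‖x‖) ^ (d + 1) * |G x| ≤ M) →
    |empiricalField N ξ G| ≤ C * M := by
  obtain ⟨C, hC0, hC⟩ := exists_tsum_weight_le d
  refine ⟨C, hC0, fun N ξ G M hM => ?_⟩
  obtain ⟨hw, hwC⟩ := hC N
  have hN0 : (0 : ℝ) < (N : ℝ) ^ d := by have : (0 : ℝ) < N := by exact_mod_cast N.pos
                                         positivity
  have hM0 : 0 ≤ M := le_trans (by positivity) (hM 0)
  rw [empiricalField_apply, abs_mul, abs_of_pos (inv_pos.2 hN0), inv_mul_le_iff₀ hN0]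
  have h1 : |∑' x : Site d, G (rescale N x) * occ ξ x| ≤ ∑' x : Site d, M * weight N x := by
    rw [← Real.norm_eq_abs]
    refine tsum_of_norm_bounded (hw.mul_left M).hasSum fun x => ?_
    rw [norm_mul]
    exact (mul_le_of_le_one_right (norm_nonneg _) (norm_occ_le ξ x)).trans
      (abs_schwartz_le_of_bound hM N x)
  rw [tsum_mul_left] at h1
  nlinarith [mul_le_mul_of_nonneg_left hwC hM0]

/-- The time factor `N ^ 2` cancels the squares of the `1 / N` gradients, and `γ = √h` balances the
cost `γ` against the term of order `h / γ`. -/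
theorem parabolic_scaling_le {h N κ : ℝ} (ν θ : ℝ) (hh : 0 < h) (hh1 : h ≤ 1) (hN : 0 < N)
    (hκ : 0 ≤ κ) :
    √h + h * N ^ 2 * κ * ((ν / N) ^ 2 / (8 * √h) + √h * (θ / N) ^ 2 / 2) ≤
      √h * (1 + κ * (ν ^ 2 / 8 + θ ^ 2 / 2)) := by
  have hγ : 0 < √h := Real.sqrt_pos.2 hh
  obtain ⟨γ, hγd⟩ : ∃ γ, γ = √h := ⟨_, rfl⟩
  rw [← hγd] at hγ ⊢
  have hγ2 : h = γ ^ 2 := by rw [hγd, Real.sq_sqrt hh.le]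
  have e1 : h * N ^ 2 * κ * ((ν / N) ^ 2 / (8 * γ) + γ * (θ / N) ^ 2 / 2) =
      γ * κ * (ν ^ 2 / 8 + h * θ ^ 2 / 2) := by
    rw [hγ2]; field_simp
  rw [e1]
  have h1 : h * θ ^ 2 / 2 ≤ θ ^ 2 / 2 := by
    have := mul_le_of_le_one_left (sq_nonneg θ) hh1; linarith
  have h2 := mul_le_mul_of_nonneg_left h1 (mul_nonneg hγ.le hκ)
  nlinarith

/-- The second moment of the increments of the density field, conditionally on the past. -/
theorem exists_setIntegral_field_sub_sq_le (lam : Environment d)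
    (hlam : ∀ t x y, Nbr x y → lam.rate t x y ≤ α) (G : 𝓢(Space d, ℝ)) :
    ∃ K : ℝ, 0 ≤ K ∧ ∀ (N : ℕ+) {Ω : Type*} [mΩ : MeasurableSpace Ω] (P : Measure Ω)
      [IsProbabilityMeasure P] (𝓕 : Filtration ℝ≥0 mΩ) (η : ℝ≥0 → Ω → Config d),
      IsSSEP lam P 𝓕 η → ∀ (t h : ℝ≥0), h ≤ 1 →
      ∀ A : Set Ω, MeasurableSet[𝓕 (t * (N : ℝ≥0) ^ 2)] A →
      ∫ ω in A, (densityField N η (t + h) ω G - densityField N η t ω G) ^ 2 ∂P ≤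
        K * √h * P.real A := by
  obtain ⟨C, hC0, hC⟩ := exists_tsum_weight_le d
  obtain ⟨C', hC'0, hC'⟩ := exists_abs_empiricalField_le d
  obtain ⟨M, hM0, hM⟩ := exists_lattice_bound G
  obtain ⟨M', hM'0, hM', -⟩ := exists_schwartz_bound G (d + 1)
  set κ₁ : ℝ := (2 * (1 * (originNbrs d).card) : ℕ) * |α| with hκ₁
  set κ₂ : ℝ := (2 * (2 * (originNbrs d).card) : ℕ) * |α| with hκ₂
  set Θ : ℝ := 3 ^ (d + 1) with hΘ
  set K₁ : ℝ := 1 + κ₁ * (M ^ 2 / 8 + Θ ^ 2 / 2) with hK₁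
  set K₂ : ℝ := 1 + κ₂ * ((M ^ 2 * (2 + Θ)) ^ 2 / 8 + (Θ * (2 + Θ)) ^ 2 / 2) with hK₂
  have hK₁0 : 0 ≤ K₁ := by positivity
  have hK₂0 : 0 ≤ K₂ := by positivity
  refine ⟨C ^ 2 * K₂ + 2 * (C' * M') * (C * K₁), by positivity, ?_⟩
  intro N Ω mΩ P _ 𝓕 η hη t h hh A hA
  -- The case `h = 0` is separate because the energy parameter `√h` must be positive.
  rcases eq_or_ne h 0 with rfl | hh0
  · simp
  have hhpos : (0 : ℝ) < h := by exact_mod_cast pos_iff_ne_zero.2 hh0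
  have hh1 : (h : ℝ) ≤ 1 := by exact_mod_cast hh
  have hγ : 0 < √(h : ℝ) := Real.sqrt_pos.2 hhpos
  have hN : (1 : ℝ) ≤ N := by exact_mod_cast N.pos
  have hN0 : (0 : ℝ) < N := by linarith
  have hNd : (0 : ℝ) < (N : ℝ) ^ d := by positivity
  obtain ⟨hw, hwC⟩ := hC N
  set t₀ : ℝ≥0 := t * (N : ℝ≥0) ^ 2 with ht₀
  set τ : ℝ≥0 := h * (N : ℝ≥0) ^ 2 with hτ
  have htτ : (t + h) * (N : ℝ≥0) ^ 2 = t₀ + τ := by rw [ht₀, hτ, add_mul]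
  have hτR : (τ : ℝ) = h * (N : ℝ) ^ 2 := by rw [hτ]; push_cast; rfl
  have hA0 : MeasurableSet A := 𝓕.le _ _ hA
  let S : ℝ≥0 → Ω → ℝ := fun s ω => ∑' x, G (rescale N x) * occ (η s ω) x
  have hX : ∀ s ω, densityField N η s ω G = ((N : ℝ) ^ d)⁻¹ * S (s * (N : ℝ≥0) ^ 2) ω :=
    fun s ω => rfl
  have hXb : ∀ s ω, |densityField N η s ω G| ≤ C' * M' := fun s ω => hC' N _ G M' hM'
  have hXm : ∀ s, Measurable fun ω => densityField N η s ω G :=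
    fun s => measurable_densityField N hη.measurable s G
  have hX0 : Measurable[𝓕 t₀] fun ω => densityField N η t ω G :=
    (measurable_empiricalField N G).comp (hη.adapted _)
  have hgen := fun κ ν θ (hκ : 0 ≤ κ) => parabolic_scaling_le ν θ hhpos hh1 hN0 hκ
  rw [← hτR] at hgen
  have hκ₁0 : 0 ≤ κ₁ := by positivity
  have hκ₂0 : 0 ≤ κ₂ := by positivity
  -- the two-point estimate
  let Z₂ : Ω → ℝ := A.indicator 1
  have hZ₂ : Measurable[𝓕 t₀] Z₂ :=
    Measurable.indicator (f := 1) (measurable_const (a := (1 : ℝ))) hA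
  have hZ₂b : ∀ ω, |Z₂ ω| ≤ 1 := fun ω => by
    simp only [Z₂, Set.indicator]; split_ifs <;> simp
  have hZ₂i : ∫ ω, |Z₂ ω| ∂P = P.real A := by
    have : (fun ω => |Z₂ ω|) = A.indicator 1 := by
      funext ω; simp only [Z₂, Set.indicator]; split_ifs <;> simp
    rw [this, integral_indicator_one hA0]
  have h2 := hη.abs_integral_field_sq_sub_le hlam N hw hM0 (hM N).1 (hM N).2 hγ hZ₂ hZ₂b τ
  rw [hZ₂i] at h2
  -- the one-point estimate
  let Z₁ : Ω → ℝ := A.indicator fun ω => densityField N η t ω G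
  have hZ₁ : Measurable[𝓕 t₀] Z₁ := hX0.indicator hA
  have hCM : 0 ≤ C' * M' := by positivity
  have hZ₁b' : ∀ ω, |Z₁ ω| ≤ C' * M' * Z₂ ω := fun ω => by
    simp only [Z₁, Z₂, Set.indicator]; split_ifs
    · simpa using hXb t ω
    · simp
  have hZ₁b : ∀ ω, |Z₁ ω| ≤ C' * M' := fun ω =>
    (hZ₁b' ω).trans (mul_le_of_le_one_right hCM ((le_abs_self _).trans (hZ₂b ω)))
  have hZ₂int : Integrable Z₂ P := (integrable_const 1).indicator hA0
  have hZ₁i : ∫ ω, |Z₁ ω| ∂P ≤ C' * M' * P.real A := by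
    have : ∫ ω, C' * M' * Z₂ ω ∂P = C' * M' * P.real A := by
      rw [integral_const_mul, integral_indicator_one hA0]
    rw [← this]
    exact integral_mono_of_nonneg (Eventually.of_forall fun ω => abs_nonneg _)
      (hZ₂int.const_mul _) (Eventually.of_forall hZ₁b')
  have h1 := hη.abs_integral_field_sub_le hlam N hw hM0 (hM N).1 (hM N).2 hγ hZ₁ hZ₁b τ
  have hW0 : 0 ≤ ∑' x : Site d, weight N x := tsum_nonneg fun x => (weight_pos N x).le
  have h1' := h1.trans (mul_le_mul hZ₁i (mul_le_mul hwC (hgen κ₁ M Θ hκ₁0)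
    (by positivity) (by positivity)) (by positivity) (by positivity))
  have h2' := h2.trans (mul_le_mul_of_nonneg_left (mul_le_mul (pow_le_pow_left₀ hW0 hwC 2)
    (hgen κ₂ (M ^ 2 * (2 + Θ)) (Θ * (2 + Θ)) hκ₂0) (by positivity) (by positivity))
      measureReal_nonneg)
  rw [← hK₁] at h1'
  rw [← hK₂] at h2'
  -- expansion of the square
  have hSX : ∀ s ω, S (s * (N : ℝ≥0) ^ 2) ω = (N : ℝ) ^ d * densityField N η s ω G := fun s ω => by
    rw [hX]; field_simp
  have hS0 : ∀ ω, ∑' x, G (rescale N x) * occ (η t₀ ω) x = (N : ℝ) ^ d * densityField N η t ω G :=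
    hSX t
  have hS1 : ∀ ω, ∑' x, G (rescale N x) * occ (η (t₀ + τ) ω) x =
      (N : ℝ) ^ d * densityField N η (t + h) ω G := fun ω => by
    rw [← htτ]; exact hSX (t + h) ω
  simp only [hS0, hS1] at h1' h2'
  have hbd : ∀ f : Ω → ℝ, Measurable f → ∀ c, (∀ ω, |f ω| ≤ c) → Integrable f P :=
    fun f hf c hc => Integrable.of_bound hf.aestronglyMeasurable c (Eventually.of_forall hc)
  have hZ₁m : Measurable Z₁ := hZ₁.mono (𝓕.le _) le_rfl
  have hZ₂m : Measurable Z₂ := hZ₂.mono (𝓕.le _) le_rfl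
  have i1 : ∀ s, Integrable (fun ω => Z₁ ω * densityField N η s ω G) P := fun s =>
    hbd _ (hZ₁m.mul (hXm s)) (C' * M' * (C' * M')) fun ω => by
      rw [abs_mul]; exact mul_le_mul (hZ₁b ω) (hXb s ω) (abs_nonneg _) hCM
  have i2 : ∀ s, Integrable (fun ω => Z₂ ω * densityField N η s ω G ^ 2) P := fun s =>
    hbd _ (hZ₂m.mul ((hXm s).pow_const 2)) (1 * (C' * M') ^ 2) fun ω => by
      rw [abs_mul, abs_pow]
      exact mul_le_mul (hZ₂b ω) (pow_le_pow_left₀ (abs_nonneg _) (hXb s ω) 2) (by positivity)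
        zero_le_one
  have e1 : ∀ s, ∫ ω, Z₁ ω * ((N : ℝ) ^ d * densityField N η s ω G) ∂P =
      (N : ℝ) ^ d * ∫ ω, Z₁ ω * densityField N η s ω G ∂P := fun s => by
    rw [← integral_const_mul]
    exact integral_congr_ae (Eventually.of_forall fun ω => by simp only; ring)
  have e2 : ∀ s, ∫ ω, Z₂ ω * ((N : ℝ) ^ d * densityField N η s ω G) ^ 2 ∂P =
      ((N : ℝ) ^ d) ^ 2 * ∫ ω, Z₂ ω * densityField N η s ω G ^ 2 ∂P := fun s => by
    rw [← integral_const_mul]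
    exact integral_congr_ae (Eventually.of_forall fun ω => by simp only; ring)
  rw [e1, e1, ← mul_sub, abs_mul, abs_of_pos hNd] at h1'
  rw [e2, e2, ← mul_sub, abs_mul, abs_of_pos (pow_pos hNd 2)] at h2'
  set D₁ := ∫ ω, Z₁ ω * densityField N η (t + h) ω G ∂P - ∫ ω, Z₁ ω * densityField N η t ω G ∂P
    with hD₁
  set D₂ := ∫ ω, Z₂ ω * densityField N η (t + h) ω G ^ 2 ∂P -
    ∫ ω, Z₂ ω * densityField N η t ω G ^ 2 ∂P with hD₂
  have f1 : |D₁| ≤ C' * M' * P.real A * (C * (√(h : ℝ) * K₁)) := by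
    refine le_of_mul_le_mul_left (h1'.trans_eq ?_) hNd
    ring
  have f2 : |D₂| ≤ P.real A * (C ^ 2 * (√(h : ℝ) * K₂)) := by
    refine le_of_mul_le_mul_left (h2'.trans_eq ?_) (pow_pos hNd 2)
    ring
  have hexp : ∫ ω in A, (densityField N η (t + h) ω G - densityField N η t ω G) ^ 2 ∂P =
      D₂ - 2 * D₁ := by
    rw [hD₂, hD₁, ← integral_sub (i2 _) (i2 _), ← integral_sub (i1 _) (i1 _),
      ← integral_const_mul, ← integral_indicator hA0]
    refine Eq.trans (integral_congr_ae (Eventually.of_forall fun ω => ?_))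
      (integral_sub ((i2 (t + h)).sub (i2 t)) (((i1 (t + h)).sub (i1 t)).const_mul 2))
    simp only [Z₁, Z₂, Set.indicator]
    split_ifs
    · simp only [Pi.one_apply]; ring
    · simp
  rw [hexp]
  have g1 := (abs_le.1 f1).1
  have g2 := (abs_le.1 f2).2
  calc D₂ - 2 * D₁ ≤ P.real A * (C ^ 2 * (√(h : ℝ) * K₂)) +
        2 * (C' * M' * P.real A * (C * (√(h : ℝ) * K₁))) := by linarith
    _ = _ := by ring

end SecondMoment

/-! ### Oscillations of processes with conditionally small increments -/

section Grid

variable {Ω S : Type*} [mΩ : MeasurableSpace Ω] {P : Measure Ω} [IsProbabilityMeasure P]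
  [PseudoMetricSpace S] [SecondCountableTopology S] [MeasurableSpace S] [OpensMeasurableSpace S]

/-- Over at most `m` steps, the increments exceed `ε` with conditional probability at most `ψ`. -/
def SmallIncrements (P : Measure Ω) (𝒢 : Filtration ℕ mΩ) (Y : ℕ → Ω → S) (ε : ℝ) (m : ℕ)
    (ψ : ℝ) : Prop :=
  ∀ j i, j ≤ i → i ≤ j + m → ∀ A, MeasurableSet[𝒢 j] A →
    P.real (A ∩ {ω | ε < dist (Y i ω) (Y j ω)}) ≤ ψ * P.real A

theorem measurableSet_lt_dist {𝒢 : Filtration ℕ mΩ} {Y : ℕ → Ω → S}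
    (hY : ∀ j, Measurable[𝒢 j] (Y j)) (c : ℝ) {i j k : ℕ} (hi : i ≤ k) (hj : j ≤ k) :
    MeasurableSet[𝒢 k] {ω | c < dist (Y i ω) (Y j ω)} := by
  have h1 : Measurable[𝒢 k] (Y i) := (hY i).mono (𝒢.mono hi) le_rfl
  have h2 : Measurable[𝒢 k] (Y j) := (hY j).mono (𝒢.mono hj) le_rfl
  have h3 : Measurable[𝒢 k] fun ω => dist (Y i ω) (Y j ω) :=
    measurable_dist.comp (h1.prodMk h2)
  exact h3 measurableSet_Ioi

/-- Ottaviani's argument: from the first exceedance of `2 * ε`, the path is unlikely to come back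
within `ε` of its start by the end of the window. -/
theorem measureReal_exists_lt_dist_le {𝒢 : Filtration ℕ mΩ} {Y : ℕ → Ω → S}
    (hY : ∀ j, Measurable[𝒢 j] (Y j)) {ε : ℝ} {m : ℕ} {ψ : ℝ}
    (h : SmallIncrements P 𝒢 Y ε m ψ) (hψ : ψ ≤ 1 / 2) (j : ℕ) {A : Set Ω}
    (hA : MeasurableSet[𝒢 j] A) :
    P.real (A ∩ {ω | ∃ i ∈ Finset.Ioc j (j + m), 2 * ε < dist (Y i ω) (Y j ω)}) ≤
      2 * ψ * P.real A := by
  let U := A ∩ {ω | ∃ i ∈ Finset.Ioc j (j + m), 2 * ε < dist (Y i ω) (Y j ω)}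
  -- The event that the first exceedance happens at step `i`; it is known at step `i`, so the
  -- increment bound can be conditioned on it.
  let D : ℕ → Set Ω := fun i => A ∩ ({ω | 2 * ε < dist (Y i ω) (Y j ω)} ∩
    ⋂ k ∈ Finset.Ioo j i, {ω | 2 * ε < dist (Y k ω) (Y j ω)}ᶜ)
  have hDm : ∀ i, j ≤ i → MeasurableSet[𝒢 i] (D i) := by
    intro i hi
    refine MeasurableSet.inter (𝒢.mono hi _ hA) (MeasurableSet.inter
      (measurableSet_lt_dist hY _ le_rfl hi) ?_)
    refine Finset.measurableSet_biInter _ fun k hk => ?_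
    exact (measurableSet_lt_dist hY _ (Finset.mem_Ioo.1 hk).2.le hi).compl
  have hDm' : ∀ i ∈ Finset.Ioc j (j + m), MeasurableSet (D i) := fun i hi =>
    𝒢.le i _ (hDm i (Finset.mem_Ioc.1 hi).1.le)
  have hdisj : Set.PairwiseDisjoint (↑(Finset.Ioc j (j + m))) D := by
    have key : ∀ a b, j < a → a < b → Disjoint (D a) (D b) := by
      intro a b hja hab
      refine Set.disjoint_left.2 fun ω h1 h2 => ?_
      have h3 := Set.mem_iInter₂.1 h2.2.2 a (Finset.mem_Ioo.2 ⟨hja, hab⟩)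
      exact h3 h1.2.1
    intro a ha b hb hab
    rcases lt_or_gt_of_ne hab with h | h
    · exact key a b (Finset.mem_Ioc.1 (Finset.mem_coe.1 ha)).1 h
    · exact (key b a (Finset.mem_Ioc.1 (Finset.mem_coe.1 hb)).1 h).symm
  have hU : U = ⋃ i ∈ Finset.Ioc j (j + m), D i := by
    ext ω
    simp only [Set.mem_iUnion]
    constructor
    · rintro ⟨hωA, hω⟩
      classical
      have hex : ∃ i, i ∈ Finset.Ioc j (j + m) ∧ 2 * ε < dist (Y i ω) (Y j ω) := hω
      obtain ⟨h1, h2⟩ := Nat.find_spec hex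
      refine ⟨Nat.find hex, h1, hωA, h2, Set.mem_iInter₂.2 fun k hk hk' => ?_⟩
      rw [Finset.mem_Ioo] at hk
      rw [Finset.mem_Ioc] at h1
      exact Nat.find_min hex hk.2 ⟨Finset.mem_Ioc.2 ⟨hk.1, hk.2.le.trans h1.2⟩, hk'⟩
    · rintro ⟨i, hi, hω⟩
      exact ⟨hω.1, i, hi, hω.2.1⟩
  let E := {ω | ε < dist (Y (j + m) ω) (Y j ω)}
  have hEm : MeasurableSet E := 𝒢.le _ _ (measurableSet_lt_dist hY ε le_rfl (Nat.le_add_right j m))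
  have hstep : ∀ i ∈ Finset.Ioc j (j + m), P.real (D i) ≤ P.real (D i ∩ E) + ψ * P.real (D i) := by
    intro i hi
    have hi' := Finset.mem_Ioc.1 hi
    have h1 := h i (j + m) hi'.2 (by omega) (D i) (hDm i hi'.1.le)
    have h2 : D i ⊆ (D i ∩ E) ∪ (D i ∩ {ω | ε < dist (Y (j + m) ω) (Y i ω)}) := by
      intro ω hω
      by_contra hcon
      simp only [E, Set.mem_union, Set.mem_inter_iff, Set.mem_ofPred_eq, hω, true_and, not_or,
        not_lt] at hcon
      have h3 : 2 * ε < dist (Y i ω) (Y j ω) := hω.2.1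
      have h4 := dist_triangle_left (Y i ω) (Y j ω) (Y (j + m) ω)
      linarith [hcon.1, hcon.2]
    calc _ ≤ _ := measureReal_mono h2
      _ ≤ _ := measureReal_union_le _ _
      _ ≤ _ := by linarith
  have hsum : ∑ i ∈ Finset.Ioc j (j + m), P.real (D i) = P.real U := by
    rw [hU, measureReal_biUnion_finset hdisj hDm']
  have hsumE : ∑ i ∈ Finset.Ioc j (j + m), P.real (D i ∩ E) ≤ P.real (A ∩ E) := by
    rw [← measureReal_biUnion_finset (fun a ha b hb hab =>
      (hdisj ha hb hab).mono Set.inter_subset_left Set.inter_subset_left)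
      fun i hi => (hDm' i hi).inter hEm]
    refine measureReal_mono ?_
    intro ω hω
    obtain ⟨i, hi, hω⟩ := Set.mem_iUnion₂.1 hω
    exact ⟨hω.1.1, hω.2⟩
  have h1 := Finset.sum_le_sum hstep
  rw [Finset.sum_add_distrib, ← Finset.mul_sum, hsum] at h1
  have h2 := h j (j + m) (Nat.le_add_right j m) le_rfl A hA
  have h3 : ψ * P.real U ≤ 1 / 2 * P.real U := mul_le_mul_of_nonneg_right hψ measureReal_nonneg
  change P.real U ≤ _
  linarith

/-- The last time, up to the current one, at which a sequence has moved by more than `c` since the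
previous such time. -/
noncomputable def lastCrossing (c : ℝ) (y : ℕ → S) : ℕ → ℕ
  | 0 => 0
  | j + 1 => open Classical in
    if c < dist (y (j + 1)) (y (lastCrossing c y j)) then j + 1 else lastCrossing c y j

/-- `j` is a crossing time of the sequence. -/
def IsCrossing (c : ℝ) (y : ℕ → S) (j : ℕ) : Prop := lastCrossing c y j = j

omit [SecondCountableTopology S] [MeasurableSpace S] [OpensMeasurableSpace S] in
theorem lastCrossing_le (c : ℝ) (y : ℕ → S) (j : ℕ) : lastCrossing c y j ≤ j := by
  induction j with
  | zero => simp [lastCrossing]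
  | succ j ih => rw [lastCrossing]; split_ifs <;> omega

omit [SecondCountableTopology S] [MeasurableSpace S] [OpensMeasurableSpace S] in
theorem lastCrossing_eq_of_forall_not {c : ℝ} {y : ℕ → S} {j : ℕ}
    (hj : IsCrossing c y j) {i : ℕ} (hji : j ≤ i)
    (h : ∀ k, j < k → k ≤ i → ¬ IsCrossing c y k) : lastCrossing c y i = j := by
  induction i, hji using Nat.le_induction with
  | base => exact hj
  | succ i hi ih =>
    have h1 := ih fun k hk hki => h k hk (hki.trans (Nat.le_succ i))
    have h2 := h (i + 1) (Nat.lt_succ_of_le hi) le_rfl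
    rw [IsCrossing, lastCrossing] at h2
    rw [lastCrossing]
    split_ifs at h2 ⊢ with h3
    · exact absurd rfl h2
    · exact h1

omit [SecondCountableTopology S] [MeasurableSpace S] [OpensMeasurableSpace S] in
theorem dist_le_of_forall_not_isCrossing {c : ℝ} (hc : 0 ≤ c) {y : ℕ → S} {j : ℕ}
    (hj : IsCrossing c y j) {i : ℕ} (hji : j ≤ i)
    (h : ∀ k, j < k → k ≤ i → ¬ IsCrossing c y k) : dist (y i) (y j) ≤ c := by
  rcases hji.eq_or_lt with rfl | hlt
  · simpa using hc
  obtain ⟨i, rfl⟩ : ∃ k, i = k + 1 := ⟨i - 1, by omega⟩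
  have h1 := lastCrossing_eq_of_forall_not hj (Nat.lt_succ_iff.1 hlt)
    fun k hk hki => h k hk (hki.trans (Nat.le_succ i))
  have h2 := h (i + 1) hlt le_rfl
  rw [IsCrossing, lastCrossing, h1] at h2
  split_ifs at h2 with h3
  · exact absurd rfl h2
  · exact not_lt.1 h3

omit [SecondCountableTopology S] [MeasurableSpace S] [OpensMeasurableSpace S] in
-- The first crossing after `j` is measured against `y j`, so it is itself the required point. Close
-- crossings thus force a large displacement, to which the maximal inequality applies.
theorem exists_lt_dist_of_isCrossing {c : ℝ} {y : ℕ → S} {j i : ℕ} (hj : IsCrossing c y j)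
    (hji : j < i) (hi : IsCrossing c y i) : ∃ k, j < k ∧ k ≤ i ∧ c < dist (y k) (y j) := by
  classical
  have hex : ∃ k, j < k ∧ IsCrossing c y k := ⟨i, hji, hi⟩
  obtain ⟨h1, h2⟩ := Nat.find_spec hex
  have h3 : Nat.find hex ≤ i := Nat.find_min' hex ⟨hji, hi⟩
  obtain ⟨k, hk⟩ : ∃ k, Nat.find hex = k + 1 := ⟨Nat.find hex - 1, by omega⟩
  refine ⟨Nat.find hex, h1, h3, ?_⟩
  have h4 : lastCrossing c y k = j := lastCrossing_eq_of_forall_not hj (by omega)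
    fun l hl hlk hcr => Nat.find_min hex (m := l) (by omega) ⟨hl, hcr⟩
  rw [hk] at h2 ⊢
  rw [IsCrossing, lastCrossing, h4] at h2
  split_ifs at h2 with h5
  · exact h5
  · omega

theorem measurableSet_lastCrossing_eq {𝒢 : Filtration ℕ mΩ} {Y : ℕ → Ω → S}
    (hY : ∀ j, Measurable[𝒢 j] (Y j)) (c : ℝ) (j k : ℕ) :
    MeasurableSet[𝒢 j] {ω | lastCrossing c (fun i => Y i ω) j = k} := by
  induction j generalizing k with
  | zero => simp [lastCrossing]
  | succ j ih =>
    have ih' : ∀ l, MeasurableSet[𝒢 (j + 1)] {ω | lastCrossing c (fun i => Y i ω) j = l} :=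
      fun l => 𝒢.mono (Nat.le_succ j) _ (ih l)
    have hm : MeasurableSet[𝒢 (j + 1)] {ω | c < dist (Y (j + 1) ω)
        (Y (lastCrossing c (fun i => Y i ω) j) ω)} := by
      have : {ω | c < dist (Y (j + 1) ω) (Y (lastCrossing c (fun i => Y i ω) j) ω)} =
          ⋃ l ∈ Finset.range (j + 1), ({ω | lastCrossing c (fun i => Y i ω) j = l} ∩
            {ω | c < dist (Y (j + 1) ω) (Y l ω)}) := by
        ext ω
        simp only [Set.mem_ofPred_eq, Set.mem_iUnion, Set.mem_inter_iff, Finset.mem_range]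
        constructor
        · exact fun h => ⟨_, Nat.lt_succ_of_le (lastCrossing_le _ _ _), rfl, h⟩
        · rintro ⟨l, _, rfl, h⟩; exact h
      rw [this]
      refine Finset.measurableSet_biUnion _ fun l hl => (ih' l).inter ?_
      exact measurableSet_lt_dist hY c le_rfl (Finset.mem_range.1 hl).le
    by_cases hk : k = j + 1
    · have : {ω | lastCrossing c (fun i => Y i ω) (j + 1) = k} = {ω | c < dist (Y (j + 1) ω)
        (Y (lastCrossing c (fun i => Y i ω) j) ω)} := by
        ext ω
        simp only [Set.mem_ofPred_eq, lastCrossing, hk]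
        have := lastCrossing_le c (fun i => Y i ω) j
        split_ifs with h
        · simp [h]
        · simp only [h, iff_false]; omega
      rw [this]; exact hm
    · have : {ω | lastCrossing c (fun i => Y i ω) (j + 1) = k} = {ω | c < dist (Y (j + 1) ω)
        (Y (lastCrossing c (fun i => Y i ω) j) ω)}ᶜ ∩
          {ω | lastCrossing c (fun i => Y i ω) j = k} := by
        ext ω
        simp only [Set.mem_ofPred_eq, lastCrossing, Set.mem_inter_iff, Set.mem_compl_iff]
        split_ifs with h
        · simp only [h, not_true_eq_false, false_and, iff_false]; omega
        · simp [h]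
      rw [this]; exact hm.compl.inter (ih' k)

theorem card_separated_mul_le {s : Finset ℕ} {n m : ℕ} (hs : ∀ j ∈ s, j < n)
    (hsep : ∀ i ∈ s, ∀ j ∈ s, i < j → i + m < j) : s.card * m ≤ n + m := by
  have hd : Set.PairwiseDisjoint (↑s) fun j => Finset.Ioc j (j + m) := by
    intro a ha b hb hab
    refine Finset.disjoint_left.2 fun x hx hx' => ?_
    rw [Finset.mem_Ioc] at hx hx'
    rcases lt_or_gt_of_ne hab with h | h
    · have := hsep a ha b hb h; omega
    · have := hsep b hb a ha h; omega
  have h1 : (s.biUnion fun j => Finset.Ioc j (j + m)).card = s.card * m := by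
    rw [Finset.card_biUnion hd]; simp
  rw [← h1]
  calc _ ≤ (Finset.Ioc 0 (n + m)).card := Finset.card_le_card fun x hx => by
        obtain ⟨j, hj, hx⟩ := Finset.mem_biUnion.1 hx
        have := hs j hj
        rw [Finset.mem_Ioc] at hx ⊢
        omega
    _ = n + m := by simp

/-- After a crossing, another one within `m₀` steps has conditional probability at most `1 / 2`. So
the expected number of crossings is at most twice that of isolated ones, and these are more than
`m₀` apart. -/
theorem sum_measureReal_isCrossing_le {𝒢 : Filtration ℕ mΩ} {Y : ℕ → Ω → S}
    (hY : ∀ j, Measurable[𝒢 j] (Y j)) {ε : ℝ} {m₀ q₀ : ℕ} (hm₀ : 0 < m₀)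
    (h : SmallIncrements P 𝒢 Y ε m₀ (1 / 4)) :
    ∑ j ∈ Finset.range (q₀ * m₀), P.real {ω | IsCrossing (2 * ε) (fun i => Y i ω) j} ≤
      2 * (q₀ + 1) := by
  classical
  let Cr : ℕ → Set Ω := fun j => {ω | IsCrossing (2 * ε) (fun i => Y i ω) j}
  have hCr : ∀ j, MeasurableSet[𝒢 j] (Cr j) := fun j => measurableSet_lastCrossing_eq hY _ j j
  have hCr' : ∀ j, MeasurableSet (Cr j) := fun j => 𝒢.le j _ (hCr j)
  let Sh : ℕ → Set Ω := fun j => ⋃ i ∈ Finset.Ioc j (j + m₀), Cr i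
  have hSh : ∀ j, MeasurableSet (Sh j) := fun j => Finset.measurableSet_biUnion _ fun i _ => hCr' i
  have h1 : ∀ j, P.real (Cr j ∩ Sh j) ≤ 1 / 2 * P.real (Cr j) := by
    intro j
    have h2 := measureReal_exists_lt_dist_le hY h (by norm_num) j (hCr j)
    refine (measureReal_mono ?_).trans (h2.trans_eq (by ring))
    rintro ω ⟨hω1, hω2⟩
    refine ⟨hω1, ?_⟩
    obtain ⟨i, hi, hω2⟩ := Set.mem_iUnion₂.1 hω2
    rw [Finset.mem_Ioc] at hi
    obtain ⟨k, hk1, hk2, hk3⟩ := exists_lt_dist_of_isCrossing hω1 hi.1 hω2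
    exact ⟨k, Finset.mem_Ioc.2 ⟨hk1, hk2.trans hi.2⟩, hk3⟩
  have h2 : ∀ j, P.real (Cr j) ≤ 2 * P.real (Cr j \ Sh j) := by
    intro j
    have := measureReal_inter_add_sdiff (μ := P) (s := Cr j) (hSh j)
    linarith [h1 j]
  have h3 : ∑ j ∈ Finset.range (q₀ * m₀), P.real (Cr j \ Sh j) ≤ q₀ + 1 := by
    have e : ∀ j, P.real (Cr j \ Sh j) = ∫ ω, (Cr j \ Sh j).indicator (1 : Ω → ℝ) ω ∂P := fun j =>
      (integral_indicator_one ((hCr' j).diff (hSh j))).symm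
    simp only [e]
    have hint : ∀ j, Integrable ((Cr j \ Sh j).indicator (1 : Ω → ℝ)) P := fun j =>
      (integrable_const (1 : ℝ)).indicator ((hCr' j).diff (hSh j))
    rw [← integral_finsetSum _ fun j _ => hint j]
    have hle : ∀ ω, ∑ j ∈ Finset.range (q₀ * m₀), (Cr j \ Sh j).indicator (1 : Ω → ℝ) ω ≤
        (q₀ + 1 : ℝ) := by
      intro ω
      have e2 : ∑ j ∈ Finset.range (q₀ * m₀), (Cr j \ Sh j).indicator (1 : Ω → ℝ) ω =
          (((Finset.range (q₀ * m₀)).filter fun j => ω ∈ Cr j \ Sh j).card : ℝ) := by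
        rw [Finset.card_filter]; push_cast
        exact Finset.sum_congr rfl fun j _ => by simp [Set.indicator_apply]
      rw [e2]
      have h4 := card_separated_mul_le (s := (Finset.range (q₀ * m₀)).filter
        fun j => ω ∈ Cr j \ Sh j) (n := q₀ * m₀) (m := m₀)
        (fun j hj => Finset.mem_range.1 (Finset.mem_filter.1 hj).1) (by
          intro i hi j hj hij
          by_contra hcon
          refine (Finset.mem_filter.1 hi).2.2 (Set.mem_iUnion₂.2 ⟨j, ?_,
            (Finset.mem_filter.1 hj).2.1⟩)
          exact Finset.mem_Ioc.2 ⟨hij, not_lt.1 hcon⟩)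
      have h5 : ((Finset.range (q₀ * m₀)).filter fun j => ω ∈ Cr j \ Sh j).card ≤ q₀ + 1 := by
        refine Nat.le_of_mul_le_mul_right (c := m₀) ?_ hm₀
        rw [add_mul, one_mul]; exact h4
      exact_mod_cast h5
    calc _ ≤ ∫ _, (q₀ + 1 : ℝ) ∂P := integral_mono_of_nonneg
          (Eventually.of_forall fun ω => Finset.sum_nonneg fun j _ =>
            Set.indicator_nonneg (fun _ _ => zero_le_one) _)
          (integrable_const _) (Eventually.of_forall hle)
      _ = _ := by simp
  calc _ ≤ ∑ j ∈ Finset.range (q₀ * m₀), 2 * P.real (Cr j \ Sh j) :=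
        Finset.sum_le_sum fun j _ => h2 j
    _ ≤ _ := by rw [← Finset.mul_sum]; linarith

/-- A partition of `{0, …, n}` with steps at least `m` on the parts of which `y` oscillates by at
most `c` from the left end. -/
def HasGridPartition (n m : ℕ) (c : ℝ) (y : ℕ → S) : Prop :=
  ∃ g : ℕ → ℕ, g 0 = 0 ∧ Monotone g ∧ (∀ i, g i ≤ n) ∧ (∀ i, g i = n ∨ g i + m ≤ g (i + 1)) ∧
    ∀ i j, g i ≤ j → j < g (i + 1) → dist (y j) (y (g i)) ≤ c

omit [SecondCountableTopology S] [MeasurableSpace S] [OpensMeasurableSpace S] in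
theorem hasGridPartition_of_isCrossing {n m : ℕ} (hm : 0 < m) (hmn : m ≤ n) {ε : ℝ} (hε : 0 ≤ ε)
    {y : ℕ → S}
    (h1 : ∀ j < n, IsCrossing (2 * ε) y j → ∀ i, j < i → i ≤ j + m → ¬ IsCrossing (2 * ε) y i)
    (h2 : ∀ i, n - m < i → i ≤ n → dist (y i) (y (n - m)) ≤ 2 * ε) :
    HasGridPartition n m (4 * ε) y := by
  classical
  -- The partition points are the crossings up to `n - m`, followed by `n`. Discarding later
  -- crossings keeps the last part at least `m` long.
  let next : ℕ → ℕ := fun j =>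
    if h : ∃ i, j < i ∧ i ≤ n - m ∧ IsCrossing (2 * ε) y i then Nat.find h else n
  let g : ℕ → ℕ := fun i => next^[i] 0
  have hg : ∀ i, g (i + 1) = next (g i) := fun i => Function.iterate_succ_apply' next i 0
  have hnext : ∀ j, (next j = n ∧ ∀ i, j < i → i ≤ n - m → ¬ IsCrossing (2 * ε) y i) ∨
      (j < next j ∧ next j ≤ n - m ∧ IsCrossing (2 * ε) y (next j) ∧
        ∀ i, j < i → i < next j → ¬ IsCrossing (2 * ε) y i) := by
    intro j
    by_cases h : ∃ i, j < i ∧ i ≤ n - m ∧ IsCrossing (2 * ε) y i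
    · right
      obtain ⟨a, b, c⟩ := Nat.find_spec h
      simp only [next, h, dif_pos]
      refine ⟨a, b, c, fun i hi hi' hcr => ?_⟩
      exact Nat.find_min h hi' ⟨hi, hi'.le.trans b, hcr⟩
    · left
      simp only [next, h]
      push Not at h
      exact ⟨by simp, h⟩
  have hinv : ∀ i, g i = n ∨ (g i ≤ n - m ∧ IsCrossing (2 * ε) y (g i)) := by
    intro i
    induction i with
    | zero => exact Or.inr ⟨Nat.zero_le _, rfl⟩
    | succ i _ =>
      rw [hg]
      rcases hnext (g i) with h | h
      · exact Or.inl h.1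
      · exact Or.inr ⟨h.2.1, h.2.2.1⟩
  have hle : ∀ i, g i ≤ n := fun i => by rcases hinv i with h | h <;> omega
  refine ⟨g, rfl, monotone_nat_of_le_succ fun i => ?_, hle, fun i => ?_, fun i j hj hj' => ?_⟩
  · rw [hg]
    rcases hnext (g i) with h | h
    · rw [h.1]; exact hle i
    · exact h.1.le
  · rcases hinv i with h | ⟨h, hcr⟩
    · exact Or.inl h
    · right
      rw [hg]
      rcases hnext (g i) with h' | h'
      · rw [h'.1]; omega
      · by_contra hcon
        exact h1 (g i) (by omega) hcr _ h'.1 (by omega) h'.2.2.1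
  · rw [hg] at hj'
    rcases hinv i with h | ⟨h, hcr⟩
    · rcases hnext (g i) with h' | h' <;> omega
    · have h2ε : 0 ≤ 2 * ε := by positivity
      rcases hnext (g i) with h' | h'
      · rw [h'.1] at hj'
        by_cases hjm : j ≤ n - m
        · have := dist_le_of_forall_not_isCrossing h2ε hcr hj fun k hk hk' =>
            h'.2 k hk (hk'.trans hjm)
          linarith
        · have a1 := dist_le_of_forall_not_isCrossing h2ε hcr h h'.2
          have a2 := h2 j (by omega) (by omega)
          have a3 := dist_triangle (y j) (y (n - m)) (y (g i))
          linarith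
      · have := dist_le_of_forall_not_isCrossing h2ε hcr hj fun k hk hk' =>
          h'.2.2.2 k hk (by omega)
        linarith

/-- Two scales are used: the long one, `m₀`, bounds the expected number of crossings; the short one,
`m`, makes a displacement shortly after any given crossing unlikely. A union bound over crossings
and the final window gives the estimate, in which `q₀` is fixed before `ψ` is made small. -/
theorem measureReal_not_hasGridPartition_le {𝒢 : Filtration ℕ mΩ} {Y : ℕ → Ω → S}
    (hY : ∀ j, Measurable[𝒢 j] (Y j)) {ε : ℝ} (hε : 0 ≤ ε) {m₀ q₀ m : ℕ} (hm₀ : 0 < m₀)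
    (hm : 0 < m) (hmn : m ≤ q₀ * m₀) (h₀ : SmallIncrements P 𝒢 Y ε m₀ (1 / 4)) {ψ : ℝ}
    (hψ0 : 0 ≤ ψ) (hψ : ψ ≤ 1 / 2) (h : SmallIncrements P 𝒢 Y ε m ψ) :
    P.real {ω | ¬ HasGridPartition (q₀ * m₀) m (4 * ε) fun j => Y j ω} ≤ 4 * ψ * (q₀ + 2) := by
  set n := q₀ * m₀ with hn
  let Cr : ℕ → Set Ω := fun j => {ω | IsCrossing (2 * ε) (fun i => Y i ω) j}
  let Ev : ℕ → Set Ω := fun j => {ω | ∃ i ∈ Finset.Ioc j (j + m), 2 * ε < dist (Y i ω) (Y j ω)}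
  have hsub : {ω | ¬ HasGridPartition n m (4 * ε) fun j => Y j ω} ⊆
      (⋃ j ∈ Finset.range n, (Cr j ∩ Ev j)) ∪ (Set.univ ∩ Ev (n - m)) := by
    intro ω hω
    by_contra hcon
    rw [Set.mem_union, not_or] at hcon
    refine hω (hasGridPartition_of_isCrossing hm hmn hε ?_ ?_)
    · intro j hj hcr i hji hij hcr'
      obtain ⟨k, hk1, hk2, hk3⟩ := exists_lt_dist_of_isCrossing hcr hji hcr'
      exact hcon.1 (Set.mem_iUnion₂.2 ⟨j, Finset.mem_range.2 hj, hcr, k,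
        Finset.mem_Ioc.2 ⟨hk1, hk2.trans hij⟩, hk3⟩)
    · intro i hi hin
      by_contra hlt
      exact hcon.2 ⟨trivial, i, Finset.mem_Ioc.2 ⟨hi, by omega⟩, not_le.1 hlt⟩
  have h1 : P.real (⋃ j ∈ Finset.range n, (Cr j ∩ Ev j)) ≤ 2 * ψ * (2 * (q₀ + 1)) := by
    calc _ ≤ ∑ j ∈ Finset.range n, P.real (Cr j ∩ Ev j) := measureReal_biUnion_finset_le _ _
      _ ≤ ∑ j ∈ Finset.range n, 2 * ψ * P.real (Cr j) := Finset.sum_le_sum fun j _ =>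
          measureReal_exists_lt_dist_le hY h hψ j (measurableSet_lastCrossing_eq hY _ j j)
      _ ≤ _ := by
          rw [← Finset.mul_sum]
          exact mul_le_mul_of_nonneg_left (sum_measureReal_isCrossing_le hY hm₀ h₀) (by positivity)
  have h2 : P.real (Set.univ ∩ Ev (n - m)) ≤ 2 * ψ := by
    have := measureReal_exists_lt_dist_le hY h hψ (n - m) (A := Set.univ) MeasurableSet.univ
    rwa [probReal_univ, mul_one] at this
  calc _ ≤ _ := measureReal_mono hsub
    _ ≤ _ := measureReal_union_le _ _
    _ ≤ 4 * ψ * (q₀ + 2) := by nlinarith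

end Grid

/-! ### Partitions of the time interval with small oscillation -/

section Partition

/-- `0 = t 0 ≤ t 1 ≤ …` is a partition of `[0,T]` with steps at least `δ` until `T` is reached. -/
structure IsTimePartition (T δ : ℝ≥0) (t : ℕ → Set.Icc (0 : ℝ≥0) T) : Prop where
  zero : (t 0 : ℝ≥0) = 0
  mono : Monotone t
  gap : ∀ i, (t i : ℝ≥0) = T ∨ (t i : ℝ≥0) + δ ≤ t (i + 1)

/-- The path `x` on `[0,T]` satisfies `V` on each part `[t i, t (i + 1))` of a partition of `[0,T)`
with steps at least `δ`. -/
def HasPartition (T δ : ℝ≥0) {E : Type*} (V : E → E → Prop) (x : Set.Icc (0 : ℝ≥0) T → E) : Prop :=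
  ∃ t : ℕ → Set.Icc (0 : ℝ≥0) T, IsTimePartition T δ t ∧
    ∀ i s s', t i ≤ s → s < t (i + 1) → t i ≤ s' → s' < t (i + 1) → V (x s) (x s')

theorem IsTimePartition.of_tendsto {T δ : ℝ≥0} {ι : Type*} {𝒰 : Ultrafilter ι}
    {tl : ι → ℕ → Set.Icc (0 : ℝ≥0) T} {t : ℕ → Set.Icc (0 : ℝ≥0) T}
    (h : ∀ᶠ l in (𝒰 : Filter ι), IsTimePartition T δ (tl l))
    (ht : ∀ i, Tendsto (fun l => tl l i) 𝒰 (𝓝 (t i))) : IsTimePartition T δ t := by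
  have ht' : ∀ i, Tendsto (fun l => (tl l i : ℝ≥0)) 𝒰 (𝓝 (t i : ℝ≥0)) := fun i =>
    (continuous_subtype_val.tendsto _).comp (ht i)
  refine ⟨?_, monotone_nat_of_le_succ fun i => ?_, fun i => ?_⟩
  · refine tendsto_nhds_unique (ht' 0) (tendsto_const_nhds.congr' ?_)
    filter_upwards [h] with l hl using hl.zero.symm
  · refine le_of_tendsto_of_tendsto (ht i) (ht (i + 1)) ?_
    filter_upwards [h] with l hl using hl.mono (Nat.le_succ i)
  · have h1 : ∀ᶠ l in (𝒰 : Filter ι), (tl l i : ℝ≥0) = T ∨ (tl l i : ℝ≥0) + δ ≤ tl l (i + 1) := by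
      filter_upwards [h] with l hl using hl.gap i
    rcases Ultrafilter.eventually_or.1 h1 with h1 | h1
    · left
      refine tendsto_nhds_unique (ht' i) (tendsto_const_nhds.congr' ?_)
      filter_upwards [h1] with l hl using hl.symm
    · right
      exact le_of_tendsto_of_tendsto ((ht' i).add tendsto_const_nhds) (ht' (i + 1)) h1

variable {S : Type*} [PseudoMetricSpace S]

theorem tendsto_floor_grid (u : ℝ≥0) {ι : Type*} {f : Filter ι} {step : ι → ℝ≥0}
    (hpos : ∀ l, 0 < step l) (hstep : Tendsto step f (𝓝 0)) :
    Tendsto (fun l => ((⌊u / step l⌋₊ + 1 : ℕ) : ℝ≥0) * step l) f (𝓝[≥] u) ∧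
    ∀ l, u < ((⌊u / step l⌋₊ + 1 : ℕ) : ℝ≥0) * step l ∧
      ((⌊u / step l⌋₊ + 1 : ℕ) : ℝ≥0) * step l ≤ u + step l := by
  have h1 : ∀ l, u < ((⌊u / step l⌋₊ + 1 : ℕ) : ℝ≥0) * step l := fun l => by
    rw [← div_lt_iff₀ (hpos l)]; push_cast; exact Nat.lt_floor_add_one _
  have h2 : ∀ l, ((⌊u / step l⌋₊ + 1 : ℕ) : ℝ≥0) * step l ≤ u + step l := fun l => by
    push_cast
    rw [add_mul, one_mul]
    gcongr
    rw [← le_div_iff₀ (hpos l)]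
    exact Nat.floor_le (zero_le)
  refine ⟨tendsto_nhdsWithin_iff.2 ⟨?_, Eventually.of_forall fun l => (h1 l).le⟩,
    fun l => ⟨h1 l, h2 l⟩⟩
  refine tendsto_of_tendsto_of_tendsto_of_le_of_le tendsto_const_nhds ?_ (fun l => (h1 l).le) h2
  simpa using (tendsto_const_nhds (x := u)).add hstep

/-- Limits of the grid partitions along an ultrafilter give partition points in `[0,T]` with the
same minimal step; right continuity transfers the oscillation bound from the grids to the path. -/
theorem hasPartition_of_frequently {T : ℝ≥0} (hT : 0 < T) {q₀ q : ℕ} (hq₀ : 0 < q₀) (hq : 0 < q)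
    {y : ℝ≥0 → S} (hy : ∀ t, ContinuousWithinAt y (Set.Ici t) t) {c : ℝ}
    (h : ∃ᶠ l : ℕ in atTop, HasGridPartition (q₀ * (q * (l + 1))) (q₀ * (l + 1)) c
      fun j => y (j * (T / (q₀ * q * (l + 1) : ℕ)))) :
    HasPartition T (T / q) (fun a b => dist a b ≤ 2 * c) fun s => y s := by
  -- The number of steps is divisible by `q₀` and by `q`, so `T / q₀` and `T / q` are whole numbers
  -- of steps for every `l`.
  let step : ℕ → ℝ≥0 := fun l => T / (q₀ * q * (l + 1) : ℕ)
  let good : ℕ → Prop := fun l => HasGridPartition (q₀ * (q * (l + 1))) (q₀ * (l + 1)) c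
    fun j => y (j * step l)
  have hstep0 : ∀ l, 0 < step l := fun l => by
    have : (0 : ℝ≥0) < (q₀ * q * (l + 1) : ℕ) := by positivity
    exact div_pos hT this
  have hn : ∀ l, ((q₀ * (q * (l + 1)) : ℕ) : ℝ≥0) * step l = T := fun l => by
    have : ((q₀ * q * (l + 1) : ℕ) : ℝ≥0) ≠ 0 := by positivity
    rw [← mul_assoc q₀]
    exact mul_div_cancel₀ T this
  have hm : ∀ l, ((q₀ * (l + 1) : ℕ) : ℝ≥0) * step l = T / q := fun l => by
    have h1 : (q₀ : ℝ≥0) ≠ 0 := by positivity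
    have h2 : (q : ℝ≥0) ≠ 0 := by positivity
    have h3 : ((l : ℝ≥0) + 1) ≠ 0 := by positivity
    simp only [step]; push_cast; field_simp
  obtain ⟨𝒰, h𝒰, hgood⟩ : ∃ 𝒰 : Ultrafilter ℕ, (𝒰 : Filter ℕ) ≤ atTop ∧
      ∀ᶠ l in (𝒰 : Filter ℕ), good l := by
    have hne : (atTop ⊓ 𝓟 {l | good l}).NeBot := frequently_mem_iff_neBot.1 h
    refine ⟨Ultrafilter.of (atTop ⊓ 𝓟 {l | good l}),
      (Ultrafilter.of_le _).trans inf_le_left, ?_⟩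
    exact (Ultrafilter.of_le _).trans inf_le_right (mem_principal_self _)
  have hstep : Tendsto step 𝒰 (𝓝 0) := by
    refine Tendsto.mono_left ?_ h𝒰
    have h1 : Tendsto (fun l : ℕ => T * ((q₀ * q * (l + 1) : ℕ) : ℝ≥0)⁻¹) atTop (𝓝 (T * 0)) := by
      refine tendsto_const_nhds.mul (tendsto_inv_atTop_zero.comp
        (tendsto_natCast_atTop_atTop.comp ?_))
      refine tendsto_atTop_mono (fun l => ?_) tendsto_id
      have : 1 ≤ q₀ * q := Nat.mul_pos hq₀ hq
      simp only [id]; nlinarith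
    rw [mul_zero] at h1
    simpa only [step, div_eq_mul_inv] using h1
  have hex : ∀ l, ∃ g : ℕ → ℕ, good l → (g 0 = 0 ∧ Monotone g ∧ (∀ i, g i ≤ q₀ * (q * (l + 1))) ∧
      (∀ i, g i = q₀ * (q * (l + 1)) ∨ g i + q₀ * (l + 1) ≤ g (i + 1)) ∧
      ∀ i j, g i ≤ j → j < g (i + 1) → dist (y (j * step l)) (y (g i * step l)) ≤ c) := fun l => by
    by_cases hl : good l
    · obtain ⟨g, hg⟩ := hl
      exact ⟨g, fun _ => hg⟩
    · exact ⟨fun _ => 0, fun h => absurd h hl⟩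
  choose g hg using hex
  let tl : ℕ → ℕ → Set.Icc (0 : ℝ≥0) T := fun l i => ⟨min (g l i * step l) T, zero_le, min_le_right _ _⟩
  choose t ht using fun i => ((𝒰.map fun l => tl l i).le_nhds_lim :
    Tendsto (fun l => tl l i) 𝒰 (𝓝 _)) |> fun h => (⟨_, h⟩ : ∃ t, Tendsto (fun l => tl l i) 𝒰 (𝓝 t))
  have htl : ∀ l, good l → ∀ i, (tl l i : ℝ≥0) = g l i * step l := fun l hl i => by
    refine min_eq_left ?_
    rw [← hn l]
    exact mul_le_mul_left (Nat.cast_le.2 ((hg l hl).2.2.1 i)) _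
  have ht' : ∀ i, Tendsto (fun l => (g l i : ℝ≥0) * step l) 𝒰 (𝓝 (t i : ℝ≥0)) := fun i => by
    have h1 : Tendsto (fun l => (tl l i : ℝ≥0)) 𝒰 (𝓝 (t i : ℝ≥0)) :=
      (continuous_subtype_val.tendsto _).comp (ht i)
    refine h1.congr' ?_
    filter_upwards [hgood] with l hl using htl l hl i
  refine ⟨t, .of_tendsto (hgood.mono fun l hl => ⟨?_, fun i j hij => ?_, fun i => ?_⟩) ht,
    fun i => ?_⟩
  · rw [htl l hl, (hg l hl).1, Nat.cast_zero, zero_mul]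
  · rw [← Subtype.coe_le_coe, htl l hl, htl l hl]
    exact mul_le_mul_left (Nat.cast_le.2 ((hg l hl).2.1 hij)) _
  · rw [htl l hl, htl l hl, ← hm l, ← add_mul, ← Nat.cast_add]
    rcases (hg l hl).2.2.2.1 i with h1 | h1
    · left; rw [h1, hn]
    · right; exact mul_le_mul_left (Nat.cast_le.2 h1) _
  · have hopen : ∀ u u' : ℝ≥0, (t i : ℝ≥0) < u → u < t (i + 1) → (t i : ℝ≥0) < u' →
        u' < t (i + 1) → dist (y u) (y u') ≤ 2 * c := by
      intro u u' hu1 hu2 hu1' hu2'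
      have key : ∀ u : ℝ≥0, (t i : ℝ≥0) < u → u < t (i + 1) → ∀ᶠ l in (𝒰 : Filter ℕ),
          dist (y (((⌊u / step l⌋₊ + 1 : ℕ) : ℝ≥0) * step l)) (y (g l i * step l)) ≤ c := by
        intro u hu1 hu2
        have e1 := (ht' i).eventually_lt_const hu1
        have e2 : ∀ᶠ l in (𝒰 : Filter ℕ), u + step l < (g l (i + 1) : ℝ≥0) * step l := by
          have e3 : Tendsto (fun l => u + step l) 𝒰 (𝓝 u) := by
            simpa using (tendsto_const_nhds (x := u)).add hstep
          exact e3.eventually_lt (ht' (i + 1)) hu2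
        filter_upwards [hgood, e1, e2] with l hl e1 e2
        obtain ⟨f1, f2⟩ := (tendsto_floor_grid u hstep0 hstep).2 l
        refine (hg l hl).2.2.2.2 i _ ?_ ?_
        · have := lt_of_mul_lt_mul_right (e1.trans f1) (zero_le)
          exact_mod_cast this.le
        · have := lt_of_mul_lt_mul_right (f2.trans_lt e2) (zero_le)
          exact_mod_cast this
      have hlim : ∀ u : ℝ≥0,
          Tendsto (fun l => y (((⌊u / step l⌋₊ + 1 : ℕ) : ℝ≥0) * step l)) 𝒰 (𝓝 (y u)) := fun u =>
        (hy u).tendsto.comp (tendsto_floor_grid u hstep0 hstep).1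
      refine le_of_tendsto ((hlim u).dist (hlim u')) ?_
      filter_upwards [key u hu1 hu2, key u' hu1' hu2'] with l h1 h2
      refine (dist_triangle_right _ _ (y (g l i * step l))).trans ?_
      linarith
    have hright : ∀ s : ℝ≥0, Tendsto y (𝓝[>] s) (𝓝 (y s)) := fun s =>
      (hy s).tendsto.mono_left (nhdsWithin_mono _ Set.Ioi_subset_Ici_self)
    have hIoo : ∀ s b : ℝ≥0, s < b → ∀ᶠ u in 𝓝[>] s, s < u ∧ u < b := fun s b hsb =>
      Ioo_mem_nhdsGT hsb
    intro s s' h1 h2 h1' h2'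
    rw [← Subtype.coe_le_coe] at h1 h1'
    rw [← Subtype.coe_lt_coe] at h2 h2'
    refine le_of_tendsto ((hright s).dist tendsto_const_nhds) ?_
    filter_upwards [hIoo _ _ h2] with u hu
    refine le_of_tendsto (tendsto_const_nhds.dist (hright s')) ?_
    filter_upwards [hIoo _ _ h2'] with u' hu'
    exact hopen u u' (h1.trans_lt hu.1) hu.2 (h1'.trans_lt hu'.1) hu'.2

/-- If there is no partition, the grid partitions fail for all fine enough grids, so the probability
is at most the uniform bound for one grid. Continuity of `P` along increasing unions is used for
sets whose measurability is not established. -/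
theorem measure_not_hasPartition_le {Ω : Type*} [mΩ : MeasurableSpace Ω] {P : Measure Ω}
    [IsProbabilityMeasure P] [SecondCountableTopology S] [MeasurableSpace S]
    [OpensMeasurableSpace S] {𝒢 : Filtration ℝ≥0 mΩ} {Y : ℝ≥0 → Ω → S}
    (hY : ∀ t, Measurable[𝒢 t] (Y t))
    (hr : ∀ ω t, ContinuousWithinAt (fun t => Y t ω) (Set.Ici t) t) {T : ℝ≥0} (hT : 0 < T)
    {ε : ℝ} (hε : 0 ≤ ε) {q₀ q : ℕ} (hq₀ : 0 < q₀) (hq : 0 < q) {ψ : ℝ} (hψ0 : 0 ≤ ψ)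
    (hψ : ψ ≤ 1 / 2)
    (h₀ : ∀ t h : ℝ≥0, h ≤ T / q₀ → ∀ A, MeasurableSet[𝒢 t] A →
      P.real (A ∩ {ω | ε < dist (Y (t + h) ω) (Y t ω)}) ≤ 1 / 4 * P.real A)
    (h₁ : ∀ t h : ℝ≥0, h ≤ T / q → ∀ A, MeasurableSet[𝒢 t] A →
      P.real (A ∩ {ω | ε < dist (Y (t + h) ω) (Y t ω)}) ≤ ψ * P.real A) :
    P {ω | ¬ HasPartition T (T / q) (fun a b => dist a b ≤ 2 * (4 * ε)) fun s => Y s ω} ≤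
      ENNReal.ofReal (4 * ψ * (q₀ + 2)) := by
  let step : ℕ → ℝ≥0 := fun l => T / (q₀ * q * (l + 1) : ℕ)
  let bad : ℕ → Set Ω := fun l => {ω | ¬ HasGridPartition (q₀ * (q * (l + 1))) (q₀ * (l + 1))
    (4 * ε) fun j => Y (j * step l) ω}
  have hbad : ∀ l, P (bad l) ≤ ENNReal.ofReal (4 * ψ * (q₀ + 2)) := by
    intro l
    let 𝒢' : Filtration ℕ mΩ :=
      { seq := fun j => 𝒢 (j * step l)
        mono' := fun i j hij => 𝒢.mono (mul_le_mul_left (Nat.cast_le.2 hij) _)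
        le' := fun j => 𝒢.le _ }
    have hsmall : ∀ (m : ℕ) (ψ : ℝ) (b : ℝ≥0), (m : ℝ≥0) * step l = b →
        (∀ t h : ℝ≥0, h ≤ b → ∀ A, MeasurableSet[𝒢 t] A →
          P.real (A ∩ {ω | ε < dist (Y (t + h) ω) (Y t ω)}) ≤ ψ * P.real A) →
        SmallIncrements P 𝒢' (fun j => Y (j * step l)) ε m ψ := by
      intro m ψ b hb h j i hji him A hA
      have h1 := h (j * step l) ((i - j : ℕ) * step l) (by
        rw [← hb]; exact mul_le_mul_left (Nat.cast_le.2 (by omega)) _) A hA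
      rw [← add_mul, ← Nat.cast_add, Nat.add_sub_cancel' hji] at h1
      exact h1
    have e1 : (q₀ : ℝ≥0) ≠ 0 := by positivity
    have e2 : (q : ℝ≥0) ≠ 0 := by positivity
    have e3 : ((l : ℝ≥0) + 1) ≠ 0 := by positivity
    have := measureReal_not_hasGridPartition_le (P := P) (𝒢 := 𝒢') (Y := fun j => Y (j * step l))
      (fun j => hY _) hε (m₀ := q * (l + 1)) (q₀ := q₀) (m := q₀ * (l + 1)) (by positivity)
      (by positivity) (Nat.mul_le_mul_left _ (Nat.le_mul_of_pos_left _ hq))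
      (hsmall _ _ (T / q₀) (by simp only [step]; push_cast; field_simp) h₀) hψ0 hψ
      (hsmall _ _ (T / q) (by simp only [step]; push_cast; field_simp) h₁)
    exact (ENNReal.le_ofReal_iff_toReal_le (measure_ne_top _ _) (by positivity)).2 this
  have hsub : {ω | ¬ HasPartition T (T / q) (fun a b => dist a b ≤ 2 * (4 * ε)) fun s => Y s ω} ⊆
      ⋃ L : ℕ, ⋂ l ≥ L, bad l := by
    intro ω hω
    by_contra hcon
    refine hω (hasPartition_of_frequently hT hq₀ hq (y := fun t => Y t ω) (hr ω) ?_)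
    rw [Filter.Frequently, eventually_atTop]
    rintro ⟨L, hL⟩
    exact hcon (Set.mem_iUnion.2 ⟨L, Set.mem_iInter₂.2 fun l hl => hL l hl⟩)
  have hmono : Monotone fun L : ℕ => ⋂ l ≥ L, bad l := fun L L' hL =>
    Set.iInter₂_mono' fun l hl => ⟨l, le_trans hL hl, subset_rfl⟩
  calc _ ≤ P (⋃ L : ℕ, ⋂ l ≥ L, bad l) := measure_mono hsub
    _ = ⨆ L : ℕ, P (⋂ l ≥ L, bad l) := hmono.measure_iUnion
    _ ≤ _ := iSup_le fun L => (measure_mono (Set.iInter₂_subset L le_rfl)).trans (hbad L)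

end Partition

/-! ### Compact sets of càdlàg paths -/

section TimeChange

variable {T δ : ℝ≥0} {t : ℕ → Set.Icc (0 : ℝ≥0) T}

theorem IsTimePartition.add_le_of_lt (ht : IsTimePartition T δ t) {i j : ℕ} (h : t i < t j) :
    (t i : ℝ≥0) + δ ≤ t j := by
  have hij : i < j := by
    by_contra hcon
    exact absurd (ht.mono (not_lt.1 hcon)) (not_le.2 h)
  rcases ht.gap i with h1 | h1
  · exact absurd h1 (ne_of_lt (lt_of_lt_of_le (Subtype.coe_lt_coe.2 h) (t j).2.2))
  · exact h1.trans (Subtype.coe_le_coe.2 (ht.mono (Nat.succ_le_of_lt hij)))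

theorem IsTimePartition.eq_or_le (ht : IsTimePartition T δ t) (i : ℕ) :
    (t i : ℝ≥0) = T ∨ (i : ℝ≥0) * δ ≤ t i := by
  induction i with
  | zero => right; simp
  | succ i ih =>
    rcases ih with h | h
    · left
      exact le_antisymm (t (i + 1)).2.2 (h.symm.le.trans (Subtype.coe_le_coe.2 (ht.mono i.le_succ)))
    · rcases ht.gap i with h' | h'
      · left
        exact le_antisymm (t (i + 1)).2.2 (h'.symm.le.trans (Subtype.coe_le_coe.2 (ht.mono i.le_succ)))
      · right
        push_cast
        rw [add_mul, one_mul]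
        exact (add_le_add_left h δ).trans h'

theorem IsTimePartition.exists_eq (ht : IsTimePartition T δ t) (hδ : 0 < δ) :
    ∃ M, ∀ i, M ≤ i → (t i : ℝ≥0) = T := by
  obtain ⟨M, hM⟩ := exists_nat_gt (T / δ)
  refine ⟨M, fun i hi => (ht.eq_or_le i).resolve_right fun h => ?_⟩
  rw [div_lt_iff₀ hδ] at hM
  have h1 : (M : ℝ≥0) * δ ≤ i * δ := mul_le_mul_left (Nat.cast_le.2 hi) _
  exact absurd (h.trans (t i).2.2) (not_le.2 (hM.trans_le h1))

theorem IsTimePartition.exists_mem_Ico (ht : IsTimePartition T δ t) (hδ : 0 < δ)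
    {s : Set.Icc (0 : ℝ≥0) T} (hs : (s : ℝ≥0) < T) : ∃ i, t i ≤ s ∧ s < t (i + 1) := by
  classical
  obtain ⟨M, hM⟩ := ht.exists_eq hδ
  have hex : ∃ i, s < t i := ⟨M, by rw [← Subtype.coe_lt_coe, hM M le_rfl]; exact hs⟩
  have h1 := Nat.find_spec hex
  have h0 : Nat.find hex ≠ 0 := fun h => by
    rw [h, ← Subtype.coe_lt_coe, ht.zero] at h1
    exact absurd h1 not_lt_zero
  obtain ⟨i, hi⟩ := Nat.exists_eq_succ_of_ne_zero h0
  refine ⟨i, not_lt.1 (Nat.find_min hex (by omega)), ?_⟩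
  rwa [hi] at h1

theorem IsTimePartition.exists_mem_Ioc (ht : IsTimePartition T δ t) (hδ : 0 < δ)
    {s : Set.Icc (0 : ℝ≥0) T} (hs : 0 < (s : ℝ≥0)) : ∃ i, t i < s ∧ s ≤ t (i + 1) := by
  classical
  obtain ⟨M, hM⟩ := ht.exists_eq hδ
  have hex : ∃ i, s ≤ t i := ⟨M, by rw [← Subtype.coe_le_coe, hM M le_rfl]; exact s.2.2⟩
  have h1 := Nat.find_spec hex
  have h0 : Nat.find hex ≠ 0 := fun h => by
    rw [h, ← Subtype.coe_le_coe, ht.zero] at h1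
    exact absurd hs (not_lt.2 h1)
  obtain ⟨i, hi⟩ := Nat.exists_eq_succ_of_ne_zero h0
  refine ⟨i, not_le.1 (Nat.find_min hex (by omega)), ?_⟩
  rwa [hi] at h1

/-- Two partitions whose points are close are matched by a time change close to the identity. -/
theorem exists_timeChange (hδ : 0 < δ) {t' : ℕ → Set.Icc (0 : ℝ≥0) T}
    (ht : IsTimePartition T δ t) (ht' : IsTimePartition T δ t') {η : ℝ} (hη : 0 ≤ η)
    (hηδ : 2 * η < δ) (hclose : ∀ i, dist (t' i) (t i) ≤ η)
    (hT : ∀ i, (t i : ℝ≥0) = T → (t' i : ℝ≥0) = T) :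
    ∃ τ : Set.Icc (0 : ℝ≥0) T ≃o Set.Icc (0 : ℝ≥0) T,
      (∀ s, dist (τ s) s ≤ 2 * η / δ * T) ∧ ∀ i, τ (t i) = t' i := by
  classical
  have hδ' : (0 : ℝ) < δ := hδ
  have heq : ∀ i j, t i = t j → t' i = t' j := by
    have key : ∀ i j, i < j → t i = t j → t' i = t' j := by
      intro i j hij h
      have h1 : (t i : ℝ≥0) = T := by
        refine (ht.gap i).resolve_right fun h1 => ?_
        have h2 := h1.trans (Subtype.coe_le_coe.2 (ht.mono (Nat.succ_le_of_lt hij)))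
        rw [h] at h2
        exact absurd h2 (not_le.2 (lt_add_of_pos_right _ hδ))
      exact Subtype.ext ((hT i h1).trans (hT j (h ▸ h1)).symm)
    intro i j h
    rcases lt_trichotomy i j with hij | rfl | hij
    · exact key i j hij h
    · rfl
    · exact (key j i hij h.symm).symm
  let p : ℕ → ℝ := fun i => ((t i : ℝ≥0) : ℝ)
  let p' : ℕ → ℝ := fun i => ((t' i : ℝ≥0) : ℝ)
  have hp : ∀ i j, p i = p j → p' i = p' j := fun i j h => by
    have : t i = t j := Subtype.ext (NNReal.coe_injective h)
    simp only [p', heq i j this]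
  have hpp : ∀ i, |p' i - p i| ≤ η := hclose
  let e₀ : ℝ → ℝ := fun r => if h : ∃ i, p i = r then p' h.choose - p h.choose else 0
  have he₀ : ∀ i, e₀ (p i) = p' i - p i := fun i => by
    have h : ∃ j, p j = p i := ⟨i, rfl⟩
    simp only [e₀, dif_pos h]
    rw [h.choose_spec, hp _ _ h.choose_spec]
  -- Displacements differ by at most `2 * η` over gaps of at least `δ`. Since this Lipschitz
  -- constant is below `1`, the identity plus a Lipschitz extension of the displacement is strictly
  -- increasing.
  let L : ℝ≥0 := ⟨2 * η / δ, by positivity⟩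
  have hL1 : (L : ℝ) < 1 := (div_lt_one hδ').2 hηδ
  have hlip : LipschitzOnWith L e₀ (Set.range p) := by
    refine LipschitzOnWith.of_dist_le_mul ?_
    rintro _ ⟨i, rfl⟩ _ ⟨j, rfl⟩
    rw [he₀, he₀]
    have key : ∀ i j, t i < t j → dist (p' i - p i) (p' j - p j) ≤ L * dist (p i) (p j) := by
      intro i j hij
      have h1 : p i + δ ≤ p j := by exact_mod_cast ht.add_le_of_lt hij
      have h2 : (δ : ℝ) ≤ dist (p i) (p j) := by
        rw [dist_comm, Real.dist_eq]; exact (by linarith : (δ : ℝ) ≤ p j - p i).trans (le_abs_self _)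
      have h3 : dist (p' i - p i) (p' j - p j) ≤ 2 * η := by
        rw [Real.dist_eq]; exact (abs_sub _ _).trans (by linarith [hpp i, hpp j])
      have h4 : (L : ℝ) * δ = 2 * η := div_mul_cancel₀ _ hδ'.ne'
      calc _ ≤ 2 * η := h3
        _ = L * δ := h4.symm
        _ ≤ _ := mul_le_mul_of_nonneg_left h2 L.2
    rcases lt_trichotomy (t i) (t j) with hij | hij | hij
    · exact key i j hij
    · have : p i = p j := by simp only [p, hij]
      rw [this, hp i j this, dist_self, dist_self, mul_zero]
    · rw [dist_comm, dist_comm (p i)]; exact key j i hij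
  obtain ⟨e, he, hee₀⟩ := hlip.extend_real
  have hep : ∀ i, e (p i) = p' i - p i := fun i => by rw [← hee₀ ⟨i, rfl⟩, he₀]
  let F : ℝ → ℝ := fun s => s + e s
  have hFc : Continuous F := continuous_id.add he.continuous
  have hFm : StrictMono F := by
    intro a b hab
    have h1 := he.dist_le_mul a b
    rw [Real.dist_eq, Real.dist_eq, abs_sub_comm a b, abs_of_pos (sub_pos.2 hab)] at h1
    have h2 := (le_abs_self _).trans h1
    simp only [F]
    nlinarith [sub_pos.2 hab]
  have hp0 : p 0 = 0 := by simp only [p, ht.zero]; rfl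
  have hp0' : p' 0 = 0 := by simp only [p', ht'.zero]; rfl
  have he0 : e 0 = 0 := by rw [← hp0, hep, hp0', hp0, sub_zero]
  have hF0 : F 0 = 0 := by simp only [F, he0, add_zero]
  have hFT : F T = T := by
    obtain ⟨M, hM⟩ := ht.exists_eq hδ
    have h1 : p M = T := by simp only [p, hM M le_rfl]
    have h2 : p' M = T := by simp only [p', hT M (hM M le_rfl)]
    simp only [F]
    rw [← h1, hep, h1, h2]; ring
  have hF0' : ∀ s : Set.Icc (0 : ℝ≥0) T, 0 ≤ F ((s : ℝ≥0) : ℝ) := fun s => by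
    rw [← hF0]; exact hFm.monotone (NNReal.coe_nonneg _)
  have hFT' : ∀ s : Set.Icc (0 : ℝ≥0) T, F ((s : ℝ≥0) : ℝ) ≤ T := fun s => by
    conv_rhs => rw [← hFT]
    exact hFm.monotone (NNReal.coe_le_coe.2 s.2.2)
  let τ : Set.Icc (0 : ℝ≥0) T → Set.Icc (0 : ℝ≥0) T := fun s =>
    ⟨⟨F ((s : ℝ≥0) : ℝ), hF0' s⟩, zero_le, hFT' s⟩
  have hτm : StrictMono τ := fun a b hab => hFm (NNReal.coe_lt_coe.2 (Subtype.coe_lt_coe.2 hab))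
  have hτs : Function.Surjective τ := by
    intro b
    obtain ⟨a, ha, hab⟩ := intermediate_value_Icc (NNReal.coe_nonneg T) hFc.continuousOn
      (show ((b : ℝ≥0) : ℝ) ∈ Set.Icc (F 0) (F T) by
        rw [hF0, hFT]; exact ⟨NNReal.coe_nonneg _, NNReal.coe_le_coe.2 b.2.2⟩)
    exact ⟨⟨⟨a, ha.1⟩, zero_le, ha.2⟩, Subtype.ext (NNReal.eq hab)⟩
  refine ⟨hτm.orderIsoOfSurjective τ hτs, fun s => ?_, fun i => ?_⟩
  · have h1 := he.dist_le_mul ((s : ℝ≥0) : ℝ) 0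
    rw [he0, Real.dist_eq, Real.dist_eq, sub_zero, sub_zero, NNReal.abs_eq] at h1
    have h2 : dist (τ s) s = |e ((s : ℝ≥0) : ℝ)| := by
      rw [Subtype.dist_eq, NNReal.dist_eq]
      change |F ((s : ℝ≥0) : ℝ) - ((s : ℝ≥0) : ℝ)| = _
      congr 1
      simp only [F]
      ring
    rw [StrictMono.coe_orderIsoOfSurjective, h2]
    exact h1.trans (mul_le_mul_of_nonneg_left (NNReal.coe_le_coe.2 s.2.2) L.2)
  · rw [StrictMono.coe_orderIsoOfSurjective]
    refine Subtype.ext (NNReal.eq ?_)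
    change p i + e (p i) = p' i
    rw [hep]; ring

end TimeChange

/-! ### Compactness in the Skorokhod topology. -/

section Compact

theorem mem_uniformity_skorokhodSpace {T : ℝ≥0} {E : Type*} [UniformSpace E]
    {S : Set (SkorokhodSpace T E × SkorokhodSpace T E)} :
    S ∈ uniformity (SkorokhodSpace T E) ↔
      ∃ U ∈ uniformity E, ∃ δ : ℝ, 0 < δ ∧ skorokhodEntourage U δ ⊆ S := by
  change S ∈ FilterBasis.filter _ ↔ _
  rw [FilterBasis.mem_filter_iff]
  constructor
  · rintro ⟨_, ⟨U, hU, δ, hδ, rfl⟩, h⟩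
    exact ⟨U, hU, δ, hδ, h⟩
  · rintro ⟨U, hU, δ, hδ, h⟩
    exact ⟨_, ⟨U, hU, δ, hδ, rfl⟩, h⟩

/-- Paths with values in a compact set, and with partitions on the parts of which they oscillate
little, form a compact set in the Skorokhod space. -/
theorem isCompact_skorokhod {T : ℝ≥0} {E : Type*} [UniformSpace E] {B : Set E} (hB : IsCompact B)
    {ι : Type*} {V : ι → E → E → Prop} (hVc : ∀ k, IsClosed {p : E × E | V k p.1 p.2})
    (hVU : ∀ U ∈ uniformity E, ∃ k, ∀ a ∈ B, ∀ b ∈ B, V k a b → (a, b) ∈ U)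
    {δ : ι → ℝ≥0} (hδ : ∀ k, 0 < δ k) :
    IsCompact {x : SkorokhodSpace T E | (∀ t, x.toFun t ∈ B) ∧
      ∀ k, HasPartition T (δ k) (V k) x.toFun} := by
  set K := {x : SkorokhodSpace T E | (∀ t, x.toFun t ∈ B) ∧
    ∀ k, HasPartition T (δ k) (V k) x.toFun} with hK
  rw [isCompact_iff_ultrafilter_le_nhds]
  intro f hf
  have hfK : ∀ᶠ x in (f : Filter (SkorokhodSpace T E)), x ∈ K := by simpa using hf
  -- pointwise limits of the paths and of the partition points
  have hy : ∀ s, ∃ e ∈ B, Tendsto (fun x : SkorokhodSpace T E => x.toFun s) f (𝓝 e) := fun s =>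
    hB.ultrafilter_le_nhds (f.map fun x : SkorokhodSpace T E => x.toFun s)
      (le_principal_iff.2 (Filter.mem_map.2 (hfK.mono fun x hx => hx.1 s)))
  choose y hyB hy using hy
  have htx : ∀ (k : ι) (x : SkorokhodSpace T E), ∃ t : ℕ → Set.Icc (0 : ℝ≥0) T, x ∈ K →
      (IsTimePartition T (δ k) t ∧ ∀ i s s', t i ≤ s → s < t (i + 1) → t i ≤ s' →
        s' < t (i + 1) → V k (x.toFun s) (x.toFun s')) := fun k x => by
    by_cases hx : x ∈ K
    · obtain ⟨t, ht⟩ := hx.2 k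
      exact ⟨t, fun _ => ht⟩
    · exact ⟨fun _ => ⟨0, le_rfl, zero_le⟩, fun h => absurd h hx⟩
  choose tx htx using htx
  have ht : ∀ k i, ∃ e, Tendsto (fun x => tx k x i) f (𝓝 e) := fun k i =>
    ⟨_, (f.map fun x => tx k x i).le_nhds_lim⟩
  choose t ht using ht
  have htp : ∀ k, IsTimePartition T (δ k) (t k) := fun k =>
    .of_tendsto (hfK.mono fun x hx => (htx k x hx).1) (ht k)
  have hyV : ∀ k i u u', t k i < u → u < t k (i + 1) → t k i < u' → u' < t k (i + 1) →
      V k (y u) (y u') := by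
    intro k i u u' h1 h2 h1' h2'
    refine (hVc k).mem_of_tendsto ((hy u).prodMk_nhds (hy u')) ?_
    filter_upwards [hfK, (ht k i).eventually_lt_const h1, (ht k (i + 1)).eventually_const_lt h2,
      (ht k i).eventually_lt_const h1', (ht k (i + 1)).eventually_const_lt h2'] with x hx a b a' b'
    exact (htx k x hx).2 i u u' a.le b a'.le b'
  -- the limit path
  have hz : ∀ s : Set.Icc (0 : ℝ≥0) T, ∃ e ∈ B, ((s : ℝ≥0) = T → e = y s) ∧ ((s : ℝ≥0) < T →
      ∃ 𝒰 : Ultrafilter (Set.Icc (0 : ℝ≥0) T), (𝒰 : Filter _) ≤ 𝓝[>] s ∧ Tendsto y 𝒰 (𝓝 e)) := by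
    intro s
    by_cases hs : (s : ℝ≥0) = T
    · exact ⟨y s, hyB s, fun _ => rfl, fun h => absurd hs h.ne⟩
    · have hlt : (s : ℝ≥0) < T := lt_of_le_of_ne s.2.2 hs
      have : (𝓝[>] s).NeBot := nhdsGT_neBot_of_exists_gt
        ⟨⟨T, zero_le, le_rfl⟩, Subtype.coe_lt_coe.1 hlt⟩
      obtain ⟨e, he, hlim⟩ := hB.ultrafilter_le_nhds ((Ultrafilter.of (𝓝[>] s)).map y)
        (le_principal_iff.2 (Filter.mem_map.2 (univ_mem' hyB)))
      exact ⟨e, he, fun h => absurd h hs, fun _ => ⟨_, Ultrafilter.of_le _, hlim⟩⟩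
  choose z hzB hzT hz using hz
  have hlt_of : ∀ {a b : Set.Icc (0 : ℝ≥0) T}, a < b → (a : ℝ≥0) < T := fun {a b} h =>
    lt_of_lt_of_le (Subtype.coe_lt_coe.2 h) b.2.2
  have hzy : ∀ k i s u, t k i ≤ s → s < t k (i + 1) → t k i < u → u < t k (i + 1) →
      V k (z s) (y u) := by
    intro k i s u h1 h2 h3 h4
    obtain ⟨𝒰, h𝒰, hlim⟩ := hz s (hlt_of h2)
    refine (hVc k).mem_of_tendsto (hlim.prodMk_nhds tendsto_const_nhds) ?_
    filter_upwards [h𝒰 (Ioo_mem_nhdsGT h2)] with v hv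
    exact hyV k i v u (h1.trans_lt hv.1) hv.2 h3 h4
  have hzz : ∀ k i s s', t k i ≤ s → s < t k (i + 1) → t k i ≤ s' → s' < t k (i + 1) →
      V k (z s) (z s') := by
    intro k i s s' h1 h2 h1' h2'
    obtain ⟨𝒰, h𝒰, hlim⟩ := hz s' (hlt_of h2')
    refine (hVc k).mem_of_tendsto (tendsto_const_nhds.prodMk_nhds hlim) ?_
    filter_upwards [h𝒰 (Ioo_mem_nhdsGT h2')] with v hv
    exact hzy k i s v h1 h2 (h1'.trans_lt hv.1) hv.2
  have hcad : IsCadlag z := by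
    intro s
    constructor
    · by_cases hs : (s : ℝ≥0) = T
      · have : Set.Ici s = {s} := by
          ext u
          simp only [Set.mem_Ici, Set.mem_singleton_iff]
          refine ⟨fun h => le_antisymm ?_ h, fun h => h.ge⟩
          rw [← Subtype.coe_le_coe, hs]; exact u.2.2
        rw [this]; exact continuousWithinAt_singleton
      · have hlt : (s : ℝ≥0) < T := lt_of_le_of_ne s.2.2 hs
        refine Uniform.tendsto_nhds_right.2 fun U hU => ?_
        obtain ⟨k, hk⟩ := hVU U hU
        obtain ⟨i, h1, h2⟩ := (htp k).exists_mem_Ico (hδ k) hlt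
        have : ∀ᶠ u in 𝓝[≥] s, s ≤ u ∧ u < t k (i + 1) := Ico_mem_nhdsGE h2
        exact this.mono fun u hu =>
          hk _ (hzB s) _ (hzB u) (hzz k i s u h1 h2 (h1.trans hu.1) hu.2)
    · rcases eq_or_neBot (𝓝[<] s) with hbot | hne
      · exact ⟨z s, by rw [hbot]; exact tendsto_bot⟩
      · have hs0 : 0 < (s : ℝ≥0) := by
          refine pos_iff_ne_zero.2 fun h0 => hne.ne ?_
          have : Set.Iio s = ∅ := by
            ext u
            simp only [Set.mem_Iio, Set.mem_empty_iff_false, iff_false, not_lt]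
            rw [← Subtype.coe_le_coe, h0]; exact zero_le
          rw [this, nhdsWithin_empty]
        obtain ⟨l, hl, hlim⟩ := hB.ultrafilter_le_nhds ((Ultrafilter.of (𝓝[<] s)).map z)
          (le_principal_iff.2 (Filter.mem_map.2 (univ_mem' hzB)))
        refine ⟨l, Uniform.tendsto_nhds_right.2 fun U hU => ?_⟩
        obtain ⟨k, hk⟩ := hVU U hU
        obtain ⟨i, h1, h2⟩ := (htp k).exists_mem_Ioc (hδ k) hs0
        have : ∀ᶠ u in 𝓝[<] s, t k i < u ∧ u < s := Ioo_mem_nhdsLT h1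
        refine this.mono fun u hu => hk _ hl _ (hzB u) ?_
        refine (hVc k).mem_of_tendsto (Tendsto.prodMk_nhds hlim tendsto_const_nhds) ?_
        filter_upwards [Ultrafilter.of_le (𝓝[<] s) (Ioo_mem_nhdsLT h1)] with v hv
        exact hzz k i v u hv.1.le (hv.2.trans_le h2) hu.1.le (hu.2.trans_le h2)
  refine ⟨⟨z, hcad⟩, ⟨hzB, fun k => ⟨t k, htp k, hzz k⟩⟩, ?_⟩
  -- convergence in the Skorokhod topology
  intro N hN
  obtain ⟨S, hS, hSN⟩ := UniformSpace.mem_nhds_iff.1 hN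
  obtain ⟨U, hU, ε, hε, hUS⟩ := mem_uniformity_skorokhodSpace.1 hS
  suffices h : ∀ᶠ x in (f : Filter (SkorokhodSpace T E)),
      ((⟨z, hcad⟩ : SkorokhodSpace T E), x) ∈ skorokhodEntourage U ε from
    h.mono fun x hx => hSN (hUS hx)
  obtain ⟨W₁, hW₁, hW₁U⟩ := comp_mem_uniformity_sets hU
  obtain ⟨W, hW, hWW⟩ := comp_mem_uniformity_sets hW₁
  obtain ⟨k, hk⟩ := hVU W hW
  obtain ⟨M, hM⟩ := (htp k).exists_eq (hδ k)
  have hδk : (0 : ℝ) < δ k := hδ k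
  have hT0 : (0 : ℝ) ≤ T := T.2
  obtain ⟨η, hη0, hη1, hη2⟩ : ∃ η : ℝ, 0 < η ∧ 2 * η < δ k ∧ 2 * η / δ k * T < ε := by
    refine ⟨min (δ k / 4) (ε * δ k / (4 * (T + 1))), by positivity, ?_, ?_⟩
    · linarith [min_le_left ((δ k : ℝ) / 4) (ε * δ k / (4 * (T + 1)))]
    · have h1 := min_le_right ((δ k : ℝ) / 4) (ε * δ k / (4 * (T + 1)))
      rw [div_mul_eq_mul_div, div_lt_iff₀ hδk]
      rw [le_div_iff₀ (by positivity)] at h1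
      have h2 : 0 < min ((δ k : ℝ) / 4) (ε * δ k / (4 * (T + 1))) := by positivity
      nlinarith [mul_pos hε hδk]
  -- One interior point per part suffices: `z s` is close to `y (p i)` by oscillation, `y (p i)` to
  -- `x (p i)` by pointwise convergence, and `x (p i)` to `x (τ s)` by oscillation again.
  have hp : ∀ i, ∃ p, t k i < t k (i + 1) → (t k i < p ∧ p < t k (i + 1)) := fun i => by
    by_cases h : t k i < t k (i + 1)
    · obtain ⟨p, hp⟩ := exists_between h
      exact ⟨p, fun _ => hp⟩
    · exact ⟨t k i, fun h' => absurd h' h⟩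
  choose p hp using hp
  have hyW : ∀ s, ∀ᶠ x in (f : Filter (SkorokhodSpace T E)), (y s, x.toFun s) ∈ W := fun s =>
    (Uniform.tendsto_nhds_right.1 (hy s)) hW
  have e1 : ∀ᶠ x in (f : Filter (SkorokhodSpace T E)), ∀ i ∈ Finset.range (M + 1),
      dist (tx k x i) (t k i) < η := (Finset.eventually_all _).2 fun i _ =>
    (ht k i).eventually (Metric.ball_mem_nhds _ hη0)
  have e2 : ∀ᶠ x in (f : Filter (SkorokhodSpace T E)), ∀ i ∈ Finset.range M,
      t k i < t k (i + 1) → ((y (p i), x.toFun (p i)) ∈ W ∧ tx k x i < p i ∧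
        p i < tx k x (i + 1)) := by
    refine (Finset.eventually_all _).2 fun i _ => ?_
    by_cases h : t k i < t k (i + 1)
    · filter_upwards [hyW (p i), (ht k i).eventually_lt_const (hp i h).1,
        (ht k (i + 1)).eventually_const_lt (hp i h).2] with x a b c _ using ⟨a, b, c⟩
    · exact Eventually.of_forall fun x h' => absurd h' h
  filter_upwards [hfK, e1, e2, hyW ⟨T, zero_le, le_rfl⟩] with x hx e1 e2 e3
  obtain ⟨hpx, hVx⟩ := htx k x hx
  -- A point within `η < δ k` of `T` must equal `T`, as there is no room for another step.
  have hTM : ∀ i, (t k i : ℝ≥0) = T → i ≤ M → (tx k x i : ℝ≥0) = T := by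
    intro i hi hiM
    refine (hpx.gap i).resolve_right fun hgap => ?_
    have h1 := e1 i (Finset.mem_range.2 (Nat.lt_succ_of_le hiM))
    rw [Subtype.dist_eq, NNReal.dist_eq, hi, abs_sub_comm] at h1
    have h2 := (le_abs_self _).trans_lt h1
    have h3 : ((tx k x i : ℝ≥0) : ℝ) + δ k ≤ T := by
      exact_mod_cast hgap.trans (tx k x (i + 1)).2.2
    linarith
  have hTx : ∀ i, (t k i : ℝ≥0) = T → (tx k x i : ℝ≥0) = T := by
    intro i hi
    rcases le_or_gt i M with hiM | hiM
    · exact hTM i hi hiM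
    · have h1 := hTM M (hM M le_rfl) le_rfl
      exact le_antisymm (tx k x i).2.2 (h1.symm.le.trans (Subtype.coe_le_coe.2 (hpx.mono hiM.le)))
  have hclose : ∀ i, dist (tx k x i) (t k i) ≤ η := by
    intro i
    rcases le_or_gt i M with hiM | hiM
    · exact (e1 i (Finset.mem_range.2 (Nat.lt_succ_of_le hiM))).le
    · have h1 := hM i hiM.le
      rw [Subtype.dist_eq, hTx i h1, h1, dist_self]
      exact hη0.le
  obtain ⟨τ, hτ1, hτ2⟩ := exists_timeChange (hδ k) (htp k) hpx hη0.le hη1 hclose hTx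
  refine ⟨τ, fun s => ⟨(hτ1 s).trans_lt hη2, ?_⟩⟩
  change (z s, x.toFun (τ s)) ∈ U
  by_cases hs : (s : ℝ≥0) = T
  · have hsT : s = ⟨T, zero_le, le_rfl⟩ := Subtype.ext hs
    have hτT : τ s = s := by
      refine le_antisymm ?_ ?_
      · rw [hsT]; exact (τ _).2.2
      · rw [← τ.symm_apply_le, hsT]; exact (τ.symm _).2.2
    rw [hτT, hzT s hs, hsT]
    exact hW₁U ⟨_, hWW ⟨_, e3, refl_mem_uniformity hW⟩, refl_mem_uniformity hW₁⟩
  · obtain ⟨i, h1, h2⟩ := (htp k).exists_mem_Ico (hδ k) (lt_of_le_of_ne s.2.2 hs)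
    have hlt := h1.trans_lt h2
    have hiM : i < M := by
      by_contra hcon
      exact absurd (hlt_of hlt) (by rw [hM i (not_lt.1 hcon)]; exact lt_irrefl _)
    obtain ⟨f1, f2, f3⟩ := e2 i (Finset.mem_range.2 hiM) hlt
    have g1 : (z s, y (p i)) ∈ W := hk _ (hzB s) _ (hyB _) (hzy k i s (p i) h1 h2 (hp i hlt).1
      (hp i hlt).2)
    have g2 : (x.toFun (p i), x.toFun (τ s)) ∈ W := by
      refine hk _ (hx.1 _) _ (hx.1 _) (hVx i (p i) (τ s) f2.le f3 ?_ ?_)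
      · rw [← hτ2]; exact τ.monotone h1
      · rw [← hτ2]; exact τ.strictMono h2
    exact hW₁U ⟨_, hWW ⟨_, g1, f1⟩, (hWW ⟨_, g2, refl_mem_uniformity hW⟩)⟩

end Compact

/-! ### Compact sets of tempered distributions -/

section Distribution

variable {d : ℕ}

/-- The functionals that are bounded by `C` with respect to the norm
`sup (1 + ‖x‖)^(d+1) |G x|`. -/
def functionalBall (d : ℕ) (C : ℝ) : Set (𝓢(Space d, ℝ) →L[ℝ] ℝ) :=
  {u | ∀ G M, (∀ x, (1 + ‖x‖) ^ (d + 1) * |G x| ≤ M) → |u G| ≤ C * M}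

/-- A bounded set of test functions that decay one order faster. -/
def testBall (d : ℕ) (r : ℝ) : Set 𝓢(Space d, ℝ) :=
  {G | (∀ x, (1 + ‖x‖) ^ (d + 2) * |G x| ≤ r) ∧ ∀ x, ‖fderiv ℝ G x‖ ≤ r}

theorem abs_sub_le_of_mem_testBall {r : ℝ} {G : 𝓢(Space d, ℝ)} (hG : G ∈ testBall d r)
    (x y : Space d) : |G x - G y| ≤ r * ‖x - y‖ := by
  have := Convex.norm_image_sub_le_of_norm_fderiv_le (𝕜 := ℝ) (f := G) (s := Set.univ) (C := r)
    (fun z _ => (G.differentiable z)) (fun z _ => hG.2 z) convex_univ (Set.mem_univ y)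
    (Set.mem_univ x)
  simpa using this

theorem abs_le_of_mem_testBall {r : ℝ} {G : 𝓢(Space d, ℝ)} (hG : G ∈ testBall d r)
    (x : Space d) : |G x| ≤ r :=
  le_trans (le_mul_of_one_le_left (abs_nonneg _)
    (one_le_pow₀ (by linarith [norm_nonneg x]))) (hG.1 x)

/-- Total boundedness in the weighted norm: outside the ball of radius `2 / ε` the extra power of
decay suffices, and inside it the Lipschitz bound reduces to values at finitely many points. -/
theorem exists_finset_testBall (d : ℕ) {ε : ℝ} (hε : 0 < ε) : ∃ F : Finset 𝓢(Space d, ℝ),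
    ∀ H ∈ testBall d 1, ∃ G ∈ F, ∀ x, (1 + ‖x‖) ^ (d + 1) * |H x - G x| ≤ ε := by
  set R : ℝ := 2 / ε with hR
  have hR0 : 0 < R := by positivity
  set δ : ℝ := ε / (3 * (1 + R) ^ (d + 1)) with hδ
  have hδ0 : 0 < δ := by positivity
  obtain ⟨J, -, hJfin, hJ⟩ := (isCompact_closedBall (0 : Space d) R).finite_cover_balls hδ0
  have : Fintype J := hJfin.fintype
  let Φ : 𝓢(Space d, ℝ) → J → ℝ := fun G j => G j
  have hbd : Bornology.IsBounded (Φ '' testBall d 1) := by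
    refine (isBounded_iff_forall_norm_le).2 ⟨1, ?_⟩
    rintro _ ⟨G, hG, rfl⟩
    exact (pi_norm_le_iff_of_nonneg zero_le_one).2 fun j => abs_le_of_mem_testBall hG j
  obtain ⟨F, hFs, hFfin, ht⟩ := Set.exists_subset_image_finite_and.1
    ((hbd.isCompact_closure.totallyBounded.subset subset_closure).exists_subset
      (Metric.dist_mem_uniformity hδ0))
  refine ⟨hFfin.toFinset, fun H hH => ?_⟩
  obtain ⟨g, hg, hHg⟩ := Set.mem_iUnion₂.1 (ht (Set.mem_image_of_mem Φ hH))
  obtain ⟨G, hGF, rfl⟩ := hg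
  refine ⟨G, hFfin.mem_toFinset.2 hGF, fun x => ?_⟩
  have hG := hFs hGF
  rcases le_or_gt ‖x‖ R with hx | hx
  · obtain ⟨j, hj, hxj⟩ := Set.mem_iUnion₂.1 (hJ (mem_closedBall_zero_iff.2 hx))
    have h1 := abs_sub_le_of_mem_testBall hH x j
    have h2 := abs_sub_le_of_mem_testBall hG j x
    have h3 : |H j - G j| < δ := lt_of_le_of_lt (dist_le_pi_dist (Φ H) (Φ G) ⟨j, hj⟩) hHg
    have h4 : ‖x - j‖ < δ := by rw [← dist_eq_norm]; exact hxj
    rw [one_mul] at h1 h2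
    rw [norm_sub_rev] at h2
    have h5 : |H x - G x| ≤ 3 * δ := by
      have : H x - G x = (H x - H j) + (H j - G j) + (G j - G x) := by ring
      rw [this]
      linarith [abs_add_three (H x - H j) (H j - G j) (G j - G x)]
    calc (1 + ‖x‖) ^ (d + 1) * |H x - G x| ≤ (1 + R) ^ (d + 1) * (3 * δ) := by gcongr
      _ = ε := by rw [hδ]; field_simp
  · have h1 := hH.1 x
    have h2 := hG.1 x
    have h3 : |H x - G x| ≤ |H x| + |G x| := abs_sub _ _
    have hpos : 0 < 1 + ‖x‖ := by positivity
    have h4 : (1 + ‖x‖) * ((1 + ‖x‖) ^ (d + 1) * |H x - G x|) ≤ 2 := by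
      calc _ = (1 + ‖x‖) ^ (d + 2) * |H x - G x| := by ring
        _ ≤ (1 + ‖x‖) ^ (d + 2) * (|H x| + |G x|) := by gcongr
        _ ≤ 2 := by linarith
    have h5 : 2 ≤ ε * (1 + ‖x‖) := by
      have : ε * R = 2 := by rw [hR]; field_simp
      nlinarith
    refine le_of_mul_le_mul_left (h4.trans (h5.trans_eq (mul_comm _ _))) hpos

/-- Finite nets of the unit ball of test functions. -/
noncomputable def testNet (d n : ℕ) : Finset 𝓢(Space d, ℝ) :=
  (exists_finset_testBall d (Nat.one_div_pos_of_nat (α := ℝ) (n := n))).choose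

theorem testNet_spec (d n : ℕ) : ∀ H ∈ testBall d 1, ∃ G ∈ testNet d n,
    ∀ x, (1 + ‖x‖) ^ (d + 1) * |H x - G x| ≤ 1 / ((n : ℝ) + 1) :=
  (exists_finset_testBall d (Nat.one_div_pos_of_nat (α := ℝ) (n := n))).choose_spec

/-- Two functionals are close on the `n`-th net. -/
def NetClose (d n : ℕ) (u v : 𝓢(Space d, ℝ) →L[ℝ] ℝ) : Prop :=
  ∀ G ∈ testNet d n, |u G - v G| ≤ 1 / ((n : ℝ) + 1)

theorem isClosed_netClose (d n : ℕ) :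
    IsClosed {p : (𝓢(Space d, ℝ) →L[ℝ] ℝ) × (𝓢(Space d, ℝ) →L[ℝ] ℝ) | NetClose d n p.1 p.2} := by
  simp only [NetClose, Set.ofPred_forall]
  refine isClosed_biInter fun G _ => isClosed_le ?_ continuous_const
  exact (((continuous_eval_const G).comp continuous_fst).sub
    ((continuous_eval_const G).comp continuous_snd)).abs

theorem exists_subset_testBall {S : Set 𝓢(Space d, ℝ)} (hS : Bornology.IsVonNBounded ℝ S) :
    ∃ r : ℝ, 0 < r ∧ S ⊆ testBall d r := by
  obtain ⟨r, hr, h⟩ := ((schwartz_withSeminorms ℝ (Space d)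
    ℝ).isVonNBounded_iff_finset_seminorm_bounded.1 hS) (Finset.Iic (d + 2, 1))
  refine ⟨2 ^ (d + 2) * r, by positivity, fun G hG => ⟨fun x => ?_, fun x => ?_⟩⟩
  · have h1 := SchwartzMap.one_add_le_sup_seminorm_apply (𝕜 := ℝ) (m := (d + 2, 1)) (k := d + 2)
      (n := 0) le_rfl zero_le_one G x
    rw [norm_iteratedFDeriv_zero] at h1
    exact h1.trans (mul_le_mul_of_nonneg_left (h G hG).le (by positivity))
  · have h1 := SchwartzMap.one_add_le_sup_seminorm_apply (𝕜 := ℝ) (m := (d + 2, 1)) (k := d + 2)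
      (n := 1) le_rfl le_rfl G x
    rw [norm_iteratedFDeriv_one] at h1
    refine le_trans (le_mul_of_one_le_left (norm_nonneg _) (one_le_pow₀ ?_))
      (h1.trans (mul_le_mul_of_nonneg_left (h G hG).le (by positivity)))
    linarith [norm_nonneg x]

/-- A strong neighbourhood tests a bounded set of functions, which lies in a multiple of `testBall d
1`. Replacing a test function by its net point costs `C / (n + 1)` for each functional, whence the
factor `2 * C + 1`. -/
theorem exists_netClose_subset {C : ℝ} {U : Set ((𝓢(Space d, ℝ) →L[ℝ] ℝ) × (𝓢(Space d, ℝ) →L[ℝ] ℝ))}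
    (hU : U ∈ uniformity (𝓢(Space d, ℝ) →L[ℝ] ℝ)) :
    ∃ n, ∀ u ∈ functionalBall d C, ∀ v ∈ functionalBall d C, NetClose d n u v → (u, v) ∈ U := by
  rw [uniformity_eq_comap_nhds_zero] at hU
  obtain ⟨W, hW, hWU⟩ := hU
  obtain ⟨⟨S, ρ⟩, ⟨hS, hρ⟩, hSW⟩ := (ContinuousLinearMap.hasBasis_nhds_zero_of_basis
    (𝕜₁ := ℝ) (σ := RingHom.id ℝ) (E := 𝓢(Space d, ℝ)) Metric.nhds_basis_ball).mem_iff.1 hW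
  obtain ⟨r, hr, hSr⟩ := exists_subset_testBall hS
  obtain ⟨n, hn⟩ := exists_nat_gt (r * (2 * C + 1) / ρ)
  have hn0 : (0 : ℝ) < n + 1 := by positivity
  refine ⟨n, fun u hu v hv huv => hWU (hSW fun G hG => ?_)⟩
  obtain ⟨hG1, hG2⟩ := hSr hG
  have hH : r⁻¹ • G ∈ testBall d 1 := by
    refine ⟨fun x => ?_, fun x => ?_⟩
    · rw [_root_.smul_apply, smul_eq_mul, abs_mul, abs_of_pos (inv_pos.2 hr), mul_left_comm,
        inv_mul_le_iff₀ hr, mul_one]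
      exact hG1 x
    · have : ⇑(r⁻¹ • G) = r⁻¹ • ⇑G := rfl
      rw [this, fderiv_const_smul (G.differentiable x), norm_smul, Real.norm_of_nonneg
        (inv_pos.2 hr).le, inv_mul_le_iff₀ hr, mul_one]
      exact hG2 x
  obtain ⟨K, hK, hHK⟩ := testNet_spec d n _ hH
  have h1 := hu (r⁻¹ • G - K) _ hHK
  have h2 := hv (r⁻¹ • G - K) _ hHK
  have h3 := huv K hK
  rw [map_sub, map_smul, smul_eq_mul] at h1 h2
  have h4 : |r⁻¹ * (v G - u G)| ≤ (2 * C + 1) * (1 / ((n : ℝ) + 1)) := by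
    have : r⁻¹ * (v G - u G) = (r⁻¹ * v G - v K) - (r⁻¹ * u G - u K) - (u K - v K) := by ring
    rw [this]
    linarith [abs_sub ((r⁻¹ * v G - v K) - (r⁻¹ * u G - u K)) (u K - v K),
      abs_sub (r⁻¹ * v G - v K) (r⁻¹ * u G - u K)]
  rw [abs_mul, abs_of_pos (inv_pos.2 hr), inv_mul_le_iff₀ hr] at h4
  rw [mem_ball_zero_iff, Real.norm_eq_abs]
  change |v G - u G| < ρ
  refine h4.trans_lt ?_
  rw [div_lt_iff₀ hρ] at hn
  rw [← mul_assoc, mul_one_div, div_lt_iff₀ hn0]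
  linarith

/-- On a ball of functionals, the strong topology is that of pointwise convergence. -/
theorem tendsto_of_mem_functionalBall {C : ℝ} {α : Type*} {l : Filter α}
    {u : α → 𝓢(Space d, ℝ) →L[ℝ] ℝ} {v : 𝓢(Space d, ℝ) →L[ℝ] ℝ}
    (hu : ∀ᶠ a in l, u a ∈ functionalBall d C) (hv : v ∈ functionalBall d C)
    (h : ∀ G, Tendsto (fun a => u a G) l (𝓝 (v G))) : Tendsto u l (𝓝 v) := by
  refine Uniform.tendsto_nhds_right.2 fun U hU => ?_
  obtain ⟨n, hn⟩ := exists_netClose_subset (C := C) hU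
  have h1 : ∀ᶠ a in l, NetClose d n v (u a) := (Finset.eventually_all _).2 fun G _ => by
    have h2 := (tendsto_const_nhds (x := v G)).sub (h G)
    rw [sub_self] at h2
    have h3 := h2.abs
    rw [abs_zero] at h3
    exact (h3.eventually_lt_const (Nat.one_div_pos_of_nat (α := ℝ) (n := n))).mono fun a ha => ha.le
  change ∀ᶠ a in l, (v, u a) ∈ U
  filter_upwards [hu, h1] with a ha ha'
  exact hn _ hv _ ha ha'

/-- As in Banach–Alaoglu, an ultrafilter converges pointwise to a linear functional with the same
bound; on the ball this is already strong convergence. -/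
theorem isCompact_functionalBall (d : ℕ) {C : ℝ} (hC : 0 ≤ C) :
    IsCompact (functionalBall d C) := by
  rw [isCompact_iff_ultrafilter_le_nhds]
  intro f hf
  have hfB : ∀ᶠ u in (f : Filter (𝓢(Space d, ℝ) →L[ℝ] ℝ)), u ∈ functionalBall d C := by
    simpa using hf
  have hlim : ∀ G : 𝓢(Space d, ℝ), ∃ y : ℝ,
      Tendsto (fun u : 𝓢(Space d, ℝ) →L[ℝ] ℝ => u G) f (𝓝 y) := fun G => by
    obtain ⟨M, -, hM, -⟩ := exists_schwartz_bound G (d + 1)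
    obtain ⟨y, -, hy⟩ := (isCompact_Icc (a := -(C * M)) (b := C * M)).ultrafilter_le_nhds
      (f.map fun u : 𝓢(Space d, ℝ) →L[ℝ] ℝ => u G)
      (le_principal_iff.2 (Filter.mem_map.2 (hfB.mono fun u hu => abs_le.1 (hu G M hM))))
    exact ⟨y, hy⟩
  choose y hy using hlim
  have hyM : ∀ G M, (∀ x, (1 + ‖x‖) ^ (d + 1) * |G x| ≤ M) → |y G| ≤ C * M := fun G M hM =>
    le_of_tendsto (hy G).abs (hfB.mono fun u hu => hu G M hM)
  let v : 𝓢(Space d, ℝ) →L[ℝ] ℝ := SchwartzMap.mkCLMtoNormedSpace y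
    (fun G H => tendsto_nhds_unique (hy _) (by simpa using (hy G).add (hy H)))
    (fun a G => tendsto_nhds_unique (hy _) (by simpa using (hy G).const_mul a))
    (by
      refine ⟨Finset.Iic (d + 1, 0), C * 2 ^ (d + 1), by positivity, fun G => ?_⟩
      rw [mul_assoc]
      refine hyM G _ fun x => ?_
      have := SchwartzMap.one_add_le_sup_seminorm_apply (𝕜 := ℝ) (m := (d + 1, 0)) (k := d + 1)
        (n := 0) le_rfl le_rfl G x
      rwa [norm_iteratedFDeriv_zero] at this)
  exact ⟨v, hyM, tendsto_of_mem_functionalBall (u := id) hfB hyM hy⟩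

theorem continuous_empiricalField (N : ℕ+) :
    Continuous (empiricalField N : Config d → 𝓢(Space d, ℝ) →L[ℝ] ℝ) := by
  obtain ⟨C, -, hC⟩ := exists_abs_empiricalField_le d
  refine continuous_iff_continuousAt.2 fun ξ => tendsto_of_mem_functionalBall (C := C)
    (Eventually.of_forall fun ξ' => hC N ξ') (hC N ξ) fun G => ?_
  refine Continuous.tendsto (f := fun ξ => empiricalField N ξ G) ?_ ξ
  obtain ⟨w, hw, h⟩ := exists_mul_occ_bound (d := d) N
  simp only [empiricalField_apply]
  exact continuous_const.mul (continuous_tsum (fun x => continuous_const.mul (continuous_occ x))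
    (hw.mul_left _) (fun x ξ => h G ξ x))

theorem IsCadlag.comp_continuous {ι E F : Type*} [TopologicalSpace ι] [Preorder ι]
    [TopologicalSpace E] [TopologicalSpace F] {g : E → F} (hg : Continuous g) {f : ι → E}
    (hf : IsCadlag f) : IsCadlag fun t => g (f t) := fun t =>
  ⟨hg.continuousAt.comp_continuousWithinAt (hf t).1,
    let ⟨l, hl⟩ := (hf t).2; ⟨g l, (hg.tendsto l).comp hl⟩⟩

theorem IsCadlag.comp_strictMono {ι κ E : Type*} [TopologicalSpace ι] [Preorder ι]
    [TopologicalSpace κ] [PartialOrder κ] [TopologicalSpace E] {f : ι → E} (hf : IsCadlag f)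
    {τ : κ → ι} (hτ : Continuous τ) (hm : StrictMono τ) : IsCadlag fun t => f (τ t) := fun t =>
  ⟨(hf (τ t)).1.comp hτ.continuousWithinAt fun _ h => hm.monotone h,
    (hf (τ t)).2.imp fun _ hl => hl.comp (tendsto_nhdsWithin_of_tendsto_nhds_of_eventually_within _
      hτ.continuousWithinAt (eventually_nhdsWithin_of_forall fun _ h => hm h))⟩

theorem isCadlag_densityField (N : ℕ+) {Ω : Type*} {η : ℝ≥0 → Ω → Config d} {ω : Ω}
    (h : IsCadlag fun t => η t ω) (T : ℝ≥0) :
    IsCadlag fun t : Set.Icc (0 : ℝ≥0) T => densityField N η t ω := by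
  have hN : (0 : ℝ≥0) < (N : ℝ≥0) ^ 2 := pow_pos (Nat.cast_pos.2 N.pos) 2
  refine IsCadlag.comp_continuous (continuous_empiricalField N)
    (h.comp_strictMono (τ := fun t : Set.Icc (0 : ℝ≥0) T => (t : ℝ≥0) * (N : ℝ≥0) ^ 2)
      (continuous_subtype_val.mul continuous_const) fun a b hab => ?_)
  exact mul_lt_mul_of_pos_right (Subtype.coe_lt_coe.2 hab) hN

end Distribution
/-! ### Tightness of the density fields -/

section Tightness

/-- An almost sure bound on a conditional probability can be checked by integrating over the events
of `m`. -/
theorem condExp_indicator_le {Ω : Type*} {m mΩ : MeasurableSpace Ω} {P : Measure Ω}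
    [IsFiniteMeasure P] (hm : m ≤ mΩ) {B : Set Ω} (hB : MeasurableSet B) {c : ℝ}
    (h : ∀ A, MeasurableSet[m] A → P.real (A ∩ B) ≤ c * P.real A) :
    ∀ᵐ ω ∂P, (P⟦B | m⟧) ω ≤ c := by
  have hint : Integrable (B.indicator fun _ => (1 : ℝ)) P := (integrable_const 1).indicator hB
  refine ae_of_ae_trim hm (ae_le_of_forall_setIntegral_le
    (integrable_condExp.trim hm stronglyMeasurable_condExp) (integrable_const c)
    fun A hA _ => ?_)
  rw [← setIntegral_trim hm stronglyMeasurable_condExp hA, setIntegral_condExp hm hint hA,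
    setIntegral_indicator hB, setIntegral_const, setIntegral_const, smul_eq_mul, smul_eq_mul,
    mul_one, mul_comm, measureReal_def (P.trim hm),
    trim_measurableSet_eq hm hA]
  exact h A hA

variable {d : ℕ} {α : ℝ}

theorem exists_measureReal_increment_le (lam : Environment d)
    (hlam : ∀ t x y, Nbr x y → lam.rate t x y ≤ α) (G : 𝓢(Space d, ℝ)) :
    ∃ K : ℝ, 0 ≤ K ∧ ∀ (N : ℕ+) {Ω : Type*} [mΩ : MeasurableSpace Ω] (P : Measure Ω)
      [IsProbabilityMeasure P] (𝓕 : Filtration ℝ≥0 mΩ) (η : ℝ≥0 → Ω → Config d),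
      IsSSEP lam P 𝓕 η → ∀ (t h : ℝ≥0), h ≤ 1 →
      ∀ A : Set Ω, MeasurableSet[𝓕 (t * (N : ℝ≥0) ^ 2)] A → ∀ ε : ℝ, 0 < ε →
      P.real (A ∩ {ω | ε < |densityField N η (t + h) ω G - densityField N η t ω G|}) ≤
        K * √h / ε ^ 2 * P.real A := by
  obtain ⟨K, hK0, hK⟩ := exists_setIntegral_field_sub_sq_le lam hlam G
  obtain ⟨C, hC0, hC⟩ := exists_abs_empiricalField_le d
  obtain ⟨M, hM0, hM, -⟩ := exists_schwartz_bound G (d + 1)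
  refine ⟨K, hK0, fun N Ω mΩ P _ 𝓕 η hη t h hh A hA ε hε => ?_⟩
  have hm : Measurable fun ω => densityField N η (t + h) ω G - densityField N η t ω G :=
    (measurable_densityField N hη.measurable _ G).sub (measurable_densityField N hη.measurable _ G)
  have hint : Integrable (fun ω => (densityField N η (t + h) ω G - densityField N η t ω G) ^ 2)
      (P.restrict A) := by
    refine Integrable.of_bound (hm.pow_const 2).aestronglyMeasurable ((2 * (C * M)) ^ 2)
      (Eventually.of_forall fun ω => ?_)
    rw [Real.norm_eq_abs, abs_pow]
    refine pow_le_pow_left₀ (abs_nonneg _) ((abs_sub _ _).trans ?_) 2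
    have h1 := hC N (η ((t + h) * (N : ℝ≥0) ^ 2) ω) G M hM
    have h2 := hC N (η (t * (N : ℝ≥0) ^ 2) ω) G M hM
    rw [densityField, densityField]
    linarith
  have h1 := mul_meas_ge_le_integral_of_nonneg
    (Eventually.of_forall fun ω => sq_nonneg _) hint (ε ^ 2)
  have h2 := h1.trans (hK N P 𝓕 η hη t h hh A hA)
  have h3 : P.real (A ∩ {ω | ε < |densityField N η (t + h) ω G - densityField N η t ω G|}) ≤
      (P.restrict A).real
        {ω | ε ^ 2 ≤ (densityField N η (t + h) ω G - densityField N η t ω G) ^ 2} := by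
    rw [measureReal_restrict_apply (measurableSet_le measurable_const (hm.pow_const 2)),
      Set.inter_comm]
    refine measureReal_mono (Set.inter_subset_inter_left _ fun ω hω => ?_)
    change ε ^ 2 ≤ _
    rw [← sq_abs (_ - _)]
    exact pow_le_pow_left₀ hε.le (le_of_lt hω) 2
  rw [div_mul_eq_mul_div, le_div_iff₀ (by positivity), mul_comm]
  exact (mul_le_mul_of_nonneg_left h3 (by positivity)).trans h2

/-- A union bound over `F`. The test functions are treated jointly because a single partition must
serve the whole net. -/
theorem exists_measureReal_dist_le (lam : Environment d)
    (hlam : ∀ t x y, Nbr x y → lam.rate t x y ≤ α) (F : Finset 𝓢(Space d, ℝ)) :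
    ∃ K : ℝ, 0 ≤ K ∧ ∀ (N : ℕ+) {Ω : Type*} [mΩ : MeasurableSpace Ω] (P : Measure Ω)
      [IsProbabilityMeasure P] (𝓕 : Filtration ℝ≥0 mΩ) (η : ℝ≥0 → Ω → Config d),
      IsSSEP lam P 𝓕 η → ∀ (t h : ℝ≥0), h ≤ 1 →
      ∀ A : Set Ω, MeasurableSet[𝓕 (t * (N : ℝ≥0) ^ 2)] A → ∀ ε : ℝ, 0 < ε →
      P.real (A ∩ {ω | ε < dist (fun G : F => densityField N η (t + h) ω G)
        (fun G : F => densityField N η t ω G)}) ≤ K * √h / ε ^ 2 * P.real A := by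
  choose K hK0 hK using exists_measureReal_increment_le lam hlam
  refine ⟨∑ G ∈ F, K G, Finset.sum_nonneg fun G _ => hK0 G,
    fun N Ω mΩ P _ 𝓕 η hη t h hh A hA ε hε => ?_⟩
  have hsub : A ∩ {ω | ε < dist (fun G : F => densityField N η (t + h) ω G)
        (fun G : F => densityField N η t ω G)} ⊆
      ⋃ G ∈ F, A ∩ {ω | ε < |densityField N η (t + h) ω G - densityField N η t ω G|} := by
    rintro ω ⟨hωA, hω⟩
    by_contra hcon
    refine absurd hω (not_lt.2 ((dist_pi_le_iff hε.le).2 fun G => ?_))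
    by_contra hG
    exact hcon (Set.mem_iUnion₂.2 ⟨G, G.2, hωA, not_le.1 hG⟩)
  calc _ ≤ P.real (⋃ G ∈ F, A ∩
        {ω | ε < |densityField N η (t + h) ω G - densityField N η t ω G|}) :=
      measureReal_mono hsub (measure_ne_top _ _)
    _ ≤ ∑ G ∈ F, P.real
        (A ∩ {ω | ε < |densityField N η (t + h) ω G - densityField N η t ω G|}) :=
      measureReal_biUnion_finset_le _ _
    _ ≤ ∑ G ∈ F, K G * √h / ε ^ 2 * P.real A :=
      Finset.sum_le_sum fun G _ => hK G N P 𝓕 η hη t h hh A hA ε hε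
    _ = _ := by rw [Finset.sum_mul, Finset.sum_div, Finset.sum_mul]

theorem exists_nat_mul_sqrt_le (T : ℝ≥0) (K : ℝ) {ρ : ℝ} (hρ : 0 < ρ) :
    ∃ q : ℕ, 0 < q ∧ T / q ≤ 1 ∧ K * √((T / q : ℝ≥0) : ℝ) ≤ ρ := by
  have h1 : Tendsto (fun q : ℕ => T / (q : ℝ≥0)) atTop (𝓝 0) :=
    tendsto_const_div_atTop_nhds_zero_nat T
  have h2 : Tendsto (fun q : ℕ => K * √((T / q : ℝ≥0) : ℝ)) atTop (𝓝 0) := by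
    have := (((NNReal.continuous_coe.tendsto 0).comp h1).sqrt).const_mul K
    simpa using this
  obtain ⟨q, hq0, hq1, hq2⟩ := ((eventually_gt_atTop 0).and
    ((h1.eventually_le_const zero_lt_one).and (h2.eventually_le_const hρ))).exists
  exact ⟨q, hq0, hq1, hq2⟩

theorem exists_measure_not_hasPartition_netClose_le (lam : Environment d)
    (hlam : ∀ t x y, Nbr x y → lam.rate t x y ≤ α) {T : ℝ≥0} (hT : 0 < T) (n : ℕ) {γ : ℝ}
    (hγ : 0 < γ) :
    ∃ δ : ℝ≥0, 0 < δ ∧ ∀ (N : ℕ+) {Ω : Type*} [mΩ : MeasurableSpace Ω] (P : Measure Ω)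
      [IsProbabilityMeasure P] (𝓕 : Filtration ℝ≥0 mΩ) (η : ℝ≥0 → Ω → Config d),
      IsSSEP lam P 𝓕 η →
      P {ω | ¬ HasPartition T δ (NetClose d n) fun s => densityField N η s ω} ≤
        ENNReal.ofReal γ := by
  obtain ⟨K, hK0, hK⟩ := exists_measureReal_dist_le lam hlam (testNet d n)
  -- The partition has oscillation `2 * (4 * ε)`, which is the tolerance `1 / (n + 1)` of the net.
  -- Then `q₀` makes the coarse bound `1 / 4`, and `ψ` is chosen so that `4 * ψ * (q₀ + 2) ≤ γ`.
  set ε : ℝ := 1 / (8 * ((n : ℝ) + 1)) with hε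
  have hε0 : 0 < ε := by positivity
  obtain ⟨q₀, hq₀, hq₀1, hq₀2⟩ := exists_nat_mul_sqrt_le T (K / ε ^ 2) (ρ := 1 / 4) (by norm_num)
  set ψ : ℝ := min (1 / 2) (γ / (4 * (q₀ + 2))) with hψ
  have hψ0 : 0 < ψ := by positivity
  obtain ⟨q, hq, hq1, hq2⟩ := exists_nat_mul_sqrt_le T (K / ε ^ 2) hψ0
  refine ⟨T / q, by positivity, fun N Ω mΩ P _ 𝓕 η hη => ?_⟩
  let 𝒢 : Filtration ℝ≥0 mΩ :=
    { seq := fun t => 𝓕 (t * (N : ℝ≥0) ^ 2)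
      mono' := fun s t hst => 𝓕.mono (mul_le_mul_left hst _)
      le' := fun t => 𝓕.le _ }
  have hsmall : ∀ (b : ℝ≥0) (c : ℝ), b ≤ 1 → K / ε ^ 2 * √(b : ℝ) ≤ c → ∀ t h : ℝ≥0, h ≤ b →
      ∀ A, MeasurableSet[𝒢 t] A → P.real (A ∩ {ω | ε < dist
        (fun G : testNet d n => densityField N η (t + h) ω G)
        (fun G : testNet d n => densityField N η t ω G)}) ≤ c * P.real A := by
    intro b c hb hc t h hh A hA
    refine (hK N P 𝓕 η hη t h (hh.trans hb) A hA ε hε0).trans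
      (mul_le_mul_of_nonneg_right (le_trans ?_ hc) measureReal_nonneg)
    rw [mul_div_right_comm]
    exact mul_le_mul_of_nonneg_left (Real.sqrt_le_sqrt (NNReal.coe_le_coe.2 hh)) (by positivity)
  have hright : ∀ ω (t : ℝ≥0),
      ContinuousWithinAt (fun t : ℝ≥0 => η (t * (N : ℝ≥0) ^ 2) ω) (Set.Ici t) t := fun ω t =>
    ContinuousWithinAt.comp (g := fun t => η t ω) (f := fun t : ℝ≥0 => t * (N : ℝ≥0) ^ 2)
      (t := Set.Ici (t * (N : ℝ≥0) ^ 2)) (hη.cadlag ω (t * (N : ℝ≥0) ^ 2)).1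
      (continuous_id.mul continuous_const).continuousWithinAt fun s hs =>
        show t * _ ≤ s * _ from mul_le_mul_left hs _
  have hmeas : Measurable fun (ξ : Config d) (G : testNet d n) =>
      empiricalField N ξ (G : 𝓢(Space d, ℝ)) :=
    measurable_pi_lambda _ fun G => measurable_empiricalField N G.1
  have hmain := measure_not_hasPartition_le (P := P) (𝒢 := 𝒢)
    (Y := fun t ω (G : testNet d n) => densityField N η t ω G)
    (fun t => hmeas.comp (hη.adapted (t * (N : ℝ≥0) ^ 2)))
    (fun ω t => continuousWithinAt_pi.2 fun G =>
      ((continuous_eval_const G.1).comp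
        (continuous_empiricalField N)).continuousAt.comp_continuousWithinAt (hright ω t))
    hT hε0.le hq₀ hq hψ0.le (min_le_left _ _) (hsmall _ _ hq₀1 hq₀2) (hsmall _ _ hq1 hq2)
  refine (measure_mono ?_).trans (hmain.trans (ENNReal.ofReal_le_ofReal ?_))
  · intro ω hω hpart
    obtain ⟨t, ht, h⟩ := hpart
    refine hω ⟨t, ht, fun i s s' h1 h2 h1' h2' G hG => ?_⟩
    have h3 := (dist_le_pi_dist _ _ (⟨G, hG⟩ : testNet d n)).trans (h i s s' h1 h2 h1' h2')
    refine h3.trans_eq ?_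
    rw [hε]; field_simp; norm_num
  · have h1 : ψ ≤ γ / (4 * (q₀ + 2)) := min_le_right _ _
    rw [le_div_iff₀ (by positivity)] at h1
    linarith

theorem isTightInSkorokhod_densityField (lam : Environment d)
    (hlam : ∀ t x y, Nbr x y → lam.rate t x y ≤ α)
    {Ω : ℕ+ → Type*} [mΩ : ∀ N, MeasurableSpace (Ω N)]
    (P : ∀ N, Measure (Ω N)) [∀ N, IsProbabilityMeasure (P N)]
    (𝓕 : ∀ N, Filtration ℝ≥0 (mΩ N)) (η : ∀ N, ℝ≥0 → Ω N → Config d)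
    (hη : ∀ N, IsSSEP lam (P N) (𝓕 N) (η N)) {T : ℝ≥0} (hT : 0 < T) :
    IsTightInSkorokhod T P (fun N => densityField N (η N)) := by
  intro ε hε
  obtain ⟨γ, hγ0, hγ⟩ := ENNReal.exists_pos_sum_of_countable hε.ne' ℕ
  obtain ⟨C, hC0, hC⟩ := exists_abs_empiricalField_le d
  choose δ hδ0 hδ using fun n =>
    exists_measure_not_hasPartition_netClose_le lam hlam hT n (NNReal.coe_pos.2 (hγ0 n))
  refine ⟨_, isCompact_skorokhod (isCompact_functionalBall d hC0) (isClosed_netClose d)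
    (fun U hU => exists_netClose_subset hU) hδ0, fun N => ?_⟩
  calc _ ≤ P N (⋃ n, {ω | ¬ HasPartition T (δ n) (NetClose d n)
        fun s => densityField N (η N) s ω}) := measure_mono fun ω hω => by
        by_contra hcon
        refine hω ⟨⟨_, isCadlag_densityField N ((hη N).cadlag ω) T⟩,
          ⟨fun t => hC N _, fun n => ?_⟩, fun t => rfl⟩
        by_contra hn
        exact hcon (Set.mem_iUnion.2 ⟨n, hn⟩)
    _ ≤ ∑' n, P N {ω | ¬ HasPartition T (δ n) (NetClose d n)
        fun s => densityField N (η N) s ω} := measure_iUnion_le _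
    _ ≤ ∑' n, (γ n : ℝ≥0∞) := ENNReal.tsum_le_tsum fun n =>
        (hδ n N (P N) (𝓕 N) (η N) (hη N)).trans_eq (ENNReal.ofReal_coe_nnreal)
    _ ≤ ε := hγ.le

/-- The increment bounds hold on all events of the particle filtration at the rescaled time, hence
on those generated by the field. -/
theorem fieldFiltration_le (N : ℕ+) {Ω : Type*} [mΩ : MeasurableSpace Ω] {η : ℝ≥0 → Ω → Config d}
    {𝓕 : Filtration ℝ≥0 mΩ} (hη : ∀ t, Measurable (η t)) (ha : ∀ t, Measurable[𝓕 t] (η t))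
    (t : ℝ≥0) : fieldFiltration N hη t ≤ 𝓕 (t * (N : ℝ≥0) ^ 2) :=
  iSup₂_le fun s hs => iSup_le fun G => Measurable.comap_le
    ((measurable_empiricalField N G).comp ((ha (s * (N : ℝ≥0) ^ 2)).mono
      (𝓕.mono (mul_le_mul_left hs _)) le_rfl))

end Tightness

theorem proposition5p5 {d : ℕ} (hd : 1 ≤ d) (lam : Environment d)
    (α : ℝ) (hlam : ∀ t x y, Nbr x y → lam.rate t x y ≤ α)
    {Ω : ℕ+ → Type*} [mΩ : ∀ N, MeasurableSpace (Ω N)]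
    (P : ∀ N, Measure (Ω N)) [∀ N, IsProbabilityMeasure (P N)]
    (𝓕 : ∀ N, Filtration ℝ≥0 (mΩ N)) (η : ∀ N, ℝ≥0 → Ω N → Config d)
    (hη : ∀ N, IsSSEP lam (P N) (𝓕 N) (η N))
    (T : ℝ≥0) (hT : 0 < T) :
    (∀ G : 𝓢(Space d, ℝ),
      -- (T1)
      (∀ t ≤ T, Tendsto (fun m : ℝ =>
        limsup (fun N : ℕ+ => P N {ω | m < |densityField N (η N) t ω G|}) atTop) atTop (𝓝 0)) ∧
      -- (T2)
      (∀ ε : ℝ, 0 < ε → ∃ (hε : ℝ≥0) (Nε : ℕ+) (ψN : ℕ+ → ℝ≥0 → ℝ≥0) (ψ : ℝ≥0 → ℝ≥0)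
          (φ : ℕ+ → ℝ≥0), 0 < hε ∧
        (∀ N ≥ Nε, MonotoneOn (ψN N) (Set.Icc 0 hε)) ∧
        (∀ N ≥ Nε, ∀ h ≤ hε, ∀ t ≤ T, ∀ᵐ ω ∂(P N),
          ((P N)⟦{ω' | ε < |densityField N (η N) (t + h) ω' G - densityField N (η N) t ω' G|} |
            fieldFiltration N (hη N).measurable t⟧) ω ≤ ψN N h) ∧
        (∀ N ≥ Nε, ∀ h ≤ hε, ψN N h ≤ ψ h + φ N) ∧
        Tendsto φ atTop (𝓝 0) ∧
        Tendsto ψ (𝓝[>] 0) (𝓝 0))) ∧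
    -- tightness in `D([0,T], 𝓢'(ℝ^d))`
    IsTightInSkorokhod T P (fun N => densityField N (η N)) := by
  refine ⟨fun G => ⟨fun t _ => ?_, fun ε hε => ?_⟩,
    isTightInSkorokhod_densityField lam hlam P 𝓕 η hη hT⟩
  · obtain ⟨C, hC0, hC⟩ := exists_abs_empiricalField_le d
    obtain ⟨M, hM0, hM, -⟩ := exists_schwartz_bound G (d + 1)
    refine tendsto_const_nhds.congr' ?_
    filter_upwards [eventually_ge_atTop (C * M)] with m hm
    have : ∀ N : ℕ+, P N {ω | m < |densityField N (η N) t ω G|} = 0 := fun N => by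
      have : {ω | m < |densityField N (η N) t ω G|} = ∅ :=
        Set.eq_empty_of_forall_notMem fun ω hω => absurd hω (not_lt.2 ((hC N _ G M hM).trans hm))
      rw [this, measure_empty]
    simp only [this, limsup_const]
  · obtain ⟨K, hK0, hK⟩ := exists_measureReal_increment_le lam hlam G
    let ψ : ℝ≥0 → ℝ≥0 := fun h => (K * √h / ε ^ 2).toNNReal
    have hψ : ∀ h : ℝ≥0, (ψ h : ℝ) = K * √h / ε ^ 2 := fun h =>
      Real.coe_toNNReal _ (by positivity)
    have hmono : Monotone ψ := fun a b hab => Real.toNNReal_le_toNNReal (by gcongr)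
    -- The bound `K * √h / ε ^ 2` holds for every `N` and `h ≤ 1`, so no error term in `N` is
    -- needed.
    refine ⟨1, 1, fun _ => ψ, ψ, fun _ => 0, one_pos, fun N _ => hmono.monotoneOn _,
      fun N _ h hh t _ => ?_, fun N _ h _ => (add_zero _).ge, tendsto_const_nhds, ?_⟩
    · rw [hψ]
      refine condExp_indicator_le ((fieldFiltration N (hη N).measurable).le t) ?_ fun A hA =>
        hK N (P N) (𝓕 N) (η N) (hη N) t h hh A
          (fieldFiltration_le N (hη N).measurable (hη N).adapted t A hA) ε hε
      exact measurableSet_lt measurable_const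
        ((measurable_densityField N (hη N).measurable _ G).sub
          (measurable_densityField N (hη N).measurable _ G)).abs
    · have hc : Continuous ψ := continuous_real_toNNReal.comp
        (((continuous_const.mul NNReal.continuous_coe.sqrt)).div_const _)
      have h0 : ψ 0 = 0 := by simp [ψ]
      have := hc.tendsto 0
      rw [h0] at this
      exact this.mono_left nhdsWithin_le_nhds
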